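/- Conventions. A manifold is a smooth ($C^\infty$), finite-dimensional, Hausdorff, paracompact, connected manifold without boundary. Let $(M,\nabla)$ be a manifold with a smooth linear connection. A geodesic is a solution $\gamma:J\to M$ of $\nabla_{\gamma'}\gamma'=0$ on an open interval $J$; it is inextendible if it is not the restriction of a geodesic on a larger interval. * $T'M$ is the tangent bundle less its zero section, and $PM$ is the quotient of $T'M$ by proportionality of vectors at the same point (the space of tangent lines). The space of geodesics $G(M)$ is the quotient space of $PM$ obtained by identifying any two tangent lines that lie on the lift of a common inextendible geodesic. * $G(M)$ is a manifold if it is Hausdorff, paracompact and connected (the empty space, which occurs for $\dim M=0$, being allowed), and carries a smooth atlas modelled on some $\mathbb R^d$ for which the natural projection $T'M\to G(M)$ is a smooth submersion. * $(M,\nabla)$ is nonreturning if each point of $M$ has arbitrarily small neighborhoods $U$ such that no inextendible geodesic returns to $U$ after having left it. * $(M,\nabla)$ is pseudoconvex if for every compact $K\subseteq M$ there is a compact $K'\subseteq M$ such that every geodesic segment with both endpoints in $K$ lies entirely in $K'$. Theorem. Let $(M_1,\nabla_1)$ and $(M_2,\nabla_2)$ be manifolds with smooth linear connections, and suppose that the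 product $(M_1\times M_2,\nabla_1\times\nabla_2)$ is nonreturning. Then the following are equivalent: 1. $G(M_1\times M_2)$ is Hausdorff; 2. $G(M_1\times M_2)$ is a manifold; 3. $(M_1\times M_2,\nabla_1\times\nabla_2)$ is pseudoconvex; 4. $G(M_1)$ and $G(M_2)$ are Hausdorff; 5. $G(M_1)$ and $G(M_2)$ are manifolds; 6. $(M_1,\nabla_1)$ and $(M_2,\nabla_2)$ are pseudoconvex. -/

import Mathlib

open Bundle Set Topology
open scoped Manifold ContDiff

noncomputable section

namespace GeodesicSpace

/-! ### The product of two linear connections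

A linear connection on `M` is a `CovariantDerivative I E (TangentSpace I : M → Type _)`;
`∇ Y x u` is the covariant derivative at `x` of the vector field `Y` in the direction `u`. -/

section Slices

variable {E₁ : Type*} [NormedAddCommGroup E₁] [NormedSpace ℝ E₁]
  {H₁ : Type*} [TopologicalSpace H₁] {I₁ : ModelWithCorners ℝ E₁ H₁}
  {M₁ : Type*} [TopologicalSpace M₁] [ChartedSpace H₁ M₁]
  {E₂ : Type*} [NormedAddCommGroup E₂] [NormedSpace ℝ E₂]
  {H₂ : Type*} [TopologicalSpace H₂] {I₂ : ModelWithCorners ℝ E₂ H₂}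
  {M₂ : Type*} [TopologicalSpace M₂] [ChartedSpace H₂ M₂]

/-- The chain rule for a scalar function on `M₁ × M₂` along the two slices through `x`. -/
lemma mvfderiv_slices {g : M₁ × M₂ → ℝ} {x : M₁ × M₂}
    (hg : MDifferentiableAt (I₁.prod I₂) 𝓘(ℝ, ℝ) g x) (u : E₁ × E₂) :
    mvfderiv (I₁.prod I₂) g x u =
      mvfderiv I₁ (fun y => g (y, x.2)) x.1 u.1 + mvfderiv I₂ (fun y => g (x.1, y)) x.2 u.2 :=
  mfderiv_prod_eq_add_apply hg

end Slices

section Product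

variable {E₁ : Type*} [NormedAddCommGroup E₁] [NormedSpace ℝ E₁]
  {H₁ : Type*} [TopologicalSpace H₁] {I₁ : ModelWithCorners ℝ E₁ H₁}
  {M₁ : Type*} [TopologicalSpace M₁] [ChartedSpace H₁ M₁] [IsManifold I₁ 1 M₁]
  {E₂ : Type*} [NormedAddCommGroup E₂] [NormedSpace ℝ E₂]
  {H₂ : Type*} [TopologicalSpace H₂] {I₂ : ModelWithCorners ℝ E₂ H₂}
  {M₂ : Type*} [TopologicalSpace M₂] [ChartedSpace H₂ M₂] [IsManifold I₂ 1 M₂]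

/-- For a vector field `Y` on `M₁ × M₂` and `x₂ : M₂`, the vector field on `M₁` formed by the
`M₁`-components of `Y` on the slice `M₁ × {x₂}`. -/
def sliceFst (Y : Π x : M₁ × M₂, TangentSpace (I₁.prod I₂) x) (x₂ : M₂) :
    Π x₁ : M₁, TangentSpace I₁ x₁ := fun x₁ => (Y (x₁, x₂)).1

/-- For a vector field `Y` on `M₁ × M₂` and `x₁ : M₁`, the vector field on `M₂` formed by the
`M₂`-components of `Y` on the slice `{x₁} × M₂`. -/
def sliceSnd (Y : Π x : M₁ × M₂, TangentSpace (I₁.prod I₂) x) (x₁ : M₁) :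
    Π x₂ : M₂, TangentSpace I₂ x₂ := fun x₂ => (Y (x₁, x₂)).2

/-- For a vector field `Y` on `M₁ × M₂` and `x₁ : M₁`, the `M₁`-components of `Y` along the slice
`{x₁} × M₂`: a function from `M₂` to the fixed vector space `T_{x₁} M₁`. -/
def vertFst (Y : Π x : M₁ × M₂, TangentSpace (I₁.prod I₂) x) (x₁ : M₁) :
    M₂ → E₁ := fun x₂ => (Y (x₁, x₂)).1

/-- For a vector field `Y` on `M₁ × M₂` and `x₂ : M₂`, the `M₂`-components of `Y` along the slice
`M₁ × {x₂}`: a function from `M₁` to the fixed vector space `T_{x₂} M₂`. -/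
def vertSnd (Y : Π x : M₁ × M₂, TangentSpace (I₁.prod I₂) x) (x₂ : M₂) :
    M₁ → E₂ := fun x₁ => (Y (x₁, x₂)).2

/-- The operator of the product connection: with `u = (u₁, u₂)` and `Y = (Y₁, Y₂)`,
`(∇_u Y)(x₁, x₂)` has the components
`∇¹_{u₁} (Y₁(·, x₂)) + d(Y₁(x₁, ·))(u₂)` and `∇²_{u₂} (Y₂(x₁, ·)) + d(Y₂(·, x₂))(u₁)`. -/
def prodCovFun
    (D₁ : CovariantDerivative I₁ E₁ (TangentSpace I₁ : M₁ → Type _))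
    (D₂ : CovariantDerivative I₂ E₂ (TangentSpace I₂ : M₂ → Type _))
    (Y : Π x : M₁ × M₂, TangentSpace (I₁.prod I₂) x) (x : M₁ × M₂) :
    (E₁ × E₂) →L[ℝ] (E₁ × E₂) :=
  let A₁ : E₁ →L[ℝ] E₁ := D₁ (sliceFst Y x.2) x.1
  let B₁ : E₂ →L[ℝ] E₁ := mvfderiv I₂ (vertFst Y x.1) x.2
  let A₂ : E₂ →L[ℝ] E₂ := D₂ (sliceSnd Y x.1) x.2
  let B₂ : E₁ →L[ℝ] E₂ := mvfderiv I₁ (vertSnd Y x.2) x.1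
  (A₁.coprod B₁).prod (B₂.coprod A₂)

lemma mdifferentiableAt_sliceFst {Y : Π x : M₁ × M₂, TangentSpace (I₁.prod I₂) x}
    {x : M₁ × M₂} (hY : MDiffAt (T% Y) x) : MDiffAt (T% (sliceFst Y x.2)) x.1 := by
  have h1 := (contMDiff_equivTangentBundleProd (I := I₁) (M := M₁) (I' := I₂) (M' := M₂)
    (n := 1)).mdifferentiable one_ne_zero
  have h3 := (h1 (T% Y x)).comp x hY
  have h4 : MDifferentiableAt I₁ (I₁.prod I₂) (fun y : M₁ => (y, x.2)) x.1 :=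
    mdifferentiableAt_id.prodMk mdifferentiableAt_const
  exact (MDifferentiableAt.comp x.1 (f := fun y : M₁ => (y, x.2)) h3 h4).fst

lemma mdifferentiableAt_sliceSnd {Y : Π x : M₁ × M₂, TangentSpace (I₁.prod I₂) x}
    {x : M₁ × M₂} (hY : MDiffAt (T% Y) x) : MDiffAt (T% (sliceSnd Y x.1)) x.2 := by
  have h1 := (contMDiff_equivTangentBundleProd (I := I₁) (M := M₁) (I' := I₂) (M' := M₂)
    (n := 1)).mdifferentiable one_ne_zero
  have h3 := (h1 (T% Y x)).comp x hY
  have h4 : MDifferentiableAt I₂ (I₁.prod I₂) (fun y : M₂ => (x.1, y)) x.2 :=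
    mdifferentiableAt_const.prodMk mdifferentiableAt_id
  exact (MDifferentiableAt.comp x.2 (f := fun y : M₂ => (x.1, y)) h3 h4).snd

lemma trivializationAt_snd_self {E : Type*} [NormedAddCommGroup E] [NormedSpace ℝ E]
    {H : Type*} [TopologicalSpace H] {I : ModelWithCorners ℝ E H}
    {M : Type*} [TopologicalSpace M] [ChartedSpace H M] [IsManifold I 1 M]
    (x : M) (v : TangentSpace I x) :
    (trivializationAt E (TangentSpace I) x (⟨x, v⟩ : TangentBundle I M)).2 = v := by
  have := tangentCoordChange_self (I := I) (x := x) (z := x) (v := v)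
    (mem_extChartAt_source x)
  exact this

lemma mdifferentiableAt_vertFst {Y : Π x : M₁ × M₂, TangentSpace (I₁.prod I₂) x}
    {x : M₁ × M₂} (hY : MDiffAt (T% Y) x) :
    MDifferentiableAt I₂ 𝓘(ℝ, E₁) (vertFst Y x.1) x.2 := by
  have h1 := (contMDiff_equivTangentBundleProd (I := I₁) (M := M₁) (I' := I₂) (M' := M₂)
    (n := 1)).mdifferentiable one_ne_zero
  have h3 := (h1 (T% Y x)).comp x hY
  have h4 : MDifferentiableAt I₂ (I₁.prod I₂) (fun y : M₂ => (x.1, y)) x.2 :=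
    mdifferentiableAt_const.prodMk mdifferentiableAt_id
  have h5 := (MDifferentiableAt.comp x.2 (f := fun y : M₂ => (x.1, y)) h3 h4).fst
  have h6 := ((mdifferentiableAt_totalSpace (E := (TangentSpace I₁ : M₁ → Type _)) I₁ _).1 h5).2
  have h7 : vertFst Y x.1 = fun y => (trivializationAt E₁ (TangentSpace I₁) x.1
      (⟨x.1, (Y (x.1, y)).1⟩ : TangentBundle I₁ M₁)).2 :=
    funext fun y => (trivializationAt_snd_self (I := I₁) x.1 (Y (x.1, y)).1).symm
  rw [h7]
  exact h6

lemma mdifferentiableAt_vertSnd {Y : Π x : M₁ × M₂, TangentSpace (I₁.prod I₂) x}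
    {x : M₁ × M₂} (hY : MDiffAt (T% Y) x) :
    MDifferentiableAt I₁ 𝓘(ℝ, E₂) (vertSnd Y x.2) x.1 := by
  have h1 := (contMDiff_equivTangentBundleProd (I := I₁) (M := M₁) (I' := I₂) (M' := M₂)
    (n := 1)).mdifferentiable one_ne_zero
  have h3 := (h1 (T% Y x)).comp x hY
  have h4 : MDifferentiableAt I₁ (I₁.prod I₂) (fun y : M₁ => (y, x.2)) x.1 :=
    mdifferentiableAt_id.prodMk mdifferentiableAt_const
  have h5 := (MDifferentiableAt.comp x.1 (f := fun y : M₁ => (y, x.2)) h3 h4).snd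
  have h6 := ((mdifferentiableAt_totalSpace (E := (TangentSpace I₂ : M₂ → Type _)) I₂ _).1 h5).2
  have h7 : vertSnd Y x.2 = fun y => (trivializationAt E₂ (TangentSpace I₂) x.2
      (⟨x.2, (Y (y, x.2)).2⟩ : TangentBundle I₂ M₂)).2 :=
    funext fun y => (trivializationAt_snd_self (I := I₂) x.2 (Y (y, x.2)).2).symm
  rw [h7]
  exact h6

/-- The product `∇₁ × ∇₂` of two linear connections. -/
def prodConnection
    (D₁ : CovariantDerivative I₁ E₁ (TangentSpace I₁ : M₁ → Type _))
    (D₂ : CovariantDerivative I₂ E₂ (TangentSpace I₂ : M₂ → Type _)) :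
    CovariantDerivative (I₁.prod I₂) (E₁ × E₂)
      (TangentSpace (I₁.prod I₂) : M₁ × M₂ → Type _) where
  toFun := prodCovFun D₁ D₂
  isCovariantDerivativeOnUniv :=
    { add := by
        intro Y Y' x hY hY' _
        let P : E₁ →L[ℝ] E₁ := D₁ (sliceFst (Y + Y') x.2) x.1
        let P₁ : E₁ →L[ℝ] E₁ := D₁ (sliceFst Y x.2) x.1
        let P₂ : E₁ →L[ℝ] E₁ := D₁ (sliceFst Y' x.2) x.1
        let Q : E₂ →L[ℝ] E₂ := D₂ (sliceSnd (Y + Y') x.1) x.2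
        let Q₁ : E₂ →L[ℝ] E₂ := D₂ (sliceSnd Y x.1) x.2
        let Q₂ : E₂ →L[ℝ] E₂ := D₂ (sliceSnd Y' x.1) x.2
        let R : E₂ →L[ℝ] E₁ := mvfderiv I₂ (vertFst (Y + Y') x.1) x.2
        let R₁ : E₂ →L[ℝ] E₁ := mvfderiv I₂ (vertFst Y x.1) x.2
        let R₂ : E₂ →L[ℝ] E₁ := mvfderiv I₂ (vertFst Y' x.1) x.2
        let S : E₁ →L[ℝ] E₂ := mvfderiv I₁ (vertSnd (Y + Y') x.2) x.1
        let S₁ : E₁ →L[ℝ] E₂ := mvfderiv I₁ (vertSnd Y x.2) x.1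
        let S₂ : E₁ →L[ℝ] E₂ := mvfderiv I₁ (vertSnd Y' x.2) x.1
        have e1 : P = P₁ + P₂ := D₁.isCovariantDerivativeOnUniv.add
          (mdifferentiableAt_sliceFst hY) (mdifferentiableAt_sliceFst hY') trivial
        have e2 : Q = Q₁ + Q₂ := D₂.isCovariantDerivativeOnUniv.add
          (mdifferentiableAt_sliceSnd hY) (mdifferentiableAt_sliceSnd hY') trivial
        have e3 : R = R₁ + R₂ := mvfderiv_add
          (mdifferentiableAt_vertFst hY) (mdifferentiableAt_vertFst hY')
        have e4 : S = S₁ + S₂ := mvfderiv_add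
          (mdifferentiableAt_vertSnd hY) (mdifferentiableAt_vertSnd hY')
        change (P.coprod R).prod (S.coprod Q)
          = (P₁.coprod R₁).prod (S₁.coprod Q₁) + (P₂.coprod R₂).prod (S₂.coprod Q₂)
        rw [e1, e2, e3, e4]
        refine ContinuousLinearMap.ext fun u => Prod.ext ?_ ?_
        · exact add_add_add_comm (P₁ u.1) (P₂ u.1) (R₁ u.2) (R₂ u.2)
        · exact add_add_add_comm (S₁ u.1) (S₂ u.1) (Q₁ u.2) (Q₂ u.2)
      leibniz := by
        intro Y g x hY hg _
        have g1 : MDifferentiableAt I₁ 𝓘(ℝ, ℝ) (fun y => g (y, x.2)) x.1 :=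
          MDifferentiableAt.comp x.1 (f := fun y : M₁ => (y, x.2)) (g := g)
            (I' := I₁.prod I₂) hg (mdifferentiableAt_id.prodMk mdifferentiableAt_const)
        have g2 : MDifferentiableAt I₂ 𝓘(ℝ, ℝ) (fun y => g (x.1, y)) x.2 :=
          MDifferentiableAt.comp x.2 (f := fun y : M₂ => (x.1, y)) (g := g)
            (I' := I₁.prod I₂) hg (mdifferentiableAt_const.prodMk mdifferentiableAt_id)
        let P : E₁ →L[ℝ] E₁ := D₁ (sliceFst (g • Y) x.2) x.1
        let P₁ : E₁ →L[ℝ] E₁ := D₁ (sliceFst Y x.2) x.1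
        let Q : E₂ →L[ℝ] E₂ := D₂ (sliceSnd (g • Y) x.1) x.2
        let Q₁ : E₂ →L[ℝ] E₂ := D₂ (sliceSnd Y x.1) x.2
        let R : E₂ →L[ℝ] E₁ := mvfderiv I₂ (vertFst (g • Y) x.1) x.2
        let R₁ : E₂ →L[ℝ] E₁ := mvfderiv I₂ (vertFst Y x.1) x.2
        let S : E₁ →L[ℝ] E₂ := mvfderiv I₁ (vertSnd (g • Y) x.2) x.1
        let S₁ : E₁ →L[ℝ] E₂ := mvfderiv I₁ (vertSnd Y x.2) x.1
        let a₁ : E₁ →L[ℝ] ℝ := mvfderiv I₁ (fun y => g (y, x.2)) x.1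
        let a₂ : E₂ →L[ℝ] ℝ := mvfderiv I₂ (fun y => g (x.1, y)) x.2
        let a : E₁ × E₂ →L[ℝ] ℝ := mvfderiv (I₁.prod I₂) g x
        let w₁ : E₁ := (Y x).1
        let w₂ : E₂ := (Y x).2
        have e1 : P = g x • P₁ + a₁.smulRight w₁ := D₁.isCovariantDerivativeOnUniv.leibniz
          (mdifferentiableAt_sliceFst hY) g1 trivial
        have e2 : Q = g x • Q₁ + a₂.smulRight w₂ := D₂.isCovariantDerivativeOnUniv.leibniz
          (mdifferentiableAt_sliceSnd hY) g2 trivial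
        have e3 : R = g x • R₁ + a₂.smulRight w₁ :=
          mvfderiv_smul g2 (mdifferentiableAt_vertFst hY)
        have e4 : S = g x • S₁ + a₁.smulRight w₂ :=
          mvfderiv_smul g1 (mdifferentiableAt_vertSnd hY)
        have e5 : ∀ u, a u = a₁ u.1 + a₂ u.2 := mvfderiv_slices hg
        change (P.coprod R).prod (S.coprod Q)
          = g x • (P₁.coprod R₁).prod (S₁.coprod Q₁) + a.smulRight (w₁, w₂)
        rw [e1, e2, e3, e4]
        refine ContinuousLinearMap.ext fun u => Prod.ext ?_ ?_
        · change (g x • P₁ u.1 + a₁ u.1 • w₁) + (g x • R₁ u.2 + a₂ u.2 • w₁)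
            = g x • (P₁ u.1 + R₁ u.2) + a u • w₁
          rw [e5]
          module
        · change (g x • S₁ u.1 + a₁ u.1 • w₂) + (g x • Q₁ u.2 + a₂ u.2 • w₂)
            = g x • (S₁ u.1 + Q₁ u.2) + a u • w₂
          rw [e5]
          module }

end Product

/-! ### Geodesics of a linear connection -/

section Geodesics

variable {E : Type*} [NormedAddCommGroup E] [NormedSpace ℝ E]
  {H : Type*} [TopologicalSpace H] {I : ModelWithCorners ℝ E H}
  {M : Type*} [TopologicalSpace M] [ChartedSpace H M] [IsManifold I 1 M]

/-- The velocity vector `γ'(t)` of a curve. -/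
def velocity (I : ModelWithCorners ℝ E H) (γ : ℝ → M) (t : ℝ) : TangentSpace I (γ t) :=
  mfderiv 𝓘(ℝ, ℝ) I γ t (1 : ℝ)

/-- The covariant derivative at time `t` of a vector field `V` along a curve `γ`. In the local frame
`(e_i)` of `TM` given by the trivialization at `γ t`, and with `V = ∑ Vⁱ e_i`, it is the vector
`∑ (Vⁱ)'(t) e_i + ∑ Vⁱ(t) ∇_{γ'(t)} e_i`; the field `∑ Vⁱ(t) e_i` with constant coefficients
is `FiberBundle.extend E (V t)`. -/
def covDerivAlong (D : CovariantDerivative I E (TangentSpace I : M → Type _))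
    (γ : ℝ → M) (V : Π t : ℝ, TangentSpace I (γ t)) (t : ℝ) : TangentSpace I (γ t) :=
  (trivializationAt E (TangentSpace I) (γ t)).symm (γ t)
      (deriv (fun s : ℝ =>
        (trivializationAt E (TangentSpace I) (γ t) (⟨γ s, V s⟩ : TangentBundle I M)).2) t)
    + D (FiberBundle.extend E (V t)) (γ t) (velocity I γ t)

/-- `γ`, restricted to the nonempty open interval `J`, is a geodesic: `∇_{γ'} γ' = 0` on `J`.
Constant curves are included; values of `γ` outside `J` are irrelevant. -/
structure IsGeodesicOn (D : CovariantDerivative I E (TangentSpace I : M → Type _))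
    (γ : ℝ → M) (J : Set ℝ) : Prop where
  isOpen : IsOpen J
  nonempty : J.Nonempty
  ordConnected : J.OrdConnected
  contMDiffOn : ContMDiffOn 𝓘(ℝ, ℝ) I 2 γ J
  geodesic_eq : ∀ t ∈ J, covDerivAlong D γ (velocity I γ) t = 0

/-- `γ : J → M` is an inextendible geodesic. -/
def IsMaxGeodesicOn (D : CovariantDerivative I E (TangentSpace I : M → Type _))
    (γ : ℝ → M) (J : Set ℝ) : Prop :=
  IsGeodesicOn D γ J ∧
    ∀ (γ' : ℝ → M) (J' : Set ℝ), IsGeodesicOn D γ' J' → J ⊆ J' → EqOn γ γ' J → J' = J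

/-- `(M, ∇)` is nonreturning: every point has arbitrarily small neighborhoods `U` such that no
inextendible geodesic returns to `U` after having left it. -/
def Nonreturning (D : CovariantDerivative I E (TangentSpace I : M → Type _)) : Prop :=
  ∀ p : M, ∀ V ∈ 𝓝 p, ∃ U ∈ 𝓝 p, U ⊆ V ∧
    ∀ (γ : ℝ → M) (J : Set ℝ), IsMaxGeodesicOn D γ J → (J ∩ γ ⁻¹' U).OrdConnected

/-- `(M, ∇)` is pseudoconvex: for every compact `K` there is a compact `K'` which contains every
geodesic segment with both endpoints in `K`. -/
def Pseudoconvex (D : CovariantDerivative I E (TangentSpace I : M → Type _)) : Prop :=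
  ∀ K : Set M, IsCompact K → ∃ K' : Set M, IsCompact K' ∧
    ∀ (γ : ℝ → M) (J : Set ℝ), IsGeodesicOn D γ J → ∀ a ∈ J, ∀ b ∈ J, a ≤ b →
      γ a ∈ K → γ b ∈ K → ∀ t ∈ Icc a b, γ t ∈ K'

/-! ### The space of geodesics -/

variable (I M) in
lemma isOpen_ne_zero : IsOpen {v : TangentBundle I M | v.2 ≠ 0} := by
  rw [isOpen_iff_mem_nhds]
  intro v hv
  let e := trivializationAt E (TangentSpace I : M → Type _) v.1
  have hvs : v ∈ e.source := FiberBundle.mem_trivializationAt_proj_source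
  have hne : (e v).2 ≠ 0 := by
    intro h
    apply hv
    have h1 := trivializationAt_snd_self (I := I) v.1 v.2
    exact h1.symm.trans h
  have hc : ContinuousAt (fun w => (e w).2) v :=
    continuousAt_snd.comp (e.continuousOn.continuousAt (e.open_source.mem_nhds hvs))
  filter_upwards [hc.eventually_ne hne, e.open_source.mem_nhds hvs] with w hw hws h0
  apply hw
  have hb : w.1 ∈ e.baseSet := e.mem_source.1 hws
  have hw' : w = ⟨w.1, 0⟩ := by
    cases w
    simpa using h0
  rw [hw']
  exact (e.linear ℝ hb).map_zero

variable (I M) in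
/-- The reduced tangent bundle `T'M`: the tangent bundle less its zero section. -/
def reducedTangentBundle : TopologicalSpace.Opens (TangentBundle I M) :=
  ⟨{v | v.2 ≠ 0}, isOpen_ne_zero I M⟩

variable (I M) in
/-- Proportionality of nonzero tangent vectors at the same point. -/
def proportionalSetoid : Setoid (reducedTangentBundle I M) where
  r v w := ∃ c : ℝ, c ≠ 0 ∧ (w : TangentBundle I M) = ⟨v.1.1, c • v.1.2⟩
  iseqv :=
    { refl := fun v => ⟨1, one_ne_zero, by simp⟩
      symm := by
        rintro v w ⟨c, hc, h⟩
        refine ⟨c⁻¹, inv_ne_zero hc, ?_⟩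
        rw [h]
        simp [smul_smul, inv_mul_cancel₀ hc]
      trans := by
        rintro u v w ⟨c, hc, h⟩ ⟨d, hd, h'⟩
        refine ⟨d * c, mul_ne_zero hd hc, ?_⟩
        rw [h', h]
        simp [smul_smul] }

variable (I M) in
/-- The projectivized tangent bundle `PM`, whose points are the tangent lines of `M`. -/
def ProjTangentBundle : Type _ := Quotient (proportionalSetoid I M)

/-- The quotient topology on `PM`. -/
instance : TopologicalSpace (ProjTangentBundle I M) :=
  inferInstanceAs (TopologicalSpace (Quotient (proportionalSetoid I M)))

/-- The tangent line spanned by a nonzero tangent vector. -/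
def tangentLine (v : reducedTangentBundle I M) : ProjTangentBundle I M :=
  Quotient.mk (proportionalSetoid I M) v

/-- `ℓ` is the tangent line of `γ` at time `t`. -/
def IsTangentLineAt (γ : ℝ → M) (t : ℝ) (l : ProjTangentBundle I M) : Prop :=
  ∃ h : velocity I γ t ≠ 0,
    l = tangentLine ⟨(⟨γ t, velocity I γ t⟩ : TangentBundle I M), h⟩

/-- Two tangent lines lie on the lift to `PM` of a common inextendible geodesic. This is an
equivalence relation because there is exactly one such lift through each point of `PM`. -/
def OnCommonGeodesic (D : CovariantDerivative I E (TangentSpace I : M → Type _))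
    (l l' : ProjTangentBundle I M) : Prop :=
  ∃ (γ : ℝ → M) (J : Set ℝ), IsMaxGeodesicOn D γ J ∧
    ∃ s ∈ J, ∃ t ∈ J, IsTangentLineAt γ s l ∧ IsTangentLineAt γ t l'

/-- The space of unoriented geodesics `G(M)`. -/
def GeodesicQuotient (D : CovariantDerivative I E (TangentSpace I : M → Type _)) : Type _ :=
  Quot (OnCommonGeodesic D)

/-- The quotient topology on `G(M)`. -/
instance (D : CovariantDerivative I E (TangentSpace I : M → Type _)) :
    TopologicalSpace (GeodesicQuotient D) :=
  inferInstanceAs (TopologicalSpace (Quot (OnCommonGeodesic D)))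

/-- The natural projection `T'M → G(M)`, which sends `v` to the geodesic tangent to `v`. -/
def toGeodesicQuotient (D : CovariantDerivative I E (TangentSpace I : M → Type _))
    (v : reducedTangentBundle I M) : GeodesicQuotient D :=
  Quot.mk (OnCommonGeodesic D) (tangentLine v)

/-- `G(M)` is a manifold: it is Hausdorff, paracompact and connected, and it has a smooth atlas
with values in some `ℝᵈ` for which the natural projection `T'M → G(M)` is a smooth submersion.
(The empty space, which is `G(M)` for `dim M = 0`, counts as connected.) -/
def GeodesicQuotientIsManifold
    (D : CovariantDerivative I E (TangentSpace I : M → Type _)) : Prop :=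
  T2Space (GeodesicQuotient D) ∧ ParacompactSpace (GeodesicQuotient D) ∧
    PreconnectedSpace (GeodesicQuotient D) ∧
    ∃ (d : ℕ) (_ : ChartedSpace (EuclideanSpace ℝ (Fin d)) (GeodesicQuotient D)),
      IsManifold (𝓡 d) ∞ (GeodesicQuotient D) ∧
      ContMDiff I.tangent (𝓡 d) ∞ (toGeodesicQuotient D) ∧
      ∀ v : reducedTangentBundle I M,
        Function.Surjective (mfderiv I.tangent (𝓡 d) (toGeodesicQuotient D) v)

end Geodesics

end GeodesicSpace

end

noncomputable section

namespace GeodesicSpace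

set_option linter.unusedSectionVars false

/-! ### Smooth dependence of solutions of differential equations on initial conditions -/

section SmoothFlow

universe u

variable {K : Type*} [TopologicalSpace K] [CompactSpace K]
  {E F : Type u} [NormedAddCommGroup E] [NormedSpace ℝ E]
  [NormedAddCommGroup F] [NormedSpace ℝ F]

/-! For a single nonreturning connection the Hausdorff property, the manifold property and
pseudoconvexity coincide (`nonreturning_tfae`). The product enters only afterwards, through
pseudoconvexity, the one condition that visibly splits into conditions on the factors.

By `toGeodesicQuotient_eq_iff`, two nonzero vectors define the same geodesic exactly when one is a
nonzero multiple of a flow image of the other. Freezing the time and the factor gives smooth local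
maps that preserve the classes (`exists_holonomy`), so the projection T'M → G(M) is open. Near a
nonzero vector, flow time, scaling and a slice of dimension 2(dim M - 1) together coordinatize TM.
The nonreturning property makes every geodesic meet a small slice at most once, so the slices are
charts of G(M), and G(M) has its smooth structure before any separation is known
(`exists_manifold_structure`). If G(M) is also Hausdorff, second countability of TM yields
paracompactness; connectedness comes from that of M.

Pseudoconvex implies Hausdorff (`t2Space_of_pseudoconvex`): the relation has to be closed. A
nonconstant nonreturning geodesic leaves every compact set in both directions
(`exists_flow_notMem`). The limit geodesic therefore leaves the compact set K' at times a ≤ 0 ≤ b,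
and so do its neighbors. By pseudoconvexity the times joining the related vectors stay in [a, b],
and they have a limit.

Hausdorff implies pseudoconvex (`pseudoconvex_of_t2Space`): pairs of directions over a compact set
form a compact family. Near a pair on one geodesic, all connecting segments stay close to one
compact arc; near a pair on distinct geodesics, disjoint open sets in G(M) exclude connecting
segments altogether.

The geodesics of a product are the pairs of geodesics, constant ones included
(`isGeodesicOn_prod_iff`). So each factor is a totally geodesic slice and inherits the nonreturning
property, and the product is pseudoconvex exactly when both factors are.

The analytic input, a geodesic flow smooth in time and initial vector, comes from the inverse
function theorem in a Banach space of curves. -/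

/-- Composition on the left with a continuous map, as a map of spaces of continuous functions. -/
def postcomp (K : Type*) [TopologicalSpace K] (f : C(E, F)) (g : C(K, E)) : C(K, F) := f.comp g

set_option synthInstance.maxHeartbeats 200000 in
/-- Pointwise application of a continuous family of linear maps to a continuous function. -/
def pointwiseApply (K : Type*) [TopologicalSpace K] [CompactSpace K] (E F : Type u)
    [NormedAddCommGroup E] [NormedSpace ℝ E] [NormedAddCommGroup F] [NormedSpace ℝ F] :
    C(K, E →L[ℝ] F) →L[ℝ] C(K, E) →L[ℝ] C(K, F) :=
  LinearMap.mkContinuous₂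
    (LinearMap.mk₂ ℝ (fun (A : C(K, E →L[ℝ] F)) (h : C(K, E)) =>
        (⟨fun k => A k (h k), by fun_prop⟩ : C(K, F)))
      (fun A A' h => by ext; simp) (fun c A h => by ext; simp)
      (fun A h h' => by ext; simp) (fun c A h => by ext; simp)) 1 (by
    intro A h
    rw [ContinuousMap.norm_le _ (by positivity)]
    intro k
    calc ‖A k (h k)‖ ≤ ‖A k‖ * ‖h k‖ := (A k).le_opNorm _
      _ ≤ ‖A‖ * ‖h‖ := by gcongr <;> exact ContinuousMap.norm_coe_le_norm _ _
      _ = 1 * ‖A‖ * ‖h‖ := by ring)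

set_option synthInstance.maxHeartbeats 200000 in
set_option synthInstance.maxHeartbeats 200000 in
-- The range of `g` is compact, so `f'` is uniformly continuous along it, and the mean value
-- inequality bounds the remainder at all points of `K` with the same constant.
lemma hasFDerivAt_postcomp {f : C(E, F)} {f' : C(E, E →L[ℝ] F)}
    (hf : ∀ x, HasFDerivAt f (f' x) x) (g : C(K, E)) :
    HasFDerivAt (postcomp K f) (pointwiseApply K E F (postcomp K f' g)) g := by
  rw [hasFDerivAt_iff_isLittleO_nhds_zero, Asymptotics.isLittleO_iff]
  intro c hc
  have hK : IsCompact (range g) := isCompact_range g.continuous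
  have h1 := hK.uniformContinuousAt_of_continuousAt f' (fun x _ => f'.continuous.continuousAt)
    (Metric.dist_mem_uniformity hc)
  obtain ⟨δ, hδ, h2⟩ := Metric.mem_uniformity_dist.1 h1
  filter_upwards [Metric.ball_mem_nhds (0 : C(K, E)) hδ] with h hh
  rw [ContinuousMap.norm_le _ (by positivity)]
  intro k
  have hk : ‖h k‖ < δ := (h.norm_coe_le_norm k).trans_lt (by simpa using hh)
  have h3 := (convex_ball (g k) δ).norm_image_sub_le_of_norm_hasFDerivWithin_le'
    (f := f) (f' := fun x => f' x) (φ := f' (g k)) (C := c) (x := g k) (y := g k + h k)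
    (fun x _ => (hf x).hasFDerivWithinAt) (fun x hx => by
      have := h2 (a := g k) (b := x) (by rw [dist_comm]; exact hx) ⟨k, rfl⟩
      rw [← dist_eq_norm, dist_comm]
      exact le_of_lt this) (Metric.mem_ball_self hδ) (by simpa using hk)
  have h4 : ‖f (g k + h k) - f (g k) - f' (g k) (h k)‖ ≤ c * ‖h k‖ := by simpa using h3
  exact h4.trans (mul_le_mul_of_nonneg_left (h.norm_coe_le_norm k) hc.le)

set_option synthInstance.maxHeartbeats 200000 in
-- The derivative of `postcomp K f` is again a composition operator, that of `f'`, followed by a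
-- bounded linear map. The induction must vary `F`, because `f'` takes values in `E →L[ℝ] F`.
lemma contDiff_postcomp_nat (n : ℕ) : ∀ {F : Type u} [NormedAddCommGroup F] [NormedSpace ℝ F]
    (f : C(E, F)), ContDiff ℝ n f → ContDiff ℝ n (postcomp K f) := by
  induction n with
  | zero =>
    intro F _ _ f _
    exact contDiff_zero.2 (ContinuousMap.continuous_postcomp f)
  | succ n ih =>
    intro F _ _ f hf
    obtain ⟨f', h1, h2⟩ := contDiff_succ_iff_hasFDerivAt.1 hf
    refine contDiff_succ_iff_hasFDerivAt.2
      ⟨fun g => pointwiseApply K E F (postcomp K ⟨f', h1.continuous⟩ g), ?_,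
        fun g => hasFDerivAt_postcomp h2 g⟩
    exact (pointwiseApply K E F).contDiff.comp (ih ⟨f', h1.continuous⟩ h1)

/-- Composition on the left with a smooth map is smooth. -/
lemma contDiff_postcomp (f : C(E, F)) (hf : ContDiff ℝ ∞ f) : ContDiff ℝ ∞ (postcomp K f) :=
  contDiff_infty.2 fun n => contDiff_postcomp_nat n f (contDiff_infty.1 hf n)

/-- The closed interval `[-1, 1]`. -/
abbrev SymmInterval : Type := Icc (-1 : ℝ) 1

/-- Integration from `0` of a continuous function on `[-1, 1]`. -/
def integralFromZero (E : Type u) [NormedAddCommGroup E] [NormedSpace ℝ E] :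
    C(SymmInterval, E) →L[ℝ] C(SymmInterval, E) :=
  LinearMap.mkContinuous
    { toFun := fun g => ⟨fun t => ∫ s in (0 : ℝ)..t, IccExtend (by norm_num) g s, by
        have := intervalIntegral.continuous_primitive (a := (0 : ℝ))
          (f := IccExtend (by norm_num : (-1 : ℝ) ≤ 1) g) (μ := MeasureTheory.volume)
          (fun a b => (g.continuous.Icc_extend' (h := by norm_num)).intervalIntegrable a b)
        exact this.comp continuous_subtype_val⟩
      map_add' := fun g h => by
        ext t
        exact intervalIntegral.integral_add
          ((g.continuous.Icc_extend' (h := by norm_num)).intervalIntegrable _ _)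
          ((h.continuous.Icc_extend' (h := by norm_num)).intervalIntegrable _ _)
      map_smul' := fun c g => by
        ext t
        exact intervalIntegral.integral_smul c _ } 1 (by
    intro g
    rw [ContinuousMap.norm_le _ (by positivity)]
    intro t
    have := intervalIntegral.norm_integral_le_of_norm_le_const (a := (0 : ℝ)) (b := t) (C := ‖g‖)
      (f := IccExtend (by norm_num : (-1 : ℝ) ≤ 1) g) (fun x _ => g.norm_coe_le_norm _)
    refine this.trans ?_
    have h1 : |(t : ℝ) - 0| ≤ 1 := by rw [sub_zero, abs_le]; exact t.2
    nlinarith [norm_nonneg g])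

/-- Inverse function theorem on a whole neighborhood: invertible derivatives form an open set, so
the source can be shrunk until the inverse is smooth at every target point. Smoothness is assumed
near `a` because `ContDiffAt ℝ ∞` at `a` alone gives no neighborhood common to all orders. -/
lemma exists_openPartialHomeomorph_contDiffOn {X Y : Type*} [NormedAddCommGroup X]
    [NormedSpace ℝ X] [CompleteSpace X] [NormedAddCommGroup Y] [NormedSpace ℝ Y] {G : X → Y} {a : X}
    (hG : ∀ᶠ x in 𝓝 a, ContDiffAt ℝ ∞ G x) {G' : X ≃L[ℝ] Y}
    (hG' : HasFDerivAt G (G' : X →L[ℝ] Y) a) :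
    ∃ e : OpenPartialHomeomorph X Y, a ∈ e.source ∧ ⇑e = G ∧
      ContDiffOn ℝ ∞ e e.source ∧ ContDiffOn ℝ ∞ e.symm e.target := by
  have ha := hG.self_of_nhds
  let e₀ := ha.toOpenPartialHomeomorph G hG' (by simp)
  have he₀ : ⇑e₀ = G := rfl
  have hc : ContinuousAt (fderiv ℝ G) a := by
    have := ha.fderiv_right (m := 0) (by norm_num)
    exact this.continuousAt
  have h1 : ∀ᶠ x in 𝓝 a, ∃ A : X ≃L[ℝ] Y, (A : X →L[ℝ] Y) = fderiv ℝ G x := by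
    have h2 := ContinuousLinearEquiv.nhds G'
    rw [← hG'.fderiv] at h2
    exact hc h2
  obtain ⟨s, hs, hso, has⟩ := eventually_nhds_iff.1 (hG.and h1)
  refine ⟨e₀.restrOpen s hso, ⟨ha.mem_toOpenPartialHomeomorph_source hG' (by simp), has⟩, rfl,
    fun x hx => (hs x hx.2).1.contDiffWithinAt, fun y hy => ?_⟩
  set x := (e₀.restrOpen s hso).symm y with hx
  have hxs : x ∈ (e₀.restrOpen s hso).source := (e₀.restrOpen s hso).map_target hy
  obtain ⟨h3, A, hA⟩ := hs x hxs.2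
  refine ((e₀.restrOpen s hso).contDiffAt_symm hy (f₀' := A) ?_ h3).contDiffWithinAt
  rw [hA]
  exact (h3.differentiableAt (by simp)).hasFDerivAt

/-- Multiplication by an element of `[-1, 1]`. -/
def scaleMap (s : SymmInterval) : C(SymmInterval, SymmInterval) :=
  ⟨fun t => ⟨s * t, by
    have h : |(s : ℝ) * t| ≤ 1 := by
      rw [abs_mul]
      exact mul_le_one₀ (abs_le.2 s.2) (abs_nonneg _) (abs_le.2 t.2)
    exact abs_le.1 h⟩, by fun_prop⟩

/-- A smooth vector field has smooth local flows. -/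
lemma exists_smooth_flow_of_contDiff [CompleteSpace E] (f : C(E, E)) (hf : ContDiff ℝ ∞ f)
    (x₀ : E) :
    ∃ δ > 0, ∃ Φ : ℝ × E → E, ContDiffOn ℝ ∞ Φ (Metric.ball 0 δ ×ˢ Metric.ball x₀ δ) ∧
      ∀ x ∈ Metric.ball x₀ δ, Φ (0, x) = x ∧
        ∀ t ∈ Metric.ball (0 : ℝ) δ, HasDerivAt (fun s => Φ (s, x)) (f (Φ (t, x))) t := by
  let C := C(SymmInterval, E)
  let κ : E →L[ℝ] C := LinearMap.mkContinuous
    { toFun := fun x => ContinuousMap.const _ x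
      map_add' := fun _ _ => rfl
      map_smul' := fun _ _ => rfl } 1 (fun x => by
    rw [ContinuousMap.norm_le _ (by positivity)]
    intro t
    exact (one_mul ‖x‖).ge)
  have hκ : ∀ x t, κ x t = x := fun _ _ => rfl
  -- A zero of the last component is a curve with γ = x + ε ∫ f(γ), that is, a solution of γ' = ε
  -- f(γ) on `[-1, 1]` starting at x. For ε = 0 the constant curve solves it, and the inverse
  -- function theorem is applied there.
  let G : ℝ × E × C → ℝ × E × C :=
    fun a => (a.1, a.2.1, a.2.2 - κ a.2.1 - a.1 • integralFromZero E (postcomp _ f a.2.2))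
  have hG : ContDiff ℝ ∞ G := by
    have h1 : ContDiff ℝ ∞ (fun a : ℝ × E × C => postcomp SymmInterval f a.2.2) :=
      (contDiff_postcomp f hf).comp (contDiff_snd.comp contDiff_snd)
    have h2 : ContDiff ℝ ∞ (fun a : ℝ × E × C => a.1) := contDiff_fst
    have h3 : ContDiff ℝ ∞ (fun a : ℝ × E × C => a.2.1) := contDiff_fst.comp contDiff_snd
    have h4 : ContDiff ℝ ∞ (fun a : ℝ × E × C => a.2.2) := contDiff_snd.comp contDiff_snd
    exact h2.prodMk (h3.prodMk ((h4.sub (κ.contDiff.comp h3)).sub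
      (h2.smul ((integralFromZero E).contDiff.comp h1))))
  let γ₀ : C := κ x₀
  let j : C := integralFromZero E (postcomp _ f γ₀)
  -- At ε = 0 the derivative is the identity plus a strictly triangular term, so its inverse only
  -- changes the signs of that term.
  let G' : (ℝ × E × C) ≃L[ℝ] (ℝ × E × C) :=
    ContinuousLinearEquiv.equivOfInverse
      ((ContinuousLinearMap.fst ℝ ℝ (E × C)).prod
        (((ContinuousLinearMap.fst ℝ E C).comp (ContinuousLinearMap.snd ℝ ℝ (E × C))).prod
          ((ContinuousLinearMap.snd ℝ E C).comp (ContinuousLinearMap.snd ℝ ℝ (E × C))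
            - κ.comp ((ContinuousLinearMap.fst ℝ E C).comp (ContinuousLinearMap.snd ℝ ℝ (E × C)))
            - (ContinuousLinearMap.fst ℝ ℝ (E × C)).smulRight j)))
      ((ContinuousLinearMap.fst ℝ ℝ (E × C)).prod
        (((ContinuousLinearMap.fst ℝ E C).comp (ContinuousLinearMap.snd ℝ ℝ (E × C))).prod
          ((ContinuousLinearMap.snd ℝ E C).comp (ContinuousLinearMap.snd ℝ ℝ (E × C))
            + κ.comp ((ContinuousLinearMap.fst ℝ E C).comp (ContinuousLinearMap.snd ℝ ℝ (E × C)))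
            + (ContinuousLinearMap.fst ℝ ℝ (E × C)).smulRight j)))
      (fun a => Prod.ext rfl (Prod.ext rfl (by simp; abel)))
      (fun a => Prod.ext rfl (Prod.ext rfl (by simp; abel)))
  have hG' : HasFDerivAt G (G' : (ℝ × E × C) →L[ℝ] (ℝ × E × C)) (0, x₀, γ₀) := by
    have h1 : HasFDerivAt (fun a : ℝ × E × C => a.1)
      (ContinuousLinearMap.fst ℝ ℝ (E × C)) (0, x₀, γ₀) := hasFDerivAt_fst
    have h2 : HasFDerivAt (fun a : ℝ × E × C => a.2.1)
      ((ContinuousLinearMap.fst ℝ E C).comp (ContinuousLinearMap.snd ℝ ℝ (E × C))) (0, x₀, γ₀) :=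
      ((ContinuousLinearMap.fst ℝ E C).comp (ContinuousLinearMap.snd ℝ ℝ (E × C))).hasFDerivAt
    have h3 : HasFDerivAt (fun a : ℝ × E × C => a.2.2)
      ((ContinuousLinearMap.snd ℝ E C).comp (ContinuousLinearMap.snd ℝ ℝ (E × C))) (0, x₀, γ₀) :=
      ((ContinuousLinearMap.snd ℝ E C).comp (ContinuousLinearMap.snd ℝ ℝ (E × C))).hasFDerivAt
    have h4 : DifferentiableAt ℝ
        (fun a : ℝ × E × C => integralFromZero E (postcomp SymmInterval f a.2.2)) (0, x₀, γ₀) := by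
      have : ContDiff ℝ ∞
          (fun a : ℝ × E × C => integralFromZero E (postcomp SymmInterval f a.2.2)) :=
        (integralFromZero E).contDiff.comp
          ((contDiff_postcomp f hf).comp (contDiff_snd.comp contDiff_snd))
      exact this.contDiffAt.differentiableAt (by simp)
    have h5 := h1.prodMk (h2.prodMk ((h3.sub (κ.hasFDerivAt.comp _ h2)).sub
      (h1.smul h4.hasFDerivAt)))
    convert! h5 using 1
    ext <;> simp [G', j]
  obtain ⟨e, ha, heG, -, hes⟩ :=
    exists_openPartialHomeomorph_contDiffOn (Filter.Eventually.of_forall fun x => hG.contDiffAt) hG'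
  have hGa : G (0, x₀, γ₀) = (0, x₀, 0) := by simp [G, γ₀]
  have hsymm : e.symm (0, x₀, 0) = (0, x₀, γ₀) := by
    rw [← hGa, ← heG, e.left_inv ha]
  have htar : ((0 : ℝ), x₀, (0 : C)) ∈ e.target := by
    rw [← hGa, ← heG]; exact e.map_source ha
  obtain ⟨r, hr, hrs⟩ := Metric.isOpen_iff.1 e.open_source _ ha
  have hev : ∀ᶠ b in 𝓝 ((0 : ℝ), x₀, (0 : C)), b ∈ e.target ∧
      e.symm b ∈ Metric.ball ((0 : ℝ), x₀, γ₀) r := by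
    refine Filter.Eventually.and (e.open_target.mem_nhds htar) ?_
    have := e.continuousAt_symm htar
    rw [ContinuousAt, hsymm] at this
    exact this (Metric.ball_mem_nhds _ hr)
  obtain ⟨δ, hδ, hδs⟩ := Metric.eventually_nhds_iff_ball.1 hev
  let ι : ℝ × E → ℝ × E × C := fun p => (p.1, p.2, 0)
  have hι : ∀ p ∈ Metric.ball (0 : ℝ) δ ×ˢ Metric.ball x₀ δ,
      ι p ∈ Metric.ball ((0 : ℝ), x₀, (0 : C)) δ := by
    rintro ⟨t, x⟩ ⟨ht, hx⟩
    rw [Metric.mem_ball, Prod.dist_eq, Prod.dist_eq, max_lt_iff, max_lt_iff]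
    exact ⟨ht, hx, by simpa [ι] using hδ⟩
  let Y : ℝ × E → C := fun p => (e.symm (ι p)).2.2
  have hY : ∀ p ∈ Metric.ball (0 : ℝ) δ ×ˢ Metric.ball x₀ δ, e.symm (ι p) = (p.1, p.2, Y p) ∧
      Y p = κ p.2 + p.1 • integralFromZero E (postcomp _ f (Y p)) := by
    intro p hp
    have h1 : G (e.symm (ι p)) = ι p := by rw [← heG]; exact e.right_inv (hδs _ (hι p hp)).1
    have h2 : (e.symm (ι p)).1 = p.1 := congrArg (fun a => a.1) h1
    have h3 : (e.symm (ι p)).2.1 = p.2 := congrArg (fun a => a.2.1) h1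
    have h4 : Y p - κ (e.symm (ι p)).2.1
      - (e.symm (ι p)).1 • integralFromZero E (postcomp _ f (Y p)) = 0 :=
        congrArg (fun a => a.2.2) h1
    refine ⟨Prod.ext h2 (Prod.ext h3 rfl), ?_⟩
    rw [h2, h3] at h4
    rw [sub_sub, sub_eq_zero] at h4
    exact h4
  have hYr : ∀ p ∈ Metric.ball (0 : ℝ) δ ×ˢ Metric.ball x₀ δ,
      |p.1| < r ∧ dist p.2 x₀ < r ∧ dist (Y p) γ₀ < r := by
    intro p hp
    have h1 := (hδs _ (hι p hp)).2
    rw [(hY p hp).1] at h1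
    simpa [Prod.dist_eq] using h1
  -- The local inverse also gives uniqueness: within distance `r` of the constant curve the integral
  -- equation has only the solution `Y p`.
  have huniq : ∀ p ∈ Metric.ball (0 : ℝ) δ ×ˢ Metric.ball x₀ δ, ∀ g : C, dist g γ₀ < r →
      g = κ p.2 + p.1 • integralFromZero E (postcomp _ f g) → g = Y p := by
    intro p hp g hg hge
    have h1 : (p.1, p.2, g) ∈ e.source := by
      apply hrs
      have := hYr p hp
      simp [Prod.dist_eq, hg, this.1, this.2.1]
    have h2 : e (p.1, p.2, g) = ι p := by
      rw [heG]
      refine Prod.ext rfl (Prod.ext rfl ?_)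
      change g - κ p.2 - p.1 • integralFromZero E (postcomp _ f g) = 0
      rw [sub_sub, sub_eq_zero]
      exact hge
    have h3 : e.symm (ι p) = (p.1, p.2, g) := by rw [← h2, e.left_inv h1]
    exact (congrArg (fun a => a.2.2) h3).symm
  -- Slowing time by the factor `s` turns a solution for ε into one for `s * ε`, still within
  -- distance `r`; uniqueness identifies it. Hence `Φ (t, x) = Y (t, x) 1` will be the flow at time
  -- `t`.
  have hscale : ∀ p ∈ Metric.ball (0 : ℝ) δ ×ˢ Metric.ball x₀ δ, ∀ s : SymmInterval,
      Y (s * p.1, p.2) = (Y p).comp (scaleMap s) := by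
    intro p hp s
    symm
    apply huniq (s * p.1, p.2)
    · refine ⟨?_, hp.2⟩
      have h1 : |(s : ℝ)| ≤ 1 := abs_le.2 s.2
      have h2 : |p.1| < δ := by simpa using hp.1
      simp only [mem_ball_zero_iff, norm_mul, Real.norm_eq_abs]
      nlinarith [abs_nonneg p.1, abs_nonneg (s : ℝ)]
    · refine lt_of_le_of_lt ?_ (hYr p hp).2.2
      rw [ContinuousMap.dist_le dist_nonneg]
      intro t
      have h1 := ContinuousMap.dist_apply_le_dist (f := Y p) (g := γ₀) (scaleMap s t)
      exact h1
    · ext t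
      have h1 : Y p (scaleMap s t) = p.2 + p.1 • ∫ u in (0 : ℝ)..(s * t),
          IccExtend (by norm_num : (-1 : ℝ) ≤ 1) (postcomp SymmInterval f (Y p)) u :=
        congrArg (fun g : C => g (scaleMap s t)) (hY p hp).2
      change Y p (scaleMap s t) = p.2 + (s * p.1) • ∫ u in (0 : ℝ)..t,
          IccExtend (by norm_num : (-1 : ℝ) ≤ 1)
            (postcomp SymmInterval f ((Y p).comp (scaleMap s))) u
      rw [h1]
      congr 1
      rw [mul_comm (s : ℝ) p.1, mul_smul]
      congr 1
      have h2 := intervalIntegral.smul_integral_comp_mul_left (a := 0) (b := (t : ℝ))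
        (fun u => IccExtend (by norm_num : (-1 : ℝ) ≤ 1) (postcomp SymmInterval f (Y p)) u) (s : ℝ)
      rw [mul_zero] at h2
      rw [← h2]
      congr 1
      apply intervalIntegral.integral_congr
      intro u hu
      have hu1 : u ∈ Icc (-1 : ℝ) 1 := by
        have := (convex_Icc (-1 : ℝ) 1).ordConnected.uIcc_subset (x := 0) (by simp) t.2
        exact this hu
      have hu2 : (s : ℝ) * u ∈ Icc (-1 : ℝ) 1 := (scaleMap s ⟨u, hu1⟩).2
      simp only
      rw [IccExtend_of_mem _ _ hu1, IccExtend_of_mem _ _ hu2]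
      rfl
  let one : SymmInterval := ⟨1, by norm_num⟩
  refine ⟨δ, hδ, fun p => Y p one, ?_, fun x hx => ⟨?_, fun t ht => ?_⟩⟩
  · have h1 : ContDiffOn ℝ ∞ Y (Metric.ball 0 δ ×ˢ Metric.ball x₀ δ) := by
      have h2 : ContDiff ℝ ∞ ι := contDiff_fst.prodMk (contDiff_snd.prodMk contDiff_const)
      exact contDiff_snd.comp_contDiffOn (contDiff_snd.comp_contDiffOn
        (hes.comp h2.contDiffOn fun p hp => (hδs _ (hι p hp)).1))
    exact (ContinuousMap.evalCLM ℝ one).contDiff.comp_contDiffOn h1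
  · have h1 := (hY (0, x) ⟨Metric.mem_ball_self hδ, hx⟩).2
    change Y (0, x) one = x
    rw [h1]
    simp [hκ]
  · have ht' : |t| < δ := by simpa using ht
    -- One fixed curve `Y (ε, x)` with |t| < ε < δ represents `Φ (s, x)` for all |s| < ε, so the
    -- time derivative follows from the fundamental theorem of calculus.
    obtain ⟨ε, hε1, hε2⟩ := exists_between ht'
    have hε0 : 0 < ε := (abs_nonneg t).trans_lt hε1
    have hp : (ε, x) ∈ Metric.ball (0 : ℝ) δ ×ˢ Metric.ball x₀ δ :=
      ⟨by simpa [abs_of_pos hε0] using hε2, hx⟩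
    set q : C := postcomp SymmInterval f (Y (ε, x)) with hq
    have key : ∀ s : ℝ, |s| < ε → ∃ h : s / ε ∈ Icc (-1 : ℝ) 1,
        Y (s, x) one = Y (ε, x) ⟨s / ε, h⟩ := by
      intro s hs
      have h : s / ε ∈ Icc (-1 : ℝ) 1 := by
        rw [mem_Icc, ← abs_le, abs_div, abs_of_pos hε0, div_le_one hε0]
        exact hs.le
      refine ⟨h, ?_⟩
      have h2 := hscale (ε, x) hp ⟨s / ε, h⟩
      simp only [div_mul_cancel₀ s hε0.ne'] at h2
      rw [h2]
      refine congrArg (Y (ε, x)) ?_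
      exact (Subtype.ext (mul_one _) : scaleMap ⟨s / ε, h⟩ one = ⟨s / ε, h⟩)
    have hd : HasDerivAt (fun s : ℝ => x + ε • ∫ u in (0 : ℝ)..(s / ε),
        IccExtend (by norm_num : (-1 : ℝ) ≤ 1) q u) (f (Y (t, x) one)) t := by
      have hcont : Continuous (IccExtend (by norm_num : (-1 : ℝ) ≤ 1) q) :=
        q.continuous.Icc_extend'
      have h1 := intervalIntegral.integral_hasDerivAt_right
        (hcont.intervalIntegrable 0 (t / ε)) hcont.stronglyMeasurable.stronglyMeasurableAtFilter
        hcont.continuousAt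
      have h2 := (h1.scomp t ((hasDerivAt_id t).div_const ε)).const_smul ε
      have h3 := h2.const_add x
      refine h3.congr_deriv ?_
      obtain ⟨h, h4⟩ := key t hε1
      rw [h4, IccExtend_of_mem _ _ h, smul_smul, mul_one_div_cancel hε0.ne', one_smul]
      rfl
    refine hd.congr_of_eventuallyEq ?_
    have : ∀ᶠ s : ℝ in 𝓝 t, |s| < ε := continuous_abs.continuousAt.eventually_lt
      continuousAt_const hε1
    filter_upwards [this] with s hs
    obtain ⟨h, h4⟩ := key s hs
    rw [h4]
    exact congrArg (fun g : C => g ⟨s / ε, h⟩) (hY (ε, x) hp).2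

/-- A vector field which is smooth on an open subset of a finite-dimensional space has smooth local
flows. -/
lemma exists_smooth_flow [FiniteDimensional ℝ E] {f : E → E} {U : Set E} (hU : IsOpen U)
    (hf : ContDiffOn ℝ ∞ f U) {x₀ : E} (hx₀ : x₀ ∈ U) :
    ∃ δ > 0, ∃ Φ : ℝ × E → E, ContDiffOn ℝ ∞ Φ (Metric.ball 0 δ ×ˢ Metric.ball x₀ δ) ∧
      ∀ x ∈ Metric.ball x₀ δ, Φ (0, x) = x ∧ ∀ t ∈ Metric.ball (0 : ℝ) δ,
        Φ (t, x) ∈ U ∧ HasDerivAt (fun s => Φ (s, x)) (f (Φ (t, x))) t := by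
  have : CompleteSpace E := FiniteDimensional.complete ℝ E
  obtain ⟨r, hr, hrU⟩ := Metric.isOpen_iff.1 hU x₀ hx₀
  -- The cut-off equals 1 up to radius `r / 4` and is supported within `r / 2`, hence inside `U`;
  -- the product with `f` is smooth everywhere.
  let χ : ContDiffBump x₀ := ⟨r / 4, r / 2, by positivity, by linarith⟩
  have hg : ContDiff ℝ ∞ (fun x => χ x • f x) := by
    rw [contDiff_iff_contDiffAt]
    intro x
    by_cases hx : x ∈ U
    · exact χ.contDiff.contDiffAt.smul (hf.contDiffAt (hU.mem_nhds hx))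
    · have h1 : x ∉ tsupport χ := by
        rw [χ.tsupport_eq]
        intro h
        apply hx
        apply hrU
        have h2 : dist x x₀ ≤ r / 2 := h
        exact Metric.mem_ball.2 (by linarith)
      have h2 : (fun x => χ x • f x) =ᶠ[𝓝 x] fun _ => 0 := by
        have := notMem_tsupport_iff_eventuallyEq.1 h1
        filter_upwards [this] with y hy
        simp [hy]
      exact contDiffAt_const.congr_of_eventuallyEq h2
  obtain ⟨δ, hδ, Φ, h1, h2⟩ := exists_smooth_flow_of_contDiff ⟨_, hg.continuous⟩ hg x₀
  have hb : Metric.ball x₀ (r / 4) ∈ 𝓝 x₀ := Metric.ball_mem_nhds _ (by positivity)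
  have h00 : ((0 : ℝ), x₀) ∈ Metric.ball (0 : ℝ) δ ×ˢ Metric.ball x₀ δ :=
    ⟨Metric.mem_ball_self hδ, Metric.mem_ball_self hδ⟩
  have hc : ContinuousAt Φ (0, x₀) := h1.continuousOn.continuousAt
    ((Metric.isOpen_ball.prod Metric.isOpen_ball).mem_nhds h00)
  -- For short times the solutions remain where `χ = 1`, and there they solve the original equation.
  have h3 : ∀ᶠ p in 𝓝 ((0 : ℝ), x₀), Φ p ∈ Metric.ball x₀ (r / 4) := by
    apply hc
    rw [(h2 x₀ (Metric.mem_ball_self hδ)).1]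
    exact hb
  obtain ⟨δ', hδ', h4⟩ := Metric.eventually_nhds_iff_ball.1 h3
  have hsub : ∀ {X : Type u} [PseudoMetricSpace X] (a : X),
      Metric.ball a (min δ δ') ⊆ Metric.ball a δ :=
    fun a => Metric.ball_subset_ball (min_le_left _ _)
  refine ⟨min δ δ', lt_min hδ hδ', Φ, h1.mono (prod_mono
    (Metric.ball_subset_ball (min_le_left _ _)) (hsub _)), fun x hx =>
    ⟨(h2 x (hsub _ hx)).1, fun t ht => ?_⟩⟩
  have h5 : Φ (t, x) ∈ Metric.ball x₀ (r / 4) := by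
    apply h4
    rw [Metric.mem_ball, Prod.dist_eq, max_lt_iff]
    exact ⟨lt_of_lt_of_le ht (min_le_right _ _), lt_of_lt_of_le hx (min_le_right _ _)⟩
  refine ⟨hrU (Metric.ball_subset_ball (by linarith) h5), ?_⟩
  refine ((h2 x (hsub _ hx)).2 t (Metric.ball_subset_ball (min_le_left _ _) ht)).congr_deriv ?_
  have h6 : χ (Φ (t, x)) = 1 := χ.one_of_mem_closedBall (Metric.ball_subset_closedBall h5)
  change χ (Φ (t, x)) • f (Φ (t, x)) = _
  rw [h6, one_smul]

end SmoothFlow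

/-! ### The geodesic equation in a chart -/

section ChartEquation

variable {E : Type*} [NormedAddCommGroup E] [NormedSpace ℝ E]
  {H : Type*} [TopologicalSpace H] {I : ModelWithCorners ℝ E H}
  {M : Type*} [TopologicalSpace M] [ChartedSpace H M]

/-! ### Coordinates and constant-coefficient fields in a chart -/

section Frame

variable [IsManifold I 1 M]

variable (I) in
/-- The coordinates of a tangent vector at `y` in the chart at `p`. -/
def trivCoord (p y : M) : TangentSpace I y →L[ℝ] E :=
  (trivializationAt E (TangentSpace I : M → Type _) p).continuousLinearMapAt ℝ y

variable (I) in
/-- The vector field with constant coordinates `c` in the chart at `p`. -/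
def frameField (p : M) (c : E) : Π y : M, TangentSpace I y := fun y =>
  (trivializationAt E (TangentSpace I : M → Type _) p).symmL ℝ y c

lemma mem_baseSet {p y : M} (hy : y ∈ (chartAt H p).source) :
    y ∈ (trivializationAt E (TangentSpace I : M → Type _) p).baseSet := hy

lemma trivCoord_eq {p y : M} (hy : y ∈ (chartAt H p).source) (v : TangentSpace I y) :
    (trivializationAt E (TangentSpace I : M → Type _) p ⟨y, v⟩).2 = trivCoord I p y v := by
  rw [trivCoord, Trivialization.continuousLinearMapAt_apply,
    Trivialization.coe_linearMapAt_of_mem _ (mem_baseSet hy)]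

lemma frameField_eq {p y : M} (hy : y ∈ (chartAt H p).source) (c : E) :
    (trivializationAt E (TangentSpace I : M → Type _) p).symm y c = frameField I p c y := by
  rw [frameField, Trivialization.symmL_apply _ (mem_baseSet hy)]

@[simp] lemma trivCoord_frameField {p y : M} (hy : y ∈ (chartAt H p).source) (c : E) :
    trivCoord I p y (frameField I p c y) = c :=
  Trivialization.continuousLinearMapAt_symmL _ (mem_baseSet hy) c

@[simp] lemma frameField_trivCoord {p y : M} (hy : y ∈ (chartAt H p).source)
    (v : TangentSpace I y) : frameField I p (trivCoord I p y v) y = v :=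
  Trivialization.symmL_continuousLinearMapAt _ (mem_baseSet hy) v

lemma frameField_add (p : M) (c d : E) :
    frameField I p (c + d) = frameField I p c + frameField I p d :=
  funext fun y => map_add (Trivialization.symmL ℝ _ y) c d

lemma frameField_smul (p : M) (a : ℝ) (c : E) :
    frameField I p (a • c) = a • frameField I p c :=
  funext fun y => map_smul (Trivialization.symmL ℝ _ y) a c

lemma trivCoord_self (x : M) (v : TangentSpace I x) : trivCoord I x x v = v := by
  rw [← trivCoord_eq (mem_chart_source H x)]
  exact trivializationAt_snd_self x v

end Frame

/-! ### Coefficients of the connection in a chart -/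

section Smooth

variable [IsManifold I ∞ M]

lemma contMDiffAt_frameField {p y : M} (hy : y ∈ (chartAt H p).source) (c : E) :
    ContMDiffAt I I.tangent ∞ (fun z => (⟨z, frameField I p c z⟩ : TangentBundle I M)) y := by
  refine ((trivializationAt E (TangentSpace I : M → Type _) p).contMDiffAt_section_iff
    (IB := I) (s := frameField I p c) (mem_baseSet hy)).2 ?_
  refine (contMDiffAt_const (c := c)).congr_of_eventuallyEq ?_
  filter_upwards [(chartAt H p).open_source.mem_nhds hy] with z hz
  rw [trivCoord_eq hz, trivCoord_frameField hz]

lemma mdifferentiableAt_frameField {p y : M} (hy : y ∈ (chartAt H p).source) (c : E) :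
    MDiffAt (T% (frameField I p c)) y :=
  (contMDiffAt_frameField hy c).mdifferentiableAt (by simp)

variable (D : CovariantDerivative I E (TangentSpace I : M → Type _))

/-- The covariant derivative of a vector field in terms of its coordinates in a chart. -/
lemma covariantDerivative_frameField [FiniteDimensional ℝ E] {p y : M}
    (hy : y ∈ (chartAt H p).source) {ζ : M → E} (hζ : MDifferentiableAt I 𝓘(ℝ, E) ζ y)
    (u : TangentSpace I y) :
    D (fun z => frameField I p (ζ z) z) y u
      = frameField I p (mvfderiv I ζ y u) y + D (frameField I p (ζ y)) y u := by
  classical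
  -- Expanding `ζ` in a basis reduces the claim to the Leibniz rule for scalar functions times
  -- constant-coefficient fields.
  let b := Module.finBasis ℝ E
  let l : Fin (Module.finrank ℝ E) → E →L[ℝ] ℝ := fun i => LinearMap.toContinuousLinearMap (b.coord i)
  have hl : ∀ e : E, ∑ i, l i e • b i = e := fun e => b.sum_repr e
  let g : Fin (Module.finrank ℝ E) → M → ℝ := fun i z => l i (ζ z)
  have hg : ∀ i, MDifferentiableAt I 𝓘(ℝ, ℝ) (g i) y := fun i =>
    ((l i).mdifferentiableAt).comp y hζ
  have hgd : ∀ i, mvfderiv I (g i) y u = l i (mvfderiv I ζ y u) := fun i => by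
    have h1 := mfderiv_comp y (l i).mdifferentiableAt hζ
    have h2 : mfderiv I 𝓘(ℝ, ℝ) (g i) y = (l i).comp (mvfderiv I ζ y) := by
      rw [ContinuousLinearMap.mfderiv_eq] at h1
      exact h1
    exact congrArg (fun A : TangentSpace I y →L[ℝ] ℝ => A u) h2
  have hsum : ∀ (s : Finset (Fin (Module.finrank ℝ E))) (f : Fin (Module.finrank ℝ E) → M → ℝ),
      (∀ i, MDifferentiableAt I 𝓘(ℝ, ℝ) (f i) y) →
      MDiffAt (T% (∑ i ∈ s, f i • frameField I p (b i))) y ∧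
      D (∑ i ∈ s, f i • frameField I p (b i)) y u
        = ∑ i ∈ s, (f i y • D (frameField I p (b i)) y u
          + (mvfderiv I (f i) y u) • frameField I p (b i) y) := by
    intro s f hf
    induction s using Finset.induction_on with
    | empty =>
      refine ⟨mdifferentiableAt_zeroSection ℝ (F := E) (TangentSpace I : M → Type _), ?_⟩
      rw [Finset.sum_empty, Finset.sum_empty, D.zero]
      rfl
    | insert i s his ih =>
      have h1 : MDiffAt (T% (f i • frameField I p (b i))) y :=
        (hf i).smul_section (mdifferentiableAt_frameField hy (b i))
      rw [Finset.sum_insert his, Finset.sum_insert his]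
      refine ⟨mdifferentiableAt_add_section h1 ih.1, ?_⟩
      rw [D.isCovariantDerivativeOnUniv.add h1 ih.1 trivial,
        D.isCovariantDerivativeOnUniv.leibniz (mdifferentiableAt_frameField hy (b i)) (hf i) trivial,
        ← ih.2]
      rfl
  have e1 : (fun z => frameField I p (ζ z) z) = ∑ i, g i • frameField I p (b i) := by
    funext z
    rw [Finset.sum_apply]
    conv_lhs => rw [← hl (ζ z)]
    exact map_sum (Trivialization.symmL ℝ _ z) _ _ |>.trans
      (Finset.sum_congr rfl fun i _ => map_smul (Trivialization.symmL ℝ _ z) _ _)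
  -- The frozen field has the same expansion with constant coefficient functions, so it contributes
  -- the same terms except for the derivatives of the coefficients.
  have e2 : frameField I p (ζ y) = ∑ i, (fun _ : M => g i y) • frameField I p (b i) := by
    funext z
    rw [Finset.sum_apply]
    conv_lhs => rw [← hl (ζ y)]
    exact map_sum (Trivialization.symmL ℝ _ z) _ _ |>.trans
      (Finset.sum_congr rfl fun i _ => map_smul (Trivialization.symmL ℝ _ z) _ _)
  have e3 : frameField I p (mvfderiv I ζ y u) y
      = ∑ i, (mvfderiv I (g i) y u) • frameField I p (b i) y := by
    simp_rw [hgd]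
    conv_lhs => rw [← hl (mvfderiv I ζ y u)]
    exact map_sum (Trivialization.symmL ℝ _ y) _ _ |>.trans
      (Finset.sum_congr rfl fun i _ => map_smul (Trivialization.symmL ℝ _ y) _ _)
  rw [e1, e2, e3, (hsum _ g hg).2, (hsum _ _ fun i => mdifferentiableAt_const).2,
    Finset.sum_add_distrib, Finset.sum_add_distrib, add_comm]
  congr 1
  rw [left_eq_add]
  refine Finset.sum_eq_zero fun i _ => ?_
  rw [mvfderiv_const]
  exact zero_smul ℝ _

/-- The quadratic term `∑ Γⁱⱼₖ(x) wʲ wᵏ eᵢ` of the geodesic equation in the chart at `p`. -/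
def spray (p : M) (x w : E) : E :=
  trivCoord I p ((extChartAt I p).symm x)
    (D (frameField I p w) ((extChartAt I p).symm x) (frameField I p w ((extChartAt I p).symm x)))

/-- The coefficients of the geodesic equation are smooth functions in each chart. -/
def SmoothSpray : Prop := ∀ p : M,
  ContDiffOn ℝ ∞ (fun z : E × E => spray D p z.1 z.2) ((extChartAt I p).target ×ˢ univ)

variable {D}

/-- The vector enters twice, as the differentiated field and as the direction, and the connection is
linear in each. This homogeneity is what makes affine reparametrizations geodesic; its case `a = 0`
handles constant curves. -/
lemma spray_smul {p : M} {x : E} (hx : x ∈ (extChartAt I p).target) (a : ℝ) (w : E) :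
    spray D p x (a • w) = a ^ 2 • spray D p x w := by
  have hy : (extChartAt I p).symm x ∈ (chartAt H p).source := by
    rw [← extChartAt_source I]
    exact (extChartAt I p).map_target hx
  have h1 : ∀ u, D (frameField I p (a • w)) ((extChartAt I p).symm x) u
      = a • D (frameField I p w) ((extChartAt I p).symm x) u := fun u => by
    rw [frameField_smul, D.isCovariantDerivativeOnUniv.smul_const a
      (mdifferentiableAt_frameField hy w) trivial]
    rfl
  have h2 : frameField I p (a • w) ((extChartAt I p).symm x)
      = a • frameField I p w ((extChartAt I p).symm x) := by rw [frameField_smul]; rfl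
  simp only [spray]
  rw [h1, h2, map_smul, map_smul, map_smul, smul_smul, sq]

/-- A smooth connection has smooth coefficients. -/
lemma smoothSpray_of_contMDiff [FiniteDimensional ℝ E] [I.Boundaryless] [T2Space M]
    (hD : D.ContMDiffCovariantDerivative ∞) : SmoothSpray D := by
  intro p
  let b := Module.finBasis ℝ E
  let Γ : Fin (Module.finrank ℝ E) → Fin (Module.finrank ℝ E) → M → E := fun i j y =>
    trivCoord I p y (D (frameField I p (b i)) y (frameField I p (b j) y))
  have hΓ : ∀ i j, ContMDiffOn I 𝓘(ℝ, E) ∞ (Γ i j) (chartAt H p).source := by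
    intro i j y hy
    apply ContMDiffAt.contMDiffWithinAt
    -- Smoothness of `D` is applied to a globally smooth section, so the frame field is cut off by a
    -- bump function. Near `y` this changes nothing, since `D` is local.
    obtain ⟨χ, -, hχ⟩ := (SmoothBumpFunction.nhds_basis_tsupport (I := I) y).mem_iff.1
      ((chartAt H p).open_source.mem_nhds hy)
    let σ : Π z : M, TangentSpace I z := (χ : M → ℝ) • frameField I p (b i)
    -- The order ∞ + 1 is again ∞, so no derivative is lost.
    have hσ : ContMDiffOn I I.tangent (∞ + 1)
        (fun z => (⟨z, σ z⟩ : TangentBundle I M)) univ := by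
      have h1 : ContMDiffOn I I.tangent ∞ (fun z => (⟨z, σ z⟩ : TangentBundle I M)) univ := by
        refine (contMDiffOn_univ.2 ?_)
        intro z
        by_cases hz : z ∈ tsupport χ
        · exact (χ.contMDiff z).smul_section (contMDiffAt_frameField (hχ hz) (b i))
        · have h2 : (χ : M → ℝ) =ᶠ[𝓝 z] 0 := notMem_tsupport_iff_eventuallyEq.1 hz
          have h3 := (contMDiff_zeroSection (n := ∞) ℝ
            (TangentSpace I : M → Type _) (F := E) (IB := I)) z
          refine h3.congr_of_eventuallyEq ?_
          filter_upwards [h2] with w hw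
          have h4 : σ w = 0 := by
            change χ w • frameField I p (b i) w = 0
            rw [hw]
            exact zero_smul ℝ _
          rw [h4]
          rfl
      exact h1
    have h1 := (hD.contMDiff.contMDiff hσ).contMDiffAt (x := y) Filter.univ_mem
    have h2 := ContMDiffAt.clm_bundle_apply h1 (contMDiffAt_frameField hy (b j))
    have h3 : ContMDiffAt I 𝓘(ℝ, E) ∞ (fun z => trivCoord I p z
        (D σ z (frameField I p (b j) z))) y := by
      have h4 := ((trivializationAt E (TangentSpace I : M → Type _) p).contMDiffAt_section_iff
        (IB := I) (s := fun z => D σ z (frameField I p (b j) z)) (mem_baseSet hy)).1 h2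
      refine h4.congr_of_eventuallyEq ?_
      filter_upwards [(chartAt H p).open_source.mem_nhds hy] with z hz
      rw [trivCoord_eq hz]
    refine h3.congr_of_eventuallyEq ?_
    have h5 : ∀ᶠ z in 𝓝 y, ∀ᶠ w in 𝓝 z, χ w = 1 := χ.eventuallyEq_one.eventually_nhds
    filter_upwards [h5, (chartAt H p).open_source.mem_nhds hy] with z hz hzs
    have h6 : D (frameField I p (b i)) z = D σ z := by
      refine D.isCovariantDerivativeOnUniv.congr_of_eventuallyEq
        (mdifferentiableAt_frameField hzs (b i))
        (MDifferentiableAt.smul_section (χ.contMDiff.mdifferentiableAt (by simp))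
          (mdifferentiableAt_frameField hzs (b i))) Filter.univ_mem ?_
      filter_upwards [hz] with w hw
      change _ = χ w • frameField I p (b i) w
      rw [hw]
      exact (one_smul ℝ _).symm
    change trivCoord I p z (D (frameField I p (b i)) z (frameField I p (b j) z)) = _
    rw [h6]
  have hc : ∀ i j, ContDiffOn ℝ ∞ (fun x => Γ i j ((extChartAt I p).symm x))
      (extChartAt I p).target := by
    intro i j
    rw [← contMDiffOn_iff_contDiffOn]
    refine (hΓ i j).comp (contMDiffOn_extChartAt_symm p) fun x hx => ?_
    have := (extChartAt I p).map_target hx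
    rwa [extChartAt_source] at this
  -- By bilinearity the spray is a quadratic polynomial in `w` whose coefficients are the smooth
  -- functions `Γ i j`.
  have hs : ∀ x ∈ (extChartAt I p).target, ∀ w, spray D p x w
      = ∑ i, ∑ j, (b.coord i w * b.coord j w) • Γ i j ((extChartAt I p).symm x) := by
    intro x hx w
    set y := (extChartAt I p).symm x with hy
    have hys : y ∈ (chartAt H p).source := by
      rw [← extChartAt_source I]
      exact (extChartAt I p).map_target hx
    have hsum : ∀ (s : Finset (Fin (Module.finrank ℝ E))) u,
        MDiffAt (T% (frameField I p (∑ i ∈ s, b.coord i w • b i))) y ∧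
        D (frameField I p (∑ i ∈ s, b.coord i w • b i)) y u
          = ∑ i ∈ s, b.coord i w • D (frameField I p (b i)) y u := by
      intro s u
      refine ⟨mdifferentiableAt_frameField hys _, ?_⟩
      classical
      induction s using Finset.induction_on with
      | empty =>
        have : frameField I p (0 : E) = 0 := funext fun z => map_zero (Trivialization.symmL ℝ _ z)
        rw [Finset.sum_empty, Finset.sum_empty, this, D.zero]
        rfl
      | insert i s his ih =>
        rw [Finset.sum_insert his, Finset.sum_insert his, frameField_add,
          D.isCovariantDerivativeOnUniv.add (mdifferentiableAt_frameField hys _)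
            (mdifferentiableAt_frameField hys _) trivial, frameField_smul,
          D.isCovariantDerivativeOnUniv.smul_const _
            (mdifferentiableAt_frameField hys _) trivial, ← ih]
        rfl
    have h1 := (hsum Finset.univ (frameField I p w y)).2
    have hw : ∑ i, b.coord i w • b i = w := b.sum_repr w
    rw [hw] at h1
    have h2 : frameField I p w y = ∑ j, b.coord j w • frameField I p (b j) y := by
      conv_lhs => rw [← hw]
      exact map_sum (Trivialization.symmL ℝ _ y) _ _ |>.trans
        (Finset.sum_congr rfl fun i _ => map_smul (Trivialization.symmL ℝ _ y) _ _)
    simp only [spray]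
    rw [← hy, h1, map_sum]
    refine Finset.sum_congr rfl fun i _ => ?_
    rw [h2, map_sum, map_smul, map_sum, Finset.smul_sum]
    refine Finset.sum_congr rfl fun j _ => ?_
    rw [map_smul, map_smul, smul_smul]
  have hb : ∀ i, ContDiff ℝ ∞ fun w : E => b.coord i w := fun i =>
    (LinearMap.toContinuousLinearMap (b.coord i)).contDiff
  refine ContDiffOn.congr ?_ (fun z hz => hs z.1 hz.1 z.2)
  refine ContDiffOn.sum fun i _ => ContDiffOn.sum fun j _ => ?_
  refine ContDiffOn.smul ?_ ((hc i j).comp contDiffOn_fst fun z hz => hz.1)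
  exact (((hb i).comp contDiff_snd).mul ((hb j).comp contDiff_snd)).contDiffOn

end Smooth

end ChartEquation

/-! ### Geodesics as integral curves in a chart of the tangent bundle -/

section Curves

variable {E : Type*} [NormedAddCommGroup E] [NormedSpace ℝ E]
  {H : Type*} [TopologicalSpace H] {I : ModelWithCorners ℝ E H}
  {M : Type*} [TopologicalSpace M] [ChartedSpace H M] [IsManifold I ∞ M]

lemma trivCoord_eq_mfderiv {p y : M} (hy : y ∈ (chartAt H p).source) :
    trivCoord I p y = mfderiv I 𝓘(ℝ, E) (extChartAt I p) y :=
  TangentBundle.continuousLinearMapAt_trivializationAt hy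

lemma trivCoord_velocity {γ : ℝ → M} {t : ℝ} (hγ : MDifferentiableAt 𝓘(ℝ, ℝ) I γ t) {p : M}
    (hp : γ t ∈ (chartAt H p).source) :
    trivCoord I p (γ t) (velocity I γ t) = deriv (extChartAt I p ∘ γ) t := by
  have h1 := mfderiv_comp t (mdifferentiableAt_extChartAt hp) hγ
  rw [mfderiv_eq_fderiv] at h1
  rw [trivCoord_eq_mfderiv hp]
  exact (congrArg (fun A : ℝ →L[ℝ] E => A 1) h1).symm

lemma contDiffAt_extChartAt_comp {γ : ℝ → M} {t : ℝ} {n : ℕ∞ω} (hn : n ≤ ∞)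
    (hγ : ContMDiffAt 𝓘(ℝ, ℝ) I n γ t)
    {p : M} (hp : γ t ∈ (chartAt H p).source) : ContDiffAt ℝ n (extChartAt I p ∘ γ) t := by
  rw [← contMDiffAt_iff_contDiffAt]
  exact ((contMDiffAt_extChartAt' hp).of_le hn).comp t hγ

variable (D : CovariantDerivative I E (TangentSpace I : M → Type _))

/-- The covariant acceleration of a curve in coordinates. -/
lemma trivCoord_covDerivAlong_velocity [FiniteDimensional ℝ E] {γ : ℝ → M} {t : ℝ}
    (hγ : ∀ᶠ s in 𝓝 t, ContMDiffAt 𝓘(ℝ, ℝ) I 2 γ s) {p : M} (hp : γ t ∈ (chartAt H p).source) :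
    trivCoord I p (γ t) (covDerivAlong D γ (velocity I γ) t)
      = deriv (deriv (extChartAt I p ∘ γ)) t
        + spray D p (extChartAt I p (γ t)) (deriv (extChartAt I p ∘ γ) t) := by
  set q := γ t with hq
  have hqq : q ∈ (chartAt H q).source := mem_chart_source H q
  have ht := hγ.self_of_nhds
  have htd : MDifferentiableAt 𝓘(ℝ, ℝ) I γ t := ht.mdifferentiableAt (by norm_num)
  set v : TangentSpace I q := velocity I γ t with hv
  let e := trivializationAt E (TangentSpace I : M → Type _) q
  let e' := trivializationAt E (TangentSpace I : M → Type _) p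
  -- `covDerivAlong` is defined with the chart at `γ t`, whereas the formula uses an arbitrary chart
  -- at `p`; `A` is the change of fiber coordinates from the former to the latter.
  let A : M → E →L[ℝ] E := fun y => (e.coordChangeL ℝ e' y : E →L[ℝ] E)
  have hA : ∀ y, y ∈ (chartAt H q).source → y ∈ (chartAt H p).source → ∀ c,
      A y c = trivCoord I p y (frameField I q c y) := by
    intro y hyq hyp c
    change e.coordChangeL ℝ e' y c = _
    rw [e.coordChangeL_apply e' ⟨mem_baseSet hyq, mem_baseSet hyp⟩, frameField_eq hyq,
      trivCoord_eq hyp]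
  have hAd : MDifferentiableAt I 𝓘(ℝ, E →L[ℝ] E) A q :=
    ((contMDiffOn_coordChangeL (n := ∞) (IB := I) e e').contMDiffAt
      ((e.open_baseSet.inter e'.open_baseSet).mem_nhds ⟨mem_baseSet hqq, mem_baseSet hp⟩)
      ).mdifferentiableAt (by simp)
  -- the derivatives in the two charts
  let a : ℝ → E := deriv (extChartAt I q ∘ γ)
  let b : ℝ → E := deriv (extChartAt I p ∘ γ)
  have hγc : ContinuousAt γ t := ht.continuousAt
  have hnear : ∀ᶠ s in 𝓝 t, γ s ∈ (chartAt H q).source ∧ γ s ∈ (chartAt H p).source :=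
    Filter.Eventually.and (hγc ((chartAt H q).open_source.mem_nhds hqq))
      (hγc ((chartAt H p).open_source.mem_nhds hp))
  have hba : b =ᶠ[𝓝 t] fun s => A (γ s) (a s) := by
    filter_upwards [hγ, hnear] with s hs hs'
    have h1 : MDifferentiableAt 𝓘(ℝ, ℝ) I γ s := hs.mdifferentiableAt (by norm_num)
    rw [hA _ hs'.1 hs'.2]
    change deriv _ _ = trivCoord I p (γ s) (frameField I q (deriv _ _) (γ s))
    rw [← trivCoord_velocity h1 hs'.1, ← trivCoord_velocity h1 hs'.2,
      frameField_trivCoord hs'.1]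
  have hcoord : (fun s : ℝ => (e (⟨γ s, velocity I γ s⟩ : TangentBundle I M)).2) =ᶠ[𝓝 t] a := by
    filter_upwards [hγ, hnear] with s hs hs'
    have h1 : MDifferentiableAt 𝓘(ℝ, ℝ) I γ s := hs.mdifferentiableAt (by norm_num)
    rw [trivCoord_eq hs'.1, trivCoord_velocity h1 hs'.1]
  have hav : a t = trivCoord I q q v := (trivCoord_velocity htd hqq).symm
  have hbv : b t = trivCoord I p q v := (trivCoord_velocity htd hp).symm
  have had : HasDerivAt a (deriv a t) t := by
    have h1 : ContDiffAt ℝ 2 (extChartAt I q ∘ γ) t :=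
      contDiffAt_extChartAt_comp (WithTop.coe_le_coe.2 le_top) ht hqq
    have h2 : ContDiffAt ℝ 1 a t := by
      have := h1.fderiv_right (m := 1) (by norm_num)
      exact this.clm_apply contDiffAt_const
    exact (h2.differentiableAt (by norm_num)).hasDerivAt
  -- The constant extension of the velocity in the chart at `q` has these variable coefficients in
  -- the chart at `p`.
  let ζ : M → E := fun y => A y (a t)
  have hζ : MDifferentiableAt I 𝓘(ℝ, E) ζ q := hAd.clm_apply mdifferentiableAt_const
  have hAγ : DifferentiableAt ℝ (fun s => A (γ s)) t := by
    rw [← mdifferentiableAt_iff_differentiableAt]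
    exact MDifferentiableAt.comp t hAd htd
  have hζγ : deriv (fun s => A (γ s)) t (a t) = mvfderiv I ζ q v := by
    have h1 : HasDerivAt (fun s => A (γ s) (a t)) (deriv (fun s => A (γ s)) t (a t)) t := by
      have := hAγ.hasDerivAt.clm_apply (hasDerivAt_const t (a t))
      simpa using this
    have h2 := mfderiv_comp t (g := ζ) hζ htd
    rw [mfderiv_eq_fderiv] at h2
    rw [← h1.deriv]
    exact congrArg (fun B : ℝ →L[ℝ] E => B 1) h2
  have hbd : deriv b t = A q (deriv a t) + mvfderiv I ζ q v := by
    rw [hba.deriv_eq, (hAγ.hasDerivAt.clm_apply had).deriv, hζγ, add_comm]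
  -- the constant-coefficient extension in the first chart
  have hext : D (FiberBundle.extend E v) q v
      = frameField I p (mvfderiv I ζ q v) q + D (frameField I p (b t)) q v := by
    have h1 : D (FiberBundle.extend E v) q = D (fun z => frameField I p (ζ z) z) q := by
      refine D.isCovariantDerivativeOnUniv.congr_of_eventuallyEq
        (FiberBundle.mdifferentiableAt_extend I E v) ?_ Filter.univ_mem ?_
      · have h2 := mdifferentiableAt_frameField (I := I) hqq (a t)
        refine h2.congr_of_eventuallyEq ?_
        filter_upwards [(chartAt H q).open_source.mem_nhds hqq,
          (chartAt H p).open_source.mem_nhds hp] with y hy1 hy2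
        change (⟨y, frameField I p (A y (a t)) y⟩ : TangentBundle I M) = _
        rw [hA y hy1 hy2, frameField_trivCoord hy2]
      · filter_upwards [(chartAt H q).open_source.mem_nhds hqq,
          (chartAt H p).open_source.mem_nhds hp] with y hy1 hy2
        change _ = frameField I p (A y (a t)) y
        rw [hA y hy1 hy2, frameField_trivCoord hy2, hav, ← trivCoord_eq hqq, ← frameField_eq hy1]
        rfl
    have h3 : ζ q = b t := by
      change A q (a t) = b t
      rw [hba.self_of_nhds]
    rw [h1, covariantDerivative_frameField D hp hζ, h3]
  have hcov : covDerivAlong D γ (velocity I γ) t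
      = frameField I q (deriv a t) q + D (FiberBundle.extend E v) q v := by
    change e.symm q (deriv _ t) + _ = _
    rw [hcoord.deriv_eq, frameField_eq hqq]
  -- The term `mvfderiv I ζ q v` from the change of frame is exactly the extra term of the product
  -- rule for `b = A(γ) a`, so the two combine into `deriv b t`.
  rw [hcov, hext, map_add, map_add, ← hA q hqq hp, trivCoord_frameField hp, ← add_assoc, ← hbd]
  congr 1
  have h4 : (extChartAt I p).symm (extChartAt I p q) = q :=
    (extChartAt I p).left_inv (by rwa [extChartAt_source])
  simp only [spray]
  rw [h4]
  change _ = trivCoord I p q (D (frameField I p (b t)) q (frameField I p (b t) q))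
  rw [hbv, frameField_trivCoord hp]

/-- The coordinate map is injective on the fiber. As `p` is arbitrary, one chart serves for a whole
arc of the curve. -/
lemma covDerivAlong_velocity_eq_zero_iff [FiniteDimensional ℝ E] {γ : ℝ → M} {t : ℝ}
    (hγ : ∀ᶠ s in 𝓝 t, ContMDiffAt 𝓘(ℝ, ℝ) I 2 γ s) {p : M} (hp : γ t ∈ (chartAt H p).source) :
    covDerivAlong D γ (velocity I γ) t = 0 ↔
      deriv (deriv (extChartAt I p ∘ γ)) t
        + spray D p (extChartAt I p (γ t)) (deriv (extChartAt I p ∘ γ) t) = 0 := by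
  rw [← trivCoord_covDerivAlong_velocity D hγ hp]
  refine ⟨fun h => by rw [h, map_zero], fun h => ?_⟩
  rw [← frameField_trivCoord (I := I) hp (covDerivAlong D γ (velocity I γ) t), h]
  exact map_zero (Trivialization.symmL ℝ _ _)

end Curves

/-! ### The lift of a curve and the charts of the tangent bundle -/

section Lift

variable {E : Type*} [NormedAddCommGroup E] [NormedSpace ℝ E]
  {H : Type*} [TopologicalSpace H] {I : ModelWithCorners ℝ E H}
  {M : Type*} [TopologicalSpace M] [ChartedSpace H M] [IsManifold I ∞ M]

variable (I) in
/-- The lift of a curve to the tangent bundle. -/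
def lift (γ : ℝ → M) (t : ℝ) : TangentBundle I M := ⟨γ t, velocity I γ t⟩

variable (I) in
/-- The chart of the tangent bundle induced by the chart of `M` at `p`. -/
def tchart (p : M) : PartialEquiv (TangentBundle I M) (E × E) :=
  extChartAt I.tangent (⟨p, 0⟩ : TangentBundle I M)

lemma mem_tchart_source {p : M} {v : TangentBundle I M} :
    v ∈ (tchart I p).source ↔ v.1 ∈ (chartAt H p).source := by
  rw [tchart, extChartAt_source, TangentBundle.mem_chart_source_iff]

lemma mem_tchart_target {p : M} {z : E × E} :
    z ∈ (tchart I p).target ↔ z.1 ∈ (extChartAt I p).target := by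
  rw [tchart, FiberBundle.extChartAt_target]
  refine ⟨fun h => h.1.1, fun h => ⟨⟨h, ?_⟩, trivial⟩⟩
  have := (extChartAt I p).map_target h
  rw [extChartAt_source] at this
  exact this

lemma tchart_apply {p : M} {v : TangentBundle I M} (hv : v.1 ∈ (chartAt H p).source) :
    tchart I p v = (extChartAt I p v.1, trivCoord I p v.1 v.2) := by
  rw [← trivCoord_eq hv, tchart, FiberBundle.extChartAt]
  rfl

lemma tchart_symm_fst {p : M} {z : E × E} (hz : z.1 ∈ (extChartAt I p).target) :
    ((tchart I p).symm z).1 = (extChartAt I p).symm z.1 := by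
  have h1 : (tchart I p).symm z ∈ (tchart I p).source :=
    (tchart I p).map_target (mem_tchart_target.2 hz)
  have h2 := (tchart I p).right_inv (mem_tchart_target.2 hz)
  rw [mem_tchart_source] at h1
  rw [tchart_apply h1] at h2
  rw [← congrArg Prod.fst h2]
  exact ((extChartAt I p).left_inv (by rwa [extChartAt_source])).symm

lemma tchart_injOn (p : M) : InjOn (tchart I p) {v | v.1 ∈ (chartAt H p).source} :=
  fun _ hv _ hw h => (tchart I p).injOn (mem_tchart_source.2 hv) (mem_tchart_source.2 hw) h

lemma contMDiffOn_tchart (p : M) :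
    ContMDiffOn I.tangent 𝓘(ℝ, E × E) ∞ (tchart I p) {v | v.1 ∈ (chartAt H p).source} := by
  have h1 := contMDiffOn_extChartAt (n := ∞) (I := I.tangent)
    (x := (⟨p, 0⟩ : TangentBundle I M))
  rw [modelWithCornersSelf_prod]
  refine h1.mono fun v hv => ?_
  rw [← extChartAt_source I.tangent]
  exact mem_tchart_source.2 hv

lemma contMDiffOn_tchart_symm (p : M) :
    ContMDiffOn 𝓘(ℝ, E × E) I.tangent ∞ (tchart I p).symm
      ((extChartAt I p).target ×ˢ univ) := by
  have h1 := contMDiffOn_extChartAt_symm (n := ∞) (I := I.tangent)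
    (⟨p, 0⟩ : TangentBundle I M)
  rw [modelWithCornersSelf_prod]
  exact h1.mono fun z hz => mem_tchart_target.2 hz.1

/-- Vectors over different points are separated in `M`; vectors over the same point lie in a common
chart. The uniqueness of geodesics relies on this: the times at which two lifts differ form an open
set. -/
instance [T2Space M] : T2Space (TangentBundle I M) := by
  rw [t2Space_iff_disjoint_nhds]
  intro v w hvw
  by_cases h : v.1 = w.1
  · have hv : v.1 ∈ (chartAt H v.1).source := mem_chart_source H v.1
    have hw : w.1 ∈ (chartAt H v.1).source := h ▸ hv
    have hc : ∀ u : TangentBundle I M, u.1 ∈ (chartAt H v.1).source →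
        ContinuousAt (tchart I v.1) u := fun u hu =>
      (contMDiffOn_tchart v.1).continuousOn.continuousAt
        (((chartAt H v.1).open_source.preimage (FiberBundle.continuous_proj E _)).mem_nhds hu)
    have hne : tchart I v.1 v ≠ tchart I v.1 w := fun h' => hvw (tchart_injOn v.1 hv hw h')
    exact (hc v hv).disjoint (disjoint_nhds_nhds.2 hne) (hc w hw)
  · exact ((FiberBundle.continuous_proj E (TangentSpace I : M → Type _)).tendsto v).disjoint
      (disjoint_nhds_nhds.2 h) ((FiberBundle.continuous_proj E _).tendsto w)

/-- Scalar multiplication in the fibers of the tangent bundle. -/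
def scale (c : ℝ) (v : TangentBundle I M) : TangentBundle I M := ⟨v.1, c • v.2⟩

lemma scale_one (v : TangentBundle I M) : scale 1 v = v := by simp [scale]

lemma scale_scale (c d : ℝ) (v : TangentBundle I M) : scale c (scale d v) = scale (c * d) v :=
  congrArg (TotalSpace.mk v.1) (smul_smul c d v.2)

lemma tchart_scale {p : M} {v : TangentBundle I M} (hv : v.1 ∈ (chartAt H p).source) (c : ℝ) :
    tchart I p (scale c v) = ((tchart I p v).1, c • (tchart I p v).2) := by
  rw [tchart_apply hv, tchart_apply (v := scale c v) hv]
  exact congrArg (Prod.mk _) (map_smul (trivCoord I p v.1) c v.2)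

lemma contMDiffAt_tchart {p : M} {v : TangentBundle I M} (hv : v.1 ∈ (chartAt H p).source) :
    ContMDiffAt I.tangent 𝓘(ℝ, E × E) ∞ (tchart I p) v :=
  (contMDiffOn_tchart p).contMDiffAt
    (((chartAt H p).open_source.preimage (FiberBundle.continuous_proj E _)).mem_nhds hv)

lemma tchart_fst_mem_target {p : M} {v : TangentBundle I M} (hv : v.1 ∈ (chartAt H p).source) :
    (tchart I p v).1 ∈ (extChartAt I p).target :=
  mem_tchart_target.1 ((tchart I p).map_source (mem_tchart_source.2 hv))

lemma contMDiffAt_tchart_symm [I.Boundaryless] {p : M} {z : E × E}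
    (hz : z.1 ∈ (extChartAt I p).target) :
    ContMDiffAt 𝓘(ℝ, E × E) I.tangent ∞ (tchart I p).symm z :=
  (contMDiffOn_tchart_symm p).contMDiffAt
    (((isOpen_extChartAt_target p).prod isOpen_univ).mem_nhds ⟨hz, trivial⟩)

lemma contMDiff_scale [I.Boundaryless] (c : ℝ) :
    ContMDiff I.tangent I.tangent ∞ (scale c : TangentBundle I M → TangentBundle I M) := by
  intro v
  have hv : v.1 ∈ (chartAt H v.1).source := mem_chart_source H v.1
  have h4 : ContDiff ℝ ∞ (fun z : E × E => (z.1, c • z.2)) := by fun_prop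
  have h5 := (contMDiffAt_tchart_symm (z := ((tchart I v.1 v).1, c • (tchart I v.1 v).2))
    (tchart_fst_mem_target hv)).comp v
    (h4.contMDiff.contMDiffAt.comp v (contMDiffAt_tchart hv))
  refine h5.congr_of_eventuallyEq ?_
  filter_upwards [((chartAt H v.1).open_source.preimage
    (FiberBundle.continuous_proj E _)).mem_nhds hv] with w hw
  have h6 : (scale c w).1 ∈ (chartAt H v.1).source := hw
  rw [← (tchart I v.1).left_inv (mem_tchart_source.2 h6), tchart_scale hw]
  rfl

end Lift

/-! ### Uniqueness, reparametrization and gluing of geodesics -/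

section Geodesics

variable {E : Type*} [NormedAddCommGroup E] [NormedSpace ℝ E] [FiniteDimensional ℝ E]
  {H : Type*} [TopologicalSpace H] {I : ModelWithCorners ℝ E H} [I.Boundaryless]
  {M : Type*} [TopologicalSpace M] [ChartedSpace H M] [IsManifold I ∞ M]
  {D : CovariantDerivative I E (TangentSpace I : M → Type _)}

variable (D) in
/-- The vector field in a chart of the tangent bundle whose integral curves are the lifts of
geodesics. -/
def geodesicField (p : M) (z : E × E) : E × E := (z.2, -spray D p z.1 z.2)

lemma SmoothSpray.contDiffOn_geodesicField (hS : SmoothSpray D) (p : M) :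
    ContDiffOn ℝ ∞ (geodesicField D p) ((extChartAt I p).target ×ˢ univ) :=
  contDiff_snd.contDiffOn.prodMk (hS p).neg

lemma IsGeodesicOn.contMDiffAt {γ : ℝ → M} {J : Set ℝ} (h : IsGeodesicOn D γ J) {t : ℝ}
    (ht : t ∈ J) : ContMDiffAt 𝓘(ℝ, ℝ) I 2 γ t :=
  h.contMDiffOn.contMDiffAt (h.isOpen.mem_nhds ht)

lemma IsGeodesicOn.mdifferentiableAt {γ : ℝ → M} {J : Set ℝ} (h : IsGeodesicOn D γ J) {t : ℝ}
    (ht : t ∈ J) : MDifferentiableAt 𝓘(ℝ, ℝ) I γ t :=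
  (h.contMDiffAt ht).mdifferentiableAt (by norm_num)

lemma IsGeodesicOn.eventually_contMDiffAt {γ : ℝ → M} {J : Set ℝ} (h : IsGeodesicOn D γ J) {t : ℝ}
    (ht : t ∈ J) : ∀ᶠ s in 𝓝 t, ContMDiffAt 𝓘(ℝ, ℝ) I 2 γ s := by
  filter_upwards [h.isOpen.mem_nhds ht] with s hs using h.contMDiffAt hs

lemma tchart_lift {γ : ℝ → M} {t : ℝ} (h : MDifferentiableAt 𝓘(ℝ, ℝ) I γ t) {p : M}
    (hp : γ t ∈ (chartAt H p).source) :
    tchart I p (lift I γ t) = (extChartAt I p (γ t), deriv (extChartAt I p ∘ γ) t) := by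
  rw [tchart_apply (v := lift I γ t) hp, ← trivCoord_velocity h hp]
  rfl

/-- The lift of a geodesic is an integral curve of the geodesic field. -/
lemma IsGeodesicOn.hasDerivAt_tchart_lift {γ : ℝ → M} {J : Set ℝ} (h : IsGeodesicOn D γ J)
    {t : ℝ} (ht : t ∈ J) {p : M} (hp : γ t ∈ (chartAt H p).source) :
    HasDerivAt (fun s => tchart I p (lift I γ s))
      (geodesicField D p (tchart I p (lift I γ t))) t := by
  have h1 : ContDiffAt ℝ 2 (extChartAt I p ∘ γ) t :=
    contDiffAt_extChartAt_comp (WithTop.coe_le_coe.2 le_top) (h.contMDiffAt ht) hp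
  have h2 : ContDiffAt ℝ 1 (deriv (extChartAt I p ∘ γ)) t :=
    (h1.fderiv_right (m := 1) (by norm_num)).clm_apply contDiffAt_const
  have h3 := (h1.differentiableAt (by norm_num)).hasDerivAt.prodMk
    (h2.differentiableAt (by norm_num)).hasDerivAt
  have h4 := (covDerivAlong_velocity_eq_zero_iff D (h.eventually_contMDiffAt ht) hp).1
    (h.geodesic_eq t ht)
  have h5 : (fun s => tchart I p (lift I γ s)) =ᶠ[𝓝 t]
      fun s => ((extChartAt I p ∘ γ) s, deriv (extChartAt I p ∘ γ) s) := by
    filter_upwards [h.isOpen.mem_nhds ht, (h.contMDiffAt ht).continuousAt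
      ((chartAt H p).open_source.mem_nhds hp)] with s hs hsp
    exact tchart_lift (h.mdifferentiableAt hs) hsp
  refine (h3.congr_of_eventuallyEq h5).congr_deriv ?_
  rw [tchart_lift (h.mdifferentiableAt ht) hp, geodesicField, eq_neg_of_add_eq_zero_left h4]

/-- An integral curve of the geodesic field is the lift of a geodesic. -/
lemma isGeodesicOn_of_hasDerivAt (hS : SmoothSpray D) {p : M} {z : ℝ → E × E} {J : Set ℝ}
    (hJ : IsOpen J) (hne : J.Nonempty) (hc : J.OrdConnected)
    (hz : ∀ t ∈ J, (z t).1 ∈ (extChartAt I p).target ∧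
      HasDerivAt z (geodesicField D p (z t)) t) :
    IsGeodesicOn D (fun t => (extChartAt I p).symm (z t).1) J ∧
      ∀ t ∈ J, lift I (fun t => (extChartAt I p).symm (z t).1) t = (tchart I p).symm (z t) := by
  set γ : ℝ → M := fun t => (extChartAt I p).symm (z t).1 with hγ
  have hd1 : ∀ t ∈ J, HasDerivAt (fun s => (z s).1) (z t).2 t := fun t ht => (hz t ht).2.fst
  have hd2 : ∀ t ∈ J, HasDerivAt (fun s => (z s).2) (-spray D p (z t).1 (z t).2) t :=
    fun t ht => (hz t ht).2.snd
  have hzc : ContinuousOn z J := fun t ht => (hz t ht).2.continuousAt.continuousWithinAt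
  -- Bootstrapping: the equation makes the velocity component C¹, and hence the position component
  -- C².
  have hC1 : ContDiffOn ℝ 1 (fun s => (z s).2) J := by
    have := (contDiffOn_succ_iff_deriv_of_isOpen (n := 0) (f := fun s => (z s).2) hJ).2
      ⟨fun t ht => (hd2 t ht).differentiableAt.differentiableWithinAt, by simp, by
        rw [contDiffOn_zero]
        have h1 : ContinuousOn (fun t => -spray D p (z t).1 (z t).2) J :=
          ((hS p).continuousOn.comp hzc fun t ht => ⟨(hz t ht).1, trivial⟩).neg
        exact h1.congr fun t ht => (hd2 t ht).deriv⟩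
    simpa using this
  have hC2 : ContDiffOn ℝ 2 (fun s => (z s).1) J := by
    have := (contDiffOn_succ_iff_deriv_of_isOpen (n := 1) (f := fun s => (z s).1) hJ).2
      ⟨fun t ht => (hd1 t ht).differentiableAt.differentiableWithinAt, by simp,
        hC1.congr fun t ht => (hd1 t ht).deriv⟩
    exact this.of_le (by norm_num)
  have hsm : ContMDiffOn 𝓘(ℝ, ℝ) I 2 γ J := by
    have h1 := (contMDiffOn_extChartAt_symm (I := I) (n := ∞) p).of_le
      (WithTop.coe_le_coe.2 (le_top : (2 : ℕ∞) ≤ ⊤))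
    exact h1.comp (contMDiffOn_iff_contDiffOn.2 hC2) fun t ht => (hz t ht).1
  have hsrc : ∀ t ∈ J, γ t ∈ (chartAt H p).source := fun t ht => by
    rw [← extChartAt_source I]
    exact (extChartAt I p).map_target (hz t ht).1
  have hx : ∀ t ∈ J, extChartAt I p (γ t) = (z t).1 := fun t ht =>
    (extChartAt I p).right_inv (hz t ht).1
  have hev : ∀ t ∈ J, (extChartAt I p ∘ γ) =ᶠ[𝓝 t] fun s => (z s).1 := fun t ht => by
    filter_upwards [hJ.mem_nhds ht] with s hs using hx s hs
  have hdx : ∀ t ∈ J, deriv (extChartAt I p ∘ γ) t = (z t).2 := fun t ht => by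
    rw [(hev t ht).deriv_eq, (hd1 t ht).deriv]
  refine ⟨⟨hJ, hne, hc, hsm, fun t ht => ?_⟩, fun t ht => ?_⟩
  · have h1 : ∀ᶠ s in 𝓝 t, ContMDiffAt 𝓘(ℝ, ℝ) I 2 γ s := by
      filter_upwards [hJ.mem_nhds ht] with s hs using hsm.contMDiffAt (hJ.mem_nhds hs)
    rw [covDerivAlong_velocity_eq_zero_iff D h1 (hsrc t ht)]
    have h2 : deriv (extChartAt I p ∘ γ) =ᶠ[𝓝 t] fun s => (z s).2 := by
      filter_upwards [hJ.mem_nhds ht] with s hs using hdx s hs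
    rw [h2.deriv_eq, (hd2 t ht).deriv, hx t ht, hdx t ht, neg_add_cancel]
  · have h1 : MDifferentiableAt 𝓘(ℝ, ℝ) I γ t :=
      (hsm.contMDiffAt (hJ.mem_nhds ht)).mdifferentiableAt (by norm_num)
    have h2 := tchart_lift h1 (hsrc t ht)
    rw [hx t ht, hdx t ht] at h2
    rw [← (tchart I p).left_inv (mem_tchart_source.2 (hsrc t ht) : lift I γ t ∈ _), h2]

lemma IsGeodesicOn.continuousAt_lift {γ : ℝ → M} {J : Set ℝ} (h : IsGeodesicOn D γ J)
    {t : ℝ} (ht : t ∈ J) : ContinuousAt (lift I γ) t := by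
  have hp : γ t ∈ (chartAt H (γ t)).source := mem_chart_source H (γ t)
  have h1 := (contMDiffAt_tchart_symm (I := I) (p := γ t) (z := tchart I (γ t) (lift I γ t))
    (tchart_fst_mem_target (v := lift I γ t) hp)).continuousAt.comp_of_eq
    (h.hasDerivAt_tchart_lift ht hp).continuousAt rfl
  refine h1.congr ?_
  filter_upwards [(h.contMDiffAt ht).continuousAt
    ((chartAt H (γ t)).open_source.mem_nhds hp)] with s hs
  exact (tchart I (γ t)).left_inv (mem_tchart_source.2 hs)

/-- In one chart both lifts are integral curves of the geodesic field, which is locally Lipschitz,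
so uniqueness for ordinary differential equations applies. -/
lemma IsGeodesicOn.lift_eventuallyEq (hS : SmoothSpray D) {γ γ' : ℝ → M} {J J' : Set ℝ}
    (h : IsGeodesicOn D γ J) (h' : IsGeodesicOn D γ' J') {t : ℝ} (ht : t ∈ J) (ht' : t ∈ J')
    (he : lift I γ t = lift I γ' t) : lift I γ =ᶠ[𝓝 t] lift I γ' := by
  set p := γ t with hp
  have hps : γ t ∈ (chartAt H p).source := mem_chart_source H (γ t)
  have hps' : γ' t ∈ (chartAt H p).source := by
    have : γ t = γ' t := congrArg TotalSpace.proj he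
    rwa [← this]
  have hn : ∀ᶠ s in 𝓝 t, s ∈ J ∧ γ s ∈ (chartAt H p).source :=
    Filter.Eventually.and (h.isOpen.mem_nhds ht) ((h.contMDiffAt ht).continuousAt
      ((chartAt H p).open_source.mem_nhds hps))
  have hn' : ∀ᶠ s in 𝓝 t, s ∈ J' ∧ γ' s ∈ (chartAt H p).source :=
    Filter.Eventually.and (h'.isOpen.mem_nhds ht') ((h'.contMDiffAt ht').continuousAt
      ((chartAt H p).open_source.mem_nhds hps'))
  set z₀ := tchart I p (lift I γ t) with hz₀
  have hz₀' : z₀ = tchart I p (lift I γ' t) := by rw [hz₀, he]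
  have htar : (extChartAt I p).target ×ˢ (univ : Set E) ∈ 𝓝 z₀ :=
    ((isOpen_extChartAt_target p).prod isOpen_univ).mem_nhds
      ⟨tchart_fst_mem_target (v := lift I γ t) hps, trivial⟩
  obtain ⟨K, s, hs, hlip⟩ := (((hS.contDiffOn_geodesicField p).contDiffAt htar).of_le
    (WithTop.coe_le_coe.2 (le_top : (1 : ℕ∞) ≤ ⊤))).exists_lipschitzOnWith
  have key := ODE_solution_unique_of_eventually (v := fun _ => geodesicField D p) (K := K)
    (s := fun _ => s) (f := fun r => tchart I p (lift I γ r))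
    (g := fun r => tchart I p (lift I γ' r)) (t₀ := t) (Filter.Eventually.of_forall fun _ => hlip)
    (by
      have h1 := (h.hasDerivAt_tchart_lift ht hps).continuousAt hs
      filter_upwards [hn, h1] with r hr hr'
      exact ⟨h.hasDerivAt_tchart_lift hr.1 hr.2, hr'⟩)
    (by
      have h1 := (h'.hasDerivAt_tchart_lift ht' hps').continuousAt (hz₀' ▸ hs)
      filter_upwards [hn', h1] with r hr hr'
      exact ⟨h'.hasDerivAt_tchart_lift hr.1 hr.2, hr'⟩)
    hz₀'
  filter_upwards [key, hn, hn'] with r hr hr1 hr2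
  exact tchart_injOn p hr1.2 hr2.2 hr

/-- Two geodesics with a common tangent vector agree wherever both are defined. -/
lemma IsGeodesicOn.lift_eqOn [T2Space M] (hS : SmoothSpray D) {γ γ' : ℝ → M} {J J' : Set ℝ}
    (h : IsGeodesicOn D γ J) (h' : IsGeodesicOn D γ' J') {t : ℝ} (ht : t ∈ J) (ht' : t ∈ J')
    (he : lift I γ t = lift I γ' t) : EqOn (lift I γ) (lift I γ') (J ∩ J') := by
  have hpc : IsPreconnected (J ∩ J') := (h.ordConnected.inter h'.ordConnected).isPreconnected
  have hopen : IsOpen (J ∩ J') := h.isOpen.inter h'.isOpen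
  -- The times of agreement and of disagreement are both open, by local uniqueness and by the
  -- Hausdorff property; the common interval is connected.
  let A : Set ℝ := {s | s ∈ J ∩ J' ∧ lift I γ s = lift I γ' s}
  let B : Set ℝ := {s | s ∈ J ∩ J' ∧ lift I γ s ≠ lift I γ' s}
  have hA : IsOpen A := isOpen_iff_mem_nhds.2 fun s hs => by
    filter_upwards [hopen.mem_nhds hs.1, h.lift_eventuallyEq hS h' hs.1.1 hs.1.2 hs.2]
      with r hr hr' using ⟨hr, hr'⟩
  have hB : IsOpen B := isOpen_iff_mem_nhds.2 fun s hs => by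
    have h1 := ((h.continuousAt_lift hs.1.1).ne_iff_eventually_ne
      (h'.continuousAt_lift hs.1.2)).1 hs.2
    filter_upwards [hopen.mem_nhds hs.1, h1] with r hr hr' using ⟨hr, hr'⟩
  intro s hs
  by_contra hne
  obtain ⟨r, -, hr, hr'⟩ := hpc A B hA hB
    (fun r hr => (em (lift I γ r = lift I γ' r)).imp (fun e => ⟨hr, e⟩) fun e => ⟨hr, e⟩)
    ⟨t, ⟨ht, ht'⟩, ⟨ht, ht'⟩, he⟩ ⟨s, hs, hs, hne⟩
  exact hr'.2 hr.2

/-- Being a geodesic is a local property. -/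
lemma isGeodesicOn_of_local {γ : ℝ → M} {J : Set ℝ} (hJ : IsOpen J) (hne : J.Nonempty)
    (hc : J.OrdConnected)
    (h : ∀ t ∈ J, ∃ γ' J', IsGeodesicOn D γ' J' ∧ t ∈ J' ∧ γ =ᶠ[𝓝 t] γ') :
    IsGeodesicOn D γ J := by
  have hsm : ∀ t ∈ J, ContMDiffAt 𝓘(ℝ, ℝ) I 2 γ t := fun t ht => by
    obtain ⟨γ', J', h', ht', he⟩ := h t ht
    exact (h'.contMDiffAt ht').congr_of_eventuallyEq he
  refine ⟨hJ, hne, hc, fun t ht => (hsm t ht).contMDiffWithinAt, fun t ht => ?_⟩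
  obtain ⟨γ', J', h', ht', he⟩ := h t ht
  have hps : γ' t ∈ (chartAt H (γ' t)).source := mem_chart_source H (γ' t)
  have h1 : ∀ᶠ s in 𝓝 t, ContMDiffAt 𝓘(ℝ, ℝ) I 2 γ s := by
    filter_upwards [hJ.mem_nhds ht] with s hs using hsm s hs
  have h2 := (covDerivAlong_velocity_eq_zero_iff D (h'.eventually_contMDiffAt ht') hps).1
    (h'.geodesic_eq t ht')
  have h3 : γ t = γ' t := he.self_of_nhds
  rw [covDerivAlong_velocity_eq_zero_iff D h1 (p := γ' t) (by rwa [h3])]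
  have h4 : (extChartAt I (γ' t) ∘ γ) =ᶠ[𝓝 t] (extChartAt I (γ' t) ∘ γ') :=
    he.fun_comp _
  rw [h4.deriv.deriv_eq, h4.deriv_eq, h3]
  exact h2

lemma lift_eventuallyEq_of_eventuallyEq {γ γ' : ℝ → M} {t : ℝ} (h : γ =ᶠ[𝓝 t] γ') :
    lift I γ =ᶠ[𝓝 t] lift I γ' := by
  have h1 : ∀ s, γ =ᶠ[𝓝 s] γ' → lift I γ s = lift I γ' s := by
    intro s hs
    have h2 : mfderiv 𝓘(ℝ, ℝ) I γ s = mfderiv 𝓘(ℝ, ℝ) I γ' s := hs.mfderiv_eq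
    have h3 : γ s = γ' s := hs.self_of_nhds
    have h4 : velocity I γ s = velocity I γ' s := congrArg (fun A : ℝ →L[ℝ] E => A 1) h2
    exact TotalSpace.ext h3 (heq_of_eq h4)
  filter_upwards [h.eventually_nhds] with s hs using h1 s hs

lemma IsGeodesicOn.mono {γ : ℝ → M} {J J' : Set ℝ} (h : IsGeodesicOn D γ J) (hJ : IsOpen J')
    (hne : J'.Nonempty) (hc : J'.OrdConnected) (hs : J' ⊆ J) : IsGeodesicOn D γ J' :=
  isGeodesicOn_of_local hJ hne hc fun _ ht => ⟨γ, J, h, hs ht, Filter.EventuallyEq.rfl⟩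

/-- The spray vanishes at the zero vector by homogeneity. Constant geodesics are what allow a
geodesic of one factor to be placed in a slice of a product. -/
lemma isGeodesicOn_const (q : M) : IsGeodesicOn D (fun _ => q) univ := by
  refine ⟨isOpen_univ, univ_nonempty, ordConnected_univ, contMDiffOn_const, fun t _ => ?_⟩
  have hq : q ∈ (chartAt H q).source := mem_chart_source H q
  rw [covDerivAlong_velocity_eq_zero_iff D (p := q)
    (Filter.Eventually.of_forall fun s => contMDiffAt_const) hq]
  have h1 : deriv (extChartAt I q ∘ fun _ : ℝ => q) = fun _ => 0 := by
    funext s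
    exact deriv_const s _
  rw [h1]
  have h2 := spray_smul (D := D) (p := q) (x := extChartAt I q q)
    ((extChartAt I q).map_source (mem_extChartAt_source q)) 0 (0 : E)
  simp only [zero_smul, ne_eq, OfNat.ofNat_ne_zero, not_false_eq_true, zero_pow] at h2
  rw [h2, add_zero]
  exact deriv_const t _

/-- An affine reparametrization of a geodesic is a geodesic. -/
lemma IsGeodesicOn.comp_affine {γ : ℝ → M} {J : Set ℝ} (h : IsGeodesicOn D γ J) {a : ℝ}
    (ha : a ≠ 0) (b : ℝ) :
    IsGeodesicOn D (fun t => γ (a * t + b)) ((fun t => a * t + b) ⁻¹' J) ∧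
    ∀ t, a * t + b ∈ J → lift I (fun t => γ (a * t + b)) t = scale a (lift I γ (a * t + b)) := by
  have haff : ∀ t, HasDerivAt (fun t : ℝ => a * t + b) a t := fun t => by
    simpa using ((hasDerivAt_id t).const_mul a).add_const b
  have hsmooth : ContMDiff 𝓘(ℝ, ℝ) 𝓘(ℝ, ℝ) 2 (fun t : ℝ => a * t + b) := by
    rw [contMDiff_iff_contDiff]; fun_prop
  have hsm : ∀ t, a * t + b ∈ J → ContMDiffAt 𝓘(ℝ, ℝ) I 2 (fun t => γ (a * t + b)) t :=
    fun t ht => (h.contMDiffAt ht).comp t hsmooth.contMDiffAt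
  have hopen : IsOpen ((fun t : ℝ => a * t + b) ⁻¹' J) := h.isOpen.preimage hsmooth.continuous
  have hd : ∀ p : M, ∀ t, a * t + b ∈ J → γ (a * t + b) ∈ (chartAt H p).source →
      deriv (extChartAt I p ∘ fun t => γ (a * t + b)) t
        = a • deriv (extChartAt I p ∘ γ) (a * t + b) := by
    intro p t ht hp
    have h1 : ContDiffAt ℝ 2 (extChartAt I p ∘ γ) (a * t + b) :=
      contDiffAt_extChartAt_comp (WithTop.coe_le_coe.2 le_top) (h.contMDiffAt ht) hp
    have h2 := (h1.differentiableAt (by norm_num)).hasDerivAt.scomp t (haff t)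
    exact h2.deriv
  refine ⟨⟨hopen, ?_, ?_, fun t ht => (hsm t ht).contMDiffWithinAt, fun t ht => ?_⟩,
    fun t ht => ?_⟩
  · obtain ⟨s, hs⟩ := h.nonempty
    refine ⟨a⁻¹ * (s - b), ?_⟩
    change a * (a⁻¹ * (s - b)) + b ∈ J
    rwa [mul_inv_cancel_left₀ ha, sub_add_cancel]
  · rcases lt_or_gt_of_ne ha with ha' | ha'
    · refine ⟨fun x hx y hy z hz => ?_⟩
      exact h.ordConnected.out hy hx ⟨by nlinarith [hz.1, hz.2], by nlinarith [hz.1, hz.2]⟩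
    · refine ⟨fun x hx y hy z hz => ?_⟩
      exact h.ordConnected.out hx hy ⟨by nlinarith [hz.1, hz.2], by nlinarith [hz.1, hz.2]⟩
  · set p := γ (a * t + b) with hp
    have hps : γ (a * t + b) ∈ (chartAt H p).source := mem_chart_source H p
    have h1 : ∀ᶠ s in 𝓝 t, ContMDiffAt 𝓘(ℝ, ℝ) I 2 (fun t => γ (a * t + b)) s := by
      filter_upwards [hopen.mem_nhds ht] with s hs using hsm s hs
    rw [covDerivAlong_velocity_eq_zero_iff D h1 (p := p) hps]
    have h2 := (covDerivAlong_velocity_eq_zero_iff D (h.eventually_contMDiffAt ht) hps).1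
      (h.geodesic_eq _ ht)
    have h3 : deriv (extChartAt I p ∘ fun t => γ (a * t + b)) =ᶠ[𝓝 t]
        fun s => a • deriv (extChartAt I p ∘ γ) (a * s + b) := by
      filter_upwards [hopen.mem_nhds ht, (hsm t ht).continuousAt
        ((chartAt H p).open_source.mem_nhds hps)] with s hs hs' using hd p s hs hs'
    have h4 : ContDiffAt ℝ 2 (extChartAt I p ∘ γ) (a * t + b) :=
      contDiffAt_extChartAt_comp (WithTop.coe_le_coe.2 le_top) (h.contMDiffAt ht) hps
    have h5 : ContDiffAt ℝ 1 (deriv (extChartAt I p ∘ γ)) (a * t + b) :=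
      (h4.fderiv_right (m := 1) (by norm_num)).clm_apply contDiffAt_const
    have h6 := ((h5.differentiableAt (by norm_num)).hasDerivAt.scomp t (haff t)).const_smul a
    -- The second derivative acquires the factor `a ^ 2`, the same as the spray.
    have h7 : deriv (deriv (extChartAt I p ∘ fun t => γ (a * t + b))) t
        = a ^ 2 • deriv (deriv (extChartAt I p ∘ γ)) (a * t + b) := by
      rw [h3.deriv_eq, sq, mul_smul]
      exact h6.deriv
    rw [h7, hd p t ht hps, spray_smul ((extChartAt I p).map_source (by rwa [extChartAt_source])),
      ← smul_add, h2, smul_zero]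
  · set p := γ (a * t + b) with hp
    have hps : γ (a * t + b) ∈ (chartAt H p).source := mem_chart_source H p
    have h1 : MDifferentiableAt 𝓘(ℝ, ℝ) I (fun t => γ (a * t + b)) t :=
      (hsm t ht).mdifferentiableAt (by norm_num)
    apply tchart_injOn p
    · exact hps
    · exact hps
    · rw [tchart_scale (v := lift I γ (a * t + b)) hps, tchart_lift (h.mdifferentiableAt ht) hps,
        tchart_lift h1 hps, hd p t ht hps]

end Geodesics

/-! ### The geodesic flow -/

section Flow

variable {E : Type*} [NormedAddCommGroup E] [NormedSpace ℝ E] [FiniteDimensional ℝ E]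
  {H : Type*} [TopologicalSpace H] {I : ModelWithCorners ℝ E H} [I.Boundaryless]
  {M : Type*} [TopologicalSpace M] [ChartedSpace H M] [IsManifold I ∞ M] [T2Space M]
  {D : CovariantDerivative I E (TangentSpace I : M → Type _)}

variable (D) in
/-- The domain of the inextendible geodesic with initial vector `v`. -/
def flowDomain (v : TangentBundle I M) : Set ℝ :=
  {t | ∃ (γ : ℝ → M) (J : Set ℝ), IsGeodesicOn D γ J ∧ 0 ∈ J ∧ t ∈ J ∧ lift I γ 0 = v}

open Classical in
variable (D) in
/-- The geodesic flow. -/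
def flow (t : ℝ) (v : TangentBundle I M) : TangentBundle I M :=
  if h : t ∈ flowDomain D v then lift I h.choose t else v

variable (D) in
/-- The inextendible geodesic with initial vector `v`. -/
def geodesicOf (v : TangentBundle I M) (t : ℝ) : M := (flow D t v).1

/-- By uniqueness the geodesic chosen in the definition of `flow` is immaterial: any geodesic with
initial vector `v` computes it. -/
lemma flow_eq_lift (hS : SmoothSpray D) {γ : ℝ → M} {J : Set ℝ} (h : IsGeodesicOn D γ J)
    (h0 : 0 ∈ J) {v : TangentBundle I M} (hv : lift I γ 0 = v) {t : ℝ} (ht : t ∈ J) :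
    t ∈ flowDomain D v ∧ flow D t v = lift I γ t := by
  have ht' : t ∈ flowDomain D v := ⟨γ, J, h, h0, ht, hv⟩
  refine ⟨ht', ?_⟩
  rw [flow, dif_pos ht']
  obtain ⟨J', h1, h2, h3, h4⟩ := ht'.choose_spec
  exact h1.lift_eqOn hS h h2 h0 (h4.trans hv.symm) ⟨h3, ht⟩

/-- Local existence and smoothness of the geodesic flow. -/
lemma exists_local_flow (hS : SmoothSpray D) (v₀ : TangentBundle I M) :
    ∃ δ > 0, ∃ W : Set (TangentBundle I M), IsOpen W ∧ v₀ ∈ W ∧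
      (∀ v ∈ W, Metric.ball 0 δ ⊆ flowDomain D v ∧ flow D 0 v = v) ∧
      ContMDiffOn (𝓘(ℝ, ℝ).prod I.tangent) I.tangent ∞
        (fun z : ℝ × TangentBundle I M => flow D z.1 z.2) (Metric.ball 0 δ ×ˢ W) := by
  set p := v₀.1 with hp
  have hv₀ : v₀.1 ∈ (chartAt H p).source := mem_chart_source H v₀.1
  have hopen : IsOpen ((extChartAt I p).target ×ˢ (univ : Set E)) :=
    (isOpen_extChartAt_target p).prod isOpen_univ
  obtain ⟨δ, hδ, Φ, h1, h2⟩ := exists_smooth_flow hopen (hS.contDiffOn_geodesicField p)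
    (x₀ := tchart I p v₀) ⟨tchart_fst_mem_target hv₀, trivial⟩
  have hsrc : IsOpen {v : TangentBundle I M | v.1 ∈ (chartAt H p).source} :=
    (chartAt H p).open_source.preimage (FiberBundle.continuous_proj E _)
  let W : Set (TangentBundle I M) :=
    {v | v.1 ∈ (chartAt H p).source} ∩ tchart I p ⁻¹' Metric.ball (tchart I p v₀) δ
  have hW : IsOpen W :=
    (contMDiffOn_tchart p).continuousOn.isOpen_inter_preimage hsrc Metric.isOpen_ball
  have hball : (Metric.ball (0 : ℝ) δ).OrdConnected := by
    rw [Real.ball_eq_Ioo]; exact ordConnected_Ioo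
  have h0 : (0 : ℝ) ∈ Metric.ball (0 : ℝ) δ := Metric.mem_ball_self hδ
  have key : ∀ v ∈ W, ∀ t ∈ Metric.ball (0 : ℝ) δ, t ∈ flowDomain D v ∧
      flow D t v = (tchart I p).symm (Φ (t, tchart I p v)) := by
    intro v hv t ht
    obtain ⟨h3, h4⟩ := h2 _ hv.2
    obtain ⟨h5, h6⟩ := isGeodesicOn_of_hasDerivAt hS (p := p)
      (z := fun s => Φ (s, tchart I p v)) Metric.isOpen_ball ⟨0, h0⟩ hball
      (fun s hs => ⟨(h4 s hs).1.1, (h4 s hs).2⟩)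
    have h7 := flow_eq_lift hS h5 h0 (v := v) (by
      rw [h6 0 h0, h3]
      exact (tchart I p).left_inv (mem_tchart_source.2 hv.1)) ht
    exact ⟨h7.1, h7.2.trans (h6 t ht)⟩
  refine ⟨δ, hδ, W, hW, ⟨hv₀, Metric.mem_ball_self hδ⟩, fun v hv =>
    ⟨fun t ht => (key v hv t ht).1, ?_⟩, ?_⟩
  · rw [(key v hv 0 h0).2, (h2 _ hv.2).1]
    exact (tchart I p).left_inv (mem_tchart_source.2 hv.1)
  · refine ContMDiffOn.congr (f := fun z : ℝ × TangentBundle I M =>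
      (tchart I p).symm (Φ (z.1, tchart I p z.2))) ?_ (fun z hz => (key z.2 hz.2 z.1 hz.1).2)
    have h8 : ContMDiffOn (𝓘(ℝ, ℝ).prod I.tangent) 𝓘(ℝ, ℝ × (E × E)) ∞
        (fun z : ℝ × TangentBundle I M => (z.1, tchart I p z.2)) (Metric.ball 0 δ ×ˢ W) := by
      refine contMDiffOn_fst.prodMk_space ?_
      exact (contMDiffOn_tchart p).comp contMDiffOn_snd fun z hz => hz.2.1
    have h9 := (contMDiffOn_iff_contDiffOn.2 h1).comp h8 (fun z hz => ⟨hz.1, hz.2.2⟩)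
    exact (contMDiffOn_tchart_symm p).comp h9 fun z hz => ((h2 _ hz.2.2).2 _ hz.1).1

lemma zero_mem_flowDomain (hS : SmoothSpray D) (v : TangentBundle I M) : 0 ∈ flowDomain D v := by
  obtain ⟨δ, hδ, W, -, hv, h, -⟩ := exists_local_flow hS v
  exact (h v hv).1 (Metric.mem_ball_self hδ)

lemma flow_zero (hS : SmoothSpray D) (v : TangentBundle I M) : flow D 0 v = v := by
  obtain ⟨δ, hδ, W, -, hv, h, -⟩ := exists_local_flow hS v
  exact (h v hv).2

lemma isOpen_flowDomain (v : TangentBundle I M) : IsOpen (flowDomain D v) := by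
  refine isOpen_iff_mem_nhds.2 fun t ⟨γ, J, h, h0, ht, hv⟩ => ?_
  filter_upwards [h.isOpen.mem_nhds ht] with s hs using ⟨γ, J, h, h0, hs, hv⟩

lemma ordConnected_flowDomain (v : TangentBundle I M) : (flowDomain D v).OrdConnected := by
  refine ordConnected_of_uIcc_subset_left (x := 0) fun t ⟨γ, J, h, h0, ht, hv⟩ s hs => ?_
  exact ⟨γ, J, h, h0, h.ordConnected.uIcc_subset h0 ht hs, hv⟩

/-- Near each time of the domain the curve coincides with a single geodesic, by `flow_eq_lift`, and
being a geodesic is local. -/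
lemma isGeodesicOn_geodesicOf (hS : SmoothSpray D) (v : TangentBundle I M) :
    IsGeodesicOn D (geodesicOf D v) (flowDomain D v) ∧
      ∀ t ∈ flowDomain D v, lift I (geodesicOf D v) t = flow D t v := by
  have key : ∀ t ∈ flowDomain D v, ∃ γ J, IsGeodesicOn D γ J ∧ t ∈ J ∧
      geodesicOf D v =ᶠ[𝓝 t] γ ∧ flow D t v = lift I γ t := by
    rintro t ⟨γ, J, h, h0, ht, hv⟩
    refine ⟨γ, J, h, ht, ?_, (flow_eq_lift hS h h0 hv ht).2⟩
    filter_upwards [h.isOpen.mem_nhds ht] with s hs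
    rw [geodesicOf, (flow_eq_lift hS h h0 hv hs).2]
    rfl
  refine ⟨isGeodesicOn_of_local (isOpen_flowDomain v) ⟨0, zero_mem_flowDomain hS v⟩
    (ordConnected_flowDomain v) fun t ht => ?_, fun t ht => ?_⟩
  · obtain ⟨γ, J, h1, h2, h3, -⟩ := key t ht
    exact ⟨γ, J, h1, h2, h3⟩
  · obtain ⟨γ, J, h1, h2, h3, h4⟩ := key t ht
    rw [h4, (lift_eventuallyEq_of_eventuallyEq h3).self_of_nhds]

lemma IsGeodesicOn.comp_add {γ : ℝ → M} {J : Set ℝ} (h : IsGeodesicOn D γ J) (b : ℝ) :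
    IsGeodesicOn D (fun t => γ (t + b)) ((fun t => t + b) ⁻¹' J) ∧
    ∀ t, t + b ∈ J → lift I (fun t => γ (t + b)) t = lift I γ (t + b) := by
  have := h.comp_affine one_ne_zero b
  simpa [scale_one] using this

/-- Any extension is itself a witness for membership in `flowDomain`, which already contains all its
times. -/
lemma isMaxGeodesicOn_geodesicOf (hS : SmoothSpray D) (v : TangentBundle I M) :
    IsMaxGeodesicOn D (geodesicOf D v) (flowDomain D v) := by
  obtain ⟨h1, h2⟩ := isGeodesicOn_geodesicOf hS v
  refine ⟨h1, fun γ' J' h' hJ he => (subset_antisymm hJ fun t ht => ?_).symm⟩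
  have h0 := zero_mem_flowDomain hS v
  refine (flow_eq_lift hS h' (hJ h0) ?_ ht).1
  have h3 : geodesicOf D v =ᶠ[𝓝 0] γ' := by
    filter_upwards [(isOpen_flowDomain v).mem_nhds h0] with s hs using he hs
  rw [← (lift_eventuallyEq_of_eventuallyEq h3).self_of_nhds, h2 0 h0, flow_zero hS]

/-- Every inextendible geodesic is given by the flow. -/
lemma IsMaxGeodesicOn.flow_eq (hS : SmoothSpray D) {γ : ℝ → M} {J : Set ℝ}
    (h : IsMaxGeodesicOn D γ J) {s : ℝ} (hs : s ∈ J) :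
    (∀ t, t ∈ flowDomain D (lift I γ s) ↔ t + s ∈ J) ∧
      ∀ t, t + s ∈ J → flow D t (lift I γ s) = lift I γ (t + s) := by
  obtain ⟨h1, h2⟩ := h.1.comp_add s
  set v := lift I γ s with hv
  have h0 : (0 : ℝ) + s ∈ J := by rwa [zero_add]
  have h3 : ∀ t, t + s ∈ J → t ∈ flowDomain D v ∧ flow D t v = lift I γ (t + s) := by
    intro t ht
    rw [← h2 t ht]
    exact flow_eq_lift hS h1 h0 (by rw [h2 0 h0, zero_add]) ht
  refine ⟨fun t => ⟨fun ht => ?_, fun ht => (h3 t ht).1⟩, fun t ht => (h3 t ht).2⟩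
  obtain ⟨h4, -⟩ := (isGeodesicOn_geodesicOf hS v).1.comp_add (-s)
  have h5 := h.2 _ _ h4 (fun r hr => by
      change r + -s ∈ flowDomain D v
      exact (h3 _ (by simpa using hr)).1) (fun r hr => by
      change γ r = (flow D (r + -s) v).1
      rw [(h3 (r + -s) (by simpa using hr)).2]
      simp [lift])
  rw [← h5]
  change t + s + -s ∈ flowDomain D v
  simpa using ht

/-- The curve `geodesicOf D v` is inextendible, so the flow restarted at time `t` runs along it on
exactly the shifted domain. -/
lemma flow_add (hS : SmoothSpray D) {v : TangentBundle I M} {t : ℝ} (ht : t ∈ flowDomain D v) :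
    (∀ s, s ∈ flowDomain D (flow D t v) ↔ s + t ∈ flowDomain D v) ∧
      ∀ s, s + t ∈ flowDomain D v → flow D s (flow D t v) = flow D (s + t) v := by
  obtain ⟨h1, h2⟩ := isGeodesicOn_geodesicOf hS v
  have h3 := (isMaxGeodesicOn_geodesicOf hS v).flow_eq hS ht
  rw [h2 t ht] at h3
  exact ⟨h3.1, fun s hs => by rw [h3.2 s hs, h2 _ hs]⟩

lemma flow_neg (hS : SmoothSpray D) {v : TangentBundle I M} {t : ℝ} (ht : t ∈ flowDomain D v) :
    -t ∈ flowDomain D (flow D t v) ∧ flow D (-t) (flow D t v) = v := by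
  have h0 : -t + t ∈ flowDomain D v := by
    rw [neg_add_cancel]; exact zero_mem_flowDomain hS v
  refine ⟨((flow_add hS ht).1 _).2 h0, ?_⟩
  rw [(flow_add hS ht).2 _ h0, neg_add_cancel, flow_zero hS]

/-- Affine reparametrization gives one inclusion of domains; the other is the same statement for
`c⁻¹`. -/
lemma flow_scale (hS : SmoothSpray D) {c : ℝ} (hc : c ≠ 0) (v : TangentBundle I M) :
    (∀ t, t ∈ flowDomain D (scale c v) ↔ c * t ∈ flowDomain D v) ∧
      ∀ t, c * t ∈ flowDomain D v → flow D t (scale c v) = scale c (flow D (c * t) v) := by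
  have key : ∀ {c : ℝ} (_ : c ≠ 0) (v : TangentBundle I M) (t : ℝ), c * t ∈ flowDomain D v →
      t ∈ flowDomain D (scale c v) ∧ flow D t (scale c v) = scale c (flow D (c * t) v) := by
    intro c hc v t ht
    obtain ⟨h1, h2⟩ := isGeodesicOn_geodesicOf hS v
    obtain ⟨h3, h4⟩ := h1.comp_affine hc 0
    simp only [add_zero] at h3 h4
    have h0 : c * 0 ∈ flowDomain D v := by rw [mul_zero]; exact zero_mem_flowDomain hS v
    have h5 := flow_eq_lift hS h3 (t := t) h0 (v := scale c v)
      (by rw [h4 0 h0, h2 _ h0, mul_zero, flow_zero hS]) ht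
    rw [h4 t ht, h2 _ ht] at h5
    exact h5
  refine ⟨fun t => ⟨fun ht => ?_, fun ht => (key hc v t ht).1⟩, fun t ht => (key hc v t ht).2⟩
  have h6 := (key (inv_ne_zero hc) (scale c v) (c * t) (by rwa [inv_mul_cancel_left₀ hc])).1
  rwa [scale_scale, inv_mul_cancel₀ hc, scale_one] at h6

lemma lift_const (q : M) (t : ℝ) : lift I (fun _ => q) t = ⟨q, 0⟩ := by
  have h1 : mfderiv 𝓘(ℝ, ℝ) I (fun _ : ℝ => q) t = 0 := mfderiv_const
  have h2 : velocity I (fun _ : ℝ => q) t = 0 := congrArg (fun A : ℝ →L[ℝ] E => A 1) h1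
  rw [lift, h2]

lemma flow_zero_vector (hS : SmoothSpray D) {v : TangentBundle I M} (hv : v.2 = 0) (t : ℝ) :
    t ∈ flowDomain D v ∧ flow D t v = v := by
  have hv' : v = ⟨v.1, 0⟩ := TotalSpace.ext rfl (heq_of_eq hv)
  have h := flow_eq_lift hS (isGeodesicOn_const (D := D) v.1) (mem_univ 0) (v := v)
    ((lift_const v.1 0).trans hv'.symm) (mem_univ t)
  exact ⟨h.1, h.2.trans ((lift_const v.1 t).trans hv'.symm)⟩

/-- A zero vector stays fixed under the flow, so flowing back from it could not reach `v`. -/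
lemma flow_snd_ne_zero (hS : SmoothSpray D) {v : TangentBundle I M} (hv : v.2 ≠ 0) {t : ℝ}
    (ht : t ∈ flowDomain D v) : (flow D t v).2 ≠ 0 := by
  intro h
  have h1 := (flow_neg hS ht).2
  rw [(flow_zero_vector hS h (-t)).2] at h1
  exact hv (h1 ▸ h)

/-- The flow is smooth on its open domain. -/
lemma contMDiffAt_flow (hS : SmoothSpray D) {v : TangentBundle I M} {t : ℝ}
    (ht : t ∈ flowDomain D v) :
    (∀ᶠ z in 𝓝 ((t, v) : ℝ × TangentBundle I M), z.1 ∈ flowDomain D z.2) ∧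
    ContMDiffAt (𝓘(ℝ, ℝ).prod I.tangent) I.tangent ∞
        (fun z : ℝ × TangentBundle I M => flow D z.1 z.2) (t, v) := by
  -- Local flows make short times good. The set of good times is shown to be open and closed in the
  -- interval `flowDomain D v`, so it is the whole interval.
  let Good : ℝ → TangentBundle I M → Prop := fun t v =>
    (∀ᶠ z in 𝓝 ((t, v) : ℝ × TangentBundle I M), z.1 ∈ flowDomain D z.2) ∧
    ContMDiffAt (𝓘(ℝ, ℝ).prod I.tangent) I.tangent ∞
        (fun z : ℝ × TangentBundle I M => flow D z.1 z.2) (t, v)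
  have hloc : ∀ v₀ : TangentBundle I M, ∃ δ > 0, ∃ W : Set (TangentBundle I M), IsOpen W ∧
      v₀ ∈ W ∧ ∀ s ∈ Metric.ball (0 : ℝ) δ, ∀ v ∈ W, Good s v := by
    intro v₀
    obtain ⟨δ, hδ, W, hW, hv, h1, h2⟩ := exists_local_flow hS v₀
    refine ⟨δ, hδ, W, hW, hv, fun s hs v hv => ?_⟩
    have hn : Metric.ball (0 : ℝ) δ ×ˢ W ∈ 𝓝 ((s, v) : ℝ × TangentBundle I M) :=
      (Metric.isOpen_ball.prod hW).mem_nhds ⟨hs, hv⟩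
    refine ⟨?_, h2.contMDiffAt hn⟩
    filter_upwards [hn] with z hz using (h1 z.2 hz.2).1 hz.1
  -- Near `(s + t, v)` the flow is the flow for a time close to `s` after the flow for the frozen
  -- time `t`.
  have hstep : ∀ t s v, Good t v → Good s (flow D t v) → Good (s + t) v := by
    intro t s v h1 h2
    have hsl : ContMDiffAt (𝓘(ℝ, ℝ).prod I.tangent) I.tangent ∞
        (fun z : ℝ × TangentBundle I M => flow D t z.2) (s + t, v) :=
      ContMDiffAt.comp (s + t, v) (g := fun z : ℝ × TangentBundle I M => flow D z.1 z.2)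
        (f := fun z : ℝ × TangentBundle I M => (t, z.2)) h1.2
        (contMDiffAt_const.prodMk contMDiffAt_snd)
    have hpair : ContMDiffAt (𝓘(ℝ, ℝ).prod I.tangent) (𝓘(ℝ, ℝ).prod I.tangent) ∞
        (fun z : ℝ × TangentBundle I M => (z.1 - t, flow D t z.2)) (s + t, v) := by
      refine ContMDiffAt.prodMk ?_ hsl
      exact contMDiffAt_fst.sub contMDiffAt_const
    have hpair0 : (fun z : ℝ × TangentBundle I M => (z.1 - t, flow D t z.2)) (s + t, v)
        = (s, flow D t v) := by simp
    have hcomp := ContMDiffAt.comp_of_eq (x := (s + t, v))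
      (g := fun z : ℝ × TangentBundle I M => flow D z.1 z.2) h2.2 hpair hpair0
    have hd1 : ∀ᶠ z in 𝓝 ((s + t, v) : ℝ × TangentBundle I M), t ∈ flowDomain D z.2 := by
      have hc : ContinuousAt (fun z : ℝ × TangentBundle I M => (t, z.2)) (s + t, v) := by fun_prop
      exact hc.eventually h1.1
    have hd2 : ∀ᶠ z in 𝓝 ((s + t, v) : ℝ × TangentBundle I M),
        z.1 - t ∈ flowDomain D (flow D t z.2) := by
      have hc : Filter.Tendsto (fun z : ℝ × TangentBundle I M => (z.1 - t, flow D t z.2))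
          (𝓝 (s + t, v)) (𝓝 (s, flow D t v)) := by
        simpa [ContinuousAt] using hpair.continuousAt
      exact hc.eventually h2.1
    refine ⟨?_, hcomp.congr_of_eventuallyEq ?_⟩
    · filter_upwards [hd1, hd2] with z hz1 hz2
      simpa using ((flow_add hS hz1).1 _).1 hz2
    · filter_upwards [hd1, hd2] with z hz1 hz2
      have h3 := ((flow_add hS hz1).1 _).1 hz2
      have h4 := (flow_add hS hz1).2 _ h3
      rw [sub_add_cancel] at h4
      exact h4.symm
  -- One neighborhood `W` of `flow D r v` carries short flows for all starting points in it, so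
  -- `hstep` works both from `s` to `r` and from `r` to `s`; the second gives openness, the first
  -- closedness.
  have hiff : ∀ r ∈ flowDomain D v, ∀ᶠ s in 𝓝 r, Good s v ↔ Good r v := by
    intro r hr
    obtain ⟨δ, hδ, W, hW, hvW, hg⟩ := hloc (flow D r v)
    have h1 : ContinuousAt (fun s => flow D s v) r := by
      obtain ⟨h2, h3⟩ := isGeodesicOn_geodesicOf hS v
      refine (h2.continuousAt_lift hr).congr ?_
      filter_upwards [(isOpen_flowDomain v).mem_nhds hr] with s hs using h3 s hs
    filter_upwards [h1 (hW.mem_nhds hvW), Metric.ball_mem_nhds r hδ] with s hs hs'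
    rw [Metric.mem_ball, Real.dist_eq] at hs'
    refine ⟨fun h => ?_, fun h => ?_⟩
    · have := hstep s (r - s) v h (hg _ (by simpa [abs_sub_comm] using hs') _ hs)
      simpa using this
    · have := hstep r (s - r) v h (hg _ (by simpa using hs') _ hvW)
      simpa using this
  have hA : IsOpen {s | s ∈ flowDomain D v ∧ Good s v} := isOpen_iff_mem_nhds.2 fun s hs => by
    filter_upwards [hiff s hs.1, (isOpen_flowDomain v).mem_nhds hs.1] with r hr hr'
      using ⟨hr', hr.2 hs.2⟩
  have hB : IsOpen {s | s ∈ flowDomain D v ∧ ¬ Good s v} := isOpen_iff_mem_nhds.2 fun s hs => by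
    filter_upwards [hiff s hs.1, (isOpen_flowDomain v).mem_nhds hs.1] with r hr hr'
      using ⟨hr', fun h => hs.2 (hr.1 h)⟩
  change Good t v
  by_contra hne
  have h0 : Good 0 v := by
    obtain ⟨δ, hδ, W, hW, hvW, hg⟩ := hloc v
    exact hg 0 (Metric.mem_ball_self hδ) v hvW
  obtain ⟨r, -, hr, hr'⟩ := (ordConnected_flowDomain v).isPreconnected _ _ hA hB
    (fun r hr => (em (Good r v)).imp (fun e => ⟨hr, e⟩) fun e => ⟨hr, e⟩)
    ⟨0, zero_mem_flowDomain hS v, zero_mem_flowDomain hS v, h0⟩ ⟨t, ht, ht, hne⟩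
  exact hr'.2 hr.2

end Flow

/-! ### The relation defining the space of geodesics -/

section Relation

variable {E : Type*} [NormedAddCommGroup E] [NormedSpace ℝ E] [FiniteDimensional ℝ E]
  {H : Type*} [TopologicalSpace H] {I : ModelWithCorners ℝ E H} [I.Boundaryless]
  {M : Type*} [TopologicalSpace M] [ChartedSpace H M] [IsManifold I ∞ M] [T2Space M]
  {D : CovariantDerivative I E (TangentSpace I : M → Type _)}

variable (D) in
/-- The tangent vectors `v` and `w` are tangent to a common inextendible geodesic. -/
def SameGeodesic (v w : TangentBundle I M) : Prop :=
  ∃ c : ℝ, c ≠ 0 ∧ ∃ t ∈ flowDomain D v, w = scale c (flow D t v)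

lemma SameGeodesic.refl (hS : SmoothSpray D) (v : TangentBundle I M) : SameGeodesic D v v :=
  ⟨1, one_ne_zero, 0, zero_mem_flowDomain hS v, by rw [flow_zero hS, scale_one]⟩

lemma SameGeodesic.symm (hS : SmoothSpray D) {v w : TangentBundle I M} (h : SameGeodesic D v w) :
    SameGeodesic D w v := by
  obtain ⟨c, hc, t, ht, rfl⟩ := h
  obtain ⟨h1, h2⟩ := flow_neg hS ht
  have h3 : c * (-t / c) = -t := by field_simp
  refine ⟨c⁻¹, inv_ne_zero hc, -t / c, ((flow_scale hS hc _).1 _).2 (h3.symm ▸ h1), ?_⟩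
  rw [(flow_scale hS hc _).2 _ (h3.symm ▸ h1), h3, h2, scale_scale, inv_mul_cancel₀ hc, scale_one]

lemma SameGeodesic.trans (hS : SmoothSpray D) {u v w : TangentBundle I M}
    (h : SameGeodesic D u v) (h' : SameGeodesic D v w) : SameGeodesic D u w := by
  obtain ⟨c, hc, t, ht, rfl⟩ := h
  obtain ⟨d, hd, s, hs, rfl⟩ := h'
  have h1 := ((flow_scale hS hc _).1 _).1 hs
  have h2 := ((flow_add hS ht).1 _).1 h1
  refine ⟨d * c, mul_ne_zero hd hc, c * s + t, h2, ?_⟩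
  rw [(flow_scale hS hc _).2 _ h1, (flow_add hS ht).2 _ h2, scale_scale]

lemma tangentLine_eq_iff {v w : reducedTangentBundle I M} :
    tangentLine v = tangentLine w ↔ ∃ c : ℝ, c ≠ 0 ∧ (w : TangentBundle I M) = scale c v.1 :=
  Quotient.eq (r := proportionalSetoid I M)

/-- `SameGeodesic` as an equivalence relation on the reduced tangent bundle. -/
def sameGeodesicSetoid (hS : SmoothSpray D) : Setoid (reducedTangentBundle I M) where
  r v w := SameGeodesic D v.1 w.1
  iseqv := ⟨fun v => .refl hS v.1, fun h => h.symm hS, fun h h' => h.trans hS h'⟩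

lemma OnCommonGeodesic.sameGeodesic (hS : SmoothSpray D) {v w : reducedTangentBundle I M}
    (h : OnCommonGeodesic D (tangentLine v) (tangentLine w)) : SameGeodesic D v.1 w.1 := by
  obtain ⟨γ, J, hm, s, hs, t, ht, ⟨_, h1⟩, ⟨_, h2⟩⟩ := h
  obtain ⟨c, hc, h1⟩ := tangentLine_eq_iff.1 h1.symm
  obtain ⟨d, hd, h2⟩ := tangentLine_eq_iff.1 h2.symm
  have hz : ∀ u : TangentBundle I M, ∀ {c : ℝ}, c ≠ 0 → SameGeodesic D u (scale c u) :=
    fun u c hc => ⟨c, hc, 0, zero_mem_flowDomain hS u, by rw [flow_zero hS]⟩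
  have h3 := hz (lift I γ s) hc
  have h4 := hz (lift I γ t) hd
  have h5 : SameGeodesic D (lift I γ s) (lift I γ t) := by
    have h6 : t - s + s ∈ J := by rwa [sub_add_cancel]
    refine ⟨1, one_ne_zero, t - s, ((hm.flow_eq hS hs).1 _).2 h6, ?_⟩
    rw [(hm.flow_eq hS hs).2 _ h6, scale_one, sub_add_cancel]
  rw [h1, h2]
  exact (h3.symm hS).trans hS (h5.trans hS h4)

/-- The quotient is by the equivalence generated by `OnCommonGeodesic`. This relation implies
`SameGeodesic`, which is already an equivalence, so passing to the generated one adds nothing.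
Conversely `geodesicOf` supplies the inextendible geodesic. -/
lemma toGeodesicQuotient_eq_iff (hS : SmoothSpray D) {v w : reducedTangentBundle I M} :
    toGeodesicQuotient D v = toGeodesicQuotient D w ↔ SameGeodesic D v.1 w.1 := by
  constructor
  · intro h
    let f : ProjTangentBundle I M → Quotient (sameGeodesicSetoid hS) :=
      Quotient.lift (fun v => Quotient.mk (sameGeodesicSetoid hS) v) fun a b hab => by
        obtain ⟨c, hc, h1⟩ := hab
        refine Quotient.sound (s := sameGeodesicSetoid hS) ⟨c, hc, 0, zero_mem_flowDomain hS _, ?_⟩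
        rw [flow_zero hS]
        exact h1
    let F : GeodesicQuotient D → Quotient (sameGeodesicSetoid hS) :=
      Quot.lift f fun a b => by
        refine Quotient.inductionOn₂ a b fun v w hvw => ?_
        exact Quotient.sound (s := sameGeodesicSetoid hS) (OnCommonGeodesic.sameGeodesic hS hvw)
    exact Quotient.exact (s := sameGeodesicSetoid hS) (congrArg F h)
  · rintro ⟨c, hc, t, ht, h⟩
    obtain ⟨h1, h2⟩ := isGeodesicOn_geodesicOf hS v.1
    have h0 := zero_mem_flowDomain hS v.1
    have h3 : lift I (geodesicOf D v.1) 0 = v.1 := by rw [h2 0 h0, flow_zero hS]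
    have h4 := h2 t ht
    have hne0 : (lift I (geodesicOf D v.1) 0).2 ≠ 0 := by rw [h3]; exact v.2
    have hne : (lift I (geodesicOf D v.1) t).2 ≠ 0 := by
      rw [h4]; exact flow_snd_ne_zero hS v.2 ht
    refine Quot.sound ⟨geodesicOf D v.1, flowDomain D v.1, isMaxGeodesicOn_geodesicOf hS v.1,
      0, h0, t, ht, ⟨hne0, ?_⟩, ⟨hne, ?_⟩⟩
    · exact congrArg tangentLine (Subtype.ext h3.symm)
    · exact (tangentLine_eq_iff.2 ⟨c, hc, h.trans (congrArg (scale c) h4.symm)⟩).symm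

lemma contMDiffAt_scale_flow (hS : SmoothSpray D) {v : TangentBundle I M} {t : ℝ}
    (ht : t ∈ flowDomain D v) (c : ℝ) :
    ContMDiffAt I.tangent I.tangent ∞ (fun x => scale c (flow D t x)) v := by
  have h1 : ContMDiffAt I.tangent (𝓘(ℝ, ℝ).prod I.tangent) ∞
      (fun x : TangentBundle I M => (t, x)) v := contMDiffAt_const.prodMk contMDiffAt_id
  have h2 : ContMDiffAt I.tangent I.tangent ∞ (fun x => flow D t x) v :=
    ContMDiffAt.comp (g := fun z : ℝ × TangentBundle I M => flow D z.1 z.2) v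
      (contMDiffAt_flow hS ht).2 h1
  exact ((contMDiff_scale c).contMDiffAt).comp v h2

lemma eventually_mem_flowDomain (hS : SmoothSpray D) {v : TangentBundle I M} {t : ℝ}
    (ht : t ∈ flowDomain D v) : ∀ᶠ x in 𝓝 v, t ∈ flowDomain D x := by
  have hc : ContinuousAt (fun x : TangentBundle I M => (t, x)) v := by fun_prop
  exact hc.eventually (contMDiffAt_flow hS ht).1

lemma contMDiffAt_opens_iff {E' : Type*} [NormedAddCommGroup E'] [NormedSpace ℝ E']
    {H' : Type*} [TopologicalSpace H'] {I' : ModelWithCorners ℝ E' H'}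
    {N : Type*} [TopologicalSpace N] [ChartedSpace H' N] {U : TopologicalSpace.Opens M}
    {f : N → U} {x : N} {n : ℕ∞ω} :
    ContMDiffAt I' I n f x ↔ ContMDiffAt I' I n (fun y => (f y : M)) x := by
  have h : IsInducing (Subtype.val : U → M) := IsInducing.subtypeVal
  rw [contMDiffAt_iff, contMDiffAt_iff, h.continuousAt_iff (f := f)]
  rfl

lemma scale_flow_mem (hS : SmoothSpray D) {v : TangentBundle I M} (hv : v.2 ≠ 0) {t c : ℝ}
    (ht : t ∈ flowDomain D v) (hc : c ≠ 0) : (scale c (flow D t v)).2 ≠ 0 :=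
  smul_ne_zero hc (flow_snd_ne_zero hS hv ht)

/-- Two tangent vectors of the same geodesic are related by a local diffeomorphism which
preserves geodesics. -/
lemma exists_holonomy (hS : SmoothSpray D) {v w : reducedTangentBundle I M}
    (h : toGeodesicQuotient D v = toGeodesicQuotient D w) :
    ∃ Θ : reducedTangentBundle I M → reducedTangentBundle I M,
      ContMDiffAt I.tangent I.tangent ∞ Θ v ∧ Θ v = w ∧
      ∀ᶠ x in 𝓝 v, toGeodesicQuotient D (Θ x) = toGeodesicQuotient D x := by
  classical
  obtain ⟨c, hc, t, ht, h⟩ := (toGeodesicQuotient_eq_iff hS).1 h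
  -- The time `t` and the factor `c` that relate `v` to `w` are kept fixed. The value where the flow
  -- is undefined is irrelevant, since only the germ at `v` is used.
  let Θ : reducedTangentBundle I M → reducedTangentBundle I M := fun x =>
    if hx : t ∈ flowDomain D x.1 then ⟨scale c (flow D t x.1), scale_flow_mem hS x.2 hx hc⟩ else x
  have hΘ : ∀ {x : reducedTangentBundle I M} (hx : t ∈ flowDomain D x.1),
      (Θ x : TangentBundle I M) = scale c (flow D t x.1) := fun {x} hx => by
    simp only [Θ, dif_pos hx]
  have hev : ∀ᶠ x : reducedTangentBundle I M in 𝓝 v, t ∈ flowDomain D x.1 :=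
    continuous_subtype_val.continuousAt.eventually (eventually_mem_flowDomain hS ht)
  refine ⟨Θ, ?_, Subtype.ext ((hΘ ht).trans h.symm), ?_⟩
  · rw [contMDiffAt_opens_iff]
    have h1 : ContMDiffAt I.tangent I.tangent ∞
        (fun x : reducedTangentBundle I M => scale c (flow D t x.1)) v :=
      (contMDiffAt_scale_flow hS ht c).comp v contMDiff_subtype_val.contMDiffAt
    refine h1.congr_of_eventuallyEq ?_
    filter_upwards [hev] with x hx using hΘ hx
  · filter_upwards [hev] with x hx
    exact ((toGeodesicQuotient_eq_iff hS).2 ⟨c, hc, t, hx, hΘ hx⟩).symm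

variable (D) in
lemma isQuotientMap_toGeodesicQuotient : IsQuotientMap (toGeodesicQuotient D) :=
  (isQuotientMap_quot_mk (r := OnCommonGeodesic D)).comp
    (isQuotientMap_quotient_mk' (s := proportionalSetoid I M))

/-- The saturation of an open set is open: holonomy carries a neighborhood of any equivalent vector
into the set without changing classes. -/
lemma isOpenQuotientMap_toGeodesicQuotient (hS : SmoothSpray D) :
    IsOpenQuotientMap (toGeodesicQuotient D) := by
  have hq := isQuotientMap_toGeodesicQuotient D
  refine ⟨hq.surjective, hq.continuous, fun U hU => hq.isOpen_preimage.1 ?_⟩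
  refine isOpen_iff_mem_nhds.2 ?_
  rintro w ⟨v, hv, h⟩
  obtain ⟨Θ, h1, h2, h3⟩ := exists_holonomy hS h.symm
  filter_upwards [h3, h1.continuousAt (hU.mem_nhds (h2.symm ▸ hv))] with x hx hx'
  exact ⟨Θ x, hx', hx⟩

end Relation

/-! ### Quotient manifolds from transverse slices -/

section Slice

variable {E : Type*} [NormedAddCommGroup E] [NormedSpace ℝ E]
  {H : Type*} [TopologicalSpace H] (J : ModelWithCorners ℝ E H)
  {T : Type*} [TopologicalSpace T] [ChartedSpace H T] [IsManifold J ∞ T]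
  {G : Type*} [TopologicalSpace G] (q : T → G)
  (F : Type*) [NormedAddCommGroup F] [NormedSpace ℝ F]

/-- A submanifold `toFun '' base` with a smooth projection `proj` onto it along the fibers of `q`,
and which meets each fiber at most once. -/
structure TransverseSlice where
  base : Set F
  toFun : F → T
  nbhd : Set T
  proj : T → F
  isOpen_base : IsOpen base
  isOpen_nbhd : IsOpen nbhd
  contMDiffOn_toFun : ContMDiffOn 𝓘(ℝ, F) J ∞ toFun base
  contMDiffOn_proj : ContMDiffOn J 𝓘(ℝ, F) ∞ proj nbhd
  mapsTo_toFun : MapsTo toFun base nbhd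
  mapsTo_proj : MapsTo proj nbhd base
  proj_toFun : ∀ b ∈ base, proj (toFun b) = b
  comp_proj : ∀ w ∈ nbhd, q (toFun (proj w)) = q w
  injOn : InjOn (q ∘ toFun) base

variable {J q F}

namespace TransverseSlice

lemma proj_eq (s : TransverseSlice J q F) {w w' : T} (hw : w ∈ s.nbhd) (hw' : w' ∈ s.nbhd)
    (h : q w = q w') : s.proj w = s.proj w' := by
  refine s.injOn (s.mapsTo_proj hw) (s.mapsTo_proj hw') ?_
  simp only [Function.comp_apply, s.comp_proj w hw, s.comp_proj w' hw', h]

variable (hq : IsOpenQuotientMap q)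

open Classical in
/-- The chart of the quotient given by a slice. -/
def chart (s : TransverseSlice J q F) : OpenPartialHomeomorph G F where
  toFun g := if h : g ∈ q '' s.nbhd then s.proj h.choose else 0
  invFun := q ∘ s.toFun
  source := q '' s.nbhd
  target := s.base
  map_source' := by
    intro g h
    rw [dif_pos h]
    exact s.mapsTo_proj h.choose_spec.1
  map_target' := fun b hb => ⟨_, s.mapsTo_toFun hb, rfl⟩
  left_inv' := by
    intro g h
    rw [dif_pos h]
    exact (s.comp_proj _ h.choose_spec.1).trans h.choose_spec.2
  right_inv' := by
    intro b hb
    have h : (q ∘ s.toFun) b ∈ q '' s.nbhd := ⟨_, s.mapsTo_toFun hb, rfl⟩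
    rw [dif_pos h, s.proj_eq h.choose_spec.1 (s.mapsTo_toFun hb) h.choose_spec.2,
      s.proj_toFun b hb]
  open_source := hq.isOpenMap _ s.isOpen_nbhd
  open_target := s.isOpen_base
  continuousOn_toFun := by
    rintro _ ⟨w, hw, rfl⟩
    refine ContinuousAt.continuousWithinAt ?_
    have h1 : 𝓝 (q w) = Filter.map q (𝓝 w) :=
      (hq.isOpenMap.map_nhds_eq hq.continuous.continuousAt).symm
    -- The chosen representative does not matter, because `proj` is constant on each fiber within
    -- `nbhd`.
    have h2 : ∀ x ∈ s.nbhd, (if h : q x ∈ q '' s.nbhd then s.proj h.choose else 0) = s.proj x := by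
      intro x hx
      have h : q x ∈ q '' s.nbhd := ⟨x, hx, rfl⟩
      rw [dif_pos h]
      exact s.proj_eq h.choose_spec.1 hx h.choose_spec.2
    rw [ContinuousAt, h2 w hw, h1, Filter.tendsto_map'_iff]
    refine ((s.contMDiffOn_proj.contMDiffAt (s.isOpen_nbhd.mem_nhds hw)).continuousAt.tendsto).congr'
      ?_
    filter_upwards [s.isOpen_nbhd.mem_nhds hw] with x hx using (h2 x hx).symm
  continuousOn_invFun := hq.continuous.comp_continuousOn s.contMDiffOn_toFun.continuousOn

open Classical in
lemma chart_apply (s : TransverseSlice J q F) {w : T} (hw : w ∈ s.nbhd) :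
    s.chart hq (q w) = s.proj w := by
  have h : q w ∈ q '' s.nbhd := ⟨w, hw, rfl⟩
  change (if h : q w ∈ q '' s.nbhd then s.proj h.choose else 0) = s.proj w
  rw [dif_pos h]
  exact s.proj_eq h.choose_spec.1 hw h.choose_spec.2

/-- Near a point the transition map is `s'.proj ∘ Θ ∘ s.toFun`, with `Θ` a holonomy map carrying the
first slice into the domain of the second projection. -/
lemma contDiffOn_transition (hΘ : ∀ v w : T, q v = q w → ∃ Θ : T → T,
      ContMDiffAt J J ∞ Θ v ∧ Θ v = w ∧ ∀ᶠ x in 𝓝 v, q (Θ x) = q x)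
    (s s' : TransverseSlice J q F) :
    ContDiffOn ℝ ∞ (s'.chart hq ∘ (s.chart hq).symm)
      ((s.chart hq).symm.trans (s'.chart hq)).source := by
  intro b hb
  rw [OpenPartialHomeomorph.trans_source] at hb
  obtain ⟨hb, w, hw, h⟩ := hb
  have hb : b ∈ s.base := hb
  have h : q w = q (s.toFun b) := h
  obtain ⟨Θ, h1, h2, h3⟩ := hΘ _ _ h.symm
  have h4 : ContMDiffAt 𝓘(ℝ, F) J ∞ s.toFun b :=
    s.contMDiffOn_toFun.contMDiffAt (s.isOpen_base.mem_nhds hb)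
  have h5 : ContMDiffAt J 𝓘(ℝ, F) ∞ s'.proj (Θ (s.toFun b)) :=
    s'.contMDiffOn_proj.contMDiffAt (s'.isOpen_nbhd.mem_nhds (h2.symm ▸ hw))
  have h6 := (h5.comp _ h1).comp b h4
  refine (contMDiffAt_iff_contDiffAt.1 (h6.congr_of_eventuallyEq ?_)).contDiffWithinAt
  have h7 : ∀ᶠ x in 𝓝 (s.toFun b), Θ x ∈ s'.nbhd :=
    h1.continuousAt (s'.isOpen_nbhd.mem_nhds (h2.symm ▸ hw))
  filter_upwards [h4.continuousAt.eventually h3, h4.continuousAt.eventually h7] with x hx hx'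
  change s'.chart hq (q (s.toFun x)) = s'.proj (Θ (s.toFun x))
  rw [← hx, chart_apply hq s' hx']

end TransverseSlice

/-- The quotient is a manifold if there are transverse slices through all points and the fibers
have smooth holonomy. -/
theorem exists_quotient_manifold {d : ℕ} (hq : IsOpenQuotientMap q)
    (hΘ : ∀ v w : T, q v = q w → ∃ Θ : T → T,
      ContMDiffAt J J ∞ Θ v ∧ Θ v = w ∧ ∀ᶠ x in 𝓝 v, q (Θ x) = q x)
    (hs : ∀ v : T, ∃ s : TransverseSlice J q (EuclideanSpace ℝ (Fin d)),
      v ∈ s.nbhd ∧ s.toFun (s.proj v) = v) :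
    ∃ _ : ChartedSpace (EuclideanSpace ℝ (Fin d)) G,
      IsManifold (𝓡 d) ∞ G ∧ ContMDiff J (𝓡 d) ∞ q ∧
      ∀ v : T, Function.Surjective (mfderiv J (𝓡 d) q v) := by
  choose s hs1 hs2 using hs
  choose r hr using hq.surjective
  let _ : ChartedSpace (EuclideanSpace ℝ (Fin d)) G :=
    { atlas := range fun s : TransverseSlice J q (EuclideanSpace ℝ (Fin d)) => s.chart hq
      chartAt := fun g => (s (r g)).chart hq
      mem_chart_source := fun g => ⟨r g, hs1 _, hr g⟩
      chart_mem_atlas := fun g => ⟨s (r g), rfl⟩ }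
  have hM : IsManifold (𝓡 d) ∞ G := by
    refine isManifold_of_contDiffOn _ _ _ ?_
    rintro _ _ ⟨s, rfl⟩ ⟨s', rfl⟩
    simpa using TransverseSlice.contDiffOn_transition hq hΘ s s'
  have hmem : ∀ s : TransverseSlice J q (EuclideanSpace ℝ (Fin d)),
      s.chart hq ∈ IsManifold.maximalAtlas (𝓡 d) ∞ G :=
    fun s => IsManifold.subset_maximalAtlas ⟨s, rfl⟩
  have hsm : ContMDiff J (𝓡 d) ∞ q := by
    intro v
    have h1 : ContMDiffAt J (𝓡 d) ∞ (s v).proj v :=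
      (s v).contMDiffOn_proj.contMDiffAt ((s v).isOpen_nbhd.mem_nhds (hs1 v))
    have h2 : ContMDiffAt (𝓡 d) (𝓡 d) ∞ ((s v).chart hq).symm ((s v).proj v) :=
      (contMDiffOn_symm_of_mem_maximalAtlas (hmem (s v))).contMDiffAt
        ((s v).isOpen_base.mem_nhds ((s v).mapsTo_proj (hs1 v)))
    refine (h2.comp v h1).congr_of_eventuallyEq ?_
    filter_upwards [(s v).isOpen_nbhd.mem_nhds (hs1 v)] with x hx
    exact ((s v).comp_proj x hx).symm
  refine ⟨inferInstance, hM, hsm, fun v => ?_⟩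
  have hsrc : q v ∈ ((s v).chart hq).source := ⟨v, hs1 v, rfl⟩
  have happ := (s v).chart_apply hq (hs1 v)
  have h1 : ContMDiffAt (𝓡 d) (𝓡 d) ∞ ((s v).chart hq) (q v) :=
    (contMDiffOn_of_mem_maximalAtlas (hmem (s v))).contMDiffAt
      (((s v).chart hq).open_source.mem_nhds hsrc)
  -- The slice composed with its chart is a smooth local section of `q`, and by `hs2` it passes
  -- through `v`. Differentiating `q ∘ section = id` gives surjectivity.
  have h2 : ContMDiffAt (𝓡 d) J ∞ (s v).toFun ((s v).chart hq (q v)) :=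
    (s v).contMDiffOn_toFun.contMDiffAt
      ((s v).isOpen_base.mem_nhds (happ.symm ▸ (s v).mapsTo_proj (hs1 v)))
  have h3 := h2.comp (q v) h1
  have h4 : ((s v).toFun ∘ (s v).chart hq) (q v) = v := by
    rw [Function.comp_apply, happ, hs2]
  have h5 : MDifferentiableAt (𝓡 d) J ((s v).toFun ∘ (s v).chart hq) (q v) :=
    h3.mdifferentiableAt (by simp)
  have h6 : MDifferentiableAt J (𝓡 d) q (((s v).toFun ∘ (s v).chart hq) (q v)) :=
    (hsm _).mdifferentiableAt (by simp)
  have h7 := mfderiv_comp (q v) h6 h5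
  have h8 : q ∘ ((s v).toFun ∘ (s v).chart hq) =ᶠ[𝓝 (q v)] id := by
    filter_upwards [((s v).chart hq).open_source.mem_nhds hsrc] with g hg
    exact ((s v).chart hq).left_inv hg
  rw [h8.mfderiv_eq, mfderiv_id] at h7
  intro y
  have h9 := congrArg (fun A : EuclideanSpace ℝ (Fin d) →L[ℝ] EuclideanSpace ℝ (Fin d) => A y) h7
  -- The section sends `q v` to `v` only propositionally; this transports the differential between
  -- the two tangent spaces.
  have key : ∀ u : T, u = v → ∀ A : EuclideanSpace ℝ (Fin d) →L[ℝ] E,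
      y = (mfderiv J (𝓡 d) q u : E →L[ℝ] EuclideanSpace ℝ (Fin d)) (A y) →
      ∃ a, (mfderiv J (𝓡 d) q v : E →L[ℝ] EuclideanSpace ℝ (Fin d)) a = y := by
    rintro u rfl A hA
    exact ⟨A y, hA.symm⟩
  exact key _ h4 _ h9

end Slice

/-! ### Transverse slices for the geodesic flow -/

section GeodesicSlice

variable {E : Type*} [NormedAddCommGroup E] [NormedSpace ℝ E] [FiniteDimensional ℝ E]
  {H : Type*} [TopologicalSpace H] {I : ModelWithCorners ℝ E H} [I.Boundaryless]
  {M : Type*} [TopologicalSpace M] [ChartedSpace H M] [IsManifold I ∞ M] [T2Space M]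
  {D : CovariantDerivative I E (TangentSpace I : M → Type _)}

lemma hasDerivAt_tchart_flow (hS : SmoothSpray D) {v : TangentBundle I M} {t : ℝ}
    (ht : t ∈ flowDomain D v) {p : M} (hp : (flow D t v).1 ∈ (chartAt H p).source) :
    HasDerivAt (fun s => tchart I p (flow D s v))
      (geodesicField D p (tchart I p (flow D t v))) t := by
  obtain ⟨h1, h2⟩ := isGeodesicOn_geodesicOf hS v
  have h3 := h1.hasDerivAt_tchart_lift ht (p := p) hp
  rw [h2 t ht] at h3
  refine h3.congr_of_eventuallyEq ?_
  filter_upwards [(isOpen_flowDomain v).mem_nhds ht] with s hs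
  rw [h2 s hs]

lemma flow_zero_proj (hS : SmoothSpray D) (v : TangentBundle I M) : (flow D 0 v).1 = v.1 := by
  rw [flow_zero hS]

lemma continuousAt_flow (hS : SmoothSpray D) {v : TangentBundle I M} {t : ℝ}
    (ht : t ∈ flowDomain D v) :
    ContinuousAt (fun z : ℝ × TangentBundle I M => flow D z.1 z.2) (t, v) :=
  (contMDiffAt_flow hS ht).2.continuousAt

/-- A coordinate function transverse to `v₀` grows linearly along all geodesics near `v₀`. -/
lemma exists_transverse_growth (hS : SmoothSpray D) {v₀ : TangentBundle I M} (l : E →L[ℝ] ℝ)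
    (hl : l (tchart I v₀.1 v₀).2 = 1) :
    ∃ T > 0, ∀ᶠ v in 𝓝 v₀, ∀ s : ℝ, |s| ≤ T → s ∈ flowDomain D v ∧
      (flow D s v).1 ∈ (chartAt H v₀.1).source ∧
      |s| / 2 ≤ |l (tchart I v₀.1 (flow D s v)).1 - l (tchart I v₀.1 v).1| := by
  set p := v₀.1 with hp
  have hps : v₀.1 ∈ (chartAt H p).source := mem_chart_source H p
  have h0 := zero_mem_flowDomain hS v₀
  -- The derivative of the coordinate `l` along a geodesic is `l` of the velocity, which is 1 at
  -- `v₀` and hence above 1/2 nearby. The mean value theorem then gives the growth rate 1/2.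
  have hN : ∀ᶠ u : TangentBundle I M in 𝓝 v₀,
      u.1 ∈ (chartAt H p).source ∧ 1 / 2 < l (tchart I p u).2 := by
    have hc : ContinuousAt (fun u : TangentBundle I M => l (tchart I p u).2) v₀ :=
      l.continuous.continuousAt.comp
        (continuous_snd.continuousAt.comp (contMDiffAt_tchart hps).continuousAt)
    have hlt : (1 / 2 : ℝ) < l (tchart I p v₀).2 := by rw [hl]; norm_num
    have hsrc : ∀ᶠ u : TangentBundle I M in 𝓝 v₀, u.1 ∈ (chartAt H p).source :=
      ((chartAt H p).open_source.preimage (FiberBundle.continuous_proj E _)).mem_nhds hps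
    exact hsrc.and (hc.eventually (lt_mem_nhds hlt))
  have hN' : ∀ᶠ z : ℝ × TangentBundle I M in 𝓝 (0, v₀), z.1 ∈ flowDomain D z.2 ∧
      (flow D z.1 z.2).1 ∈ (chartAt H p).source ∧ 1 / 2 < l (tchart I p (flow D z.1 z.2)).2 := by
    have hc := continuousAt_flow hS h0
    rw [ContinuousAt, flow_zero hS] at hc
    exact (contMDiffAt_flow hS h0).1.and (hc.eventually hN)
  rw [nhds_prod_eq] at hN'
  obtain ⟨P, hP, Q, hQ, h⟩ := Filter.eventually_prod_iff.1 hN'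
  obtain ⟨T, hT, hPT⟩ := Metric.eventually_nhds_iff.1 hP
  refine ⟨T / 2, half_pos hT, ?_⟩
  filter_upwards [hQ] with v hv
  have hI : ∀ s ∈ Icc (-(T / 2)) (T / 2), s ∈ flowDomain D v ∧
      (flow D s v).1 ∈ (chartAt H p).source ∧ 1 / 2 < l (tchart I p (flow D s v)).2 := by
    intro s hs
    refine h (hPT ?_) hv
    rw [Real.dist_eq, sub_zero]
    exact (abs_le.2 hs).trans_lt (by linarith)
  let f : ℝ → ℝ := fun s => l (tchart I p (flow D s v)).1
  have hf : ∀ s ∈ Icc (-(T / 2)) (T / 2), HasDerivAt f (l (tchart I p (flow D s v)).2) s := by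
    intro s hs
    exact l.hasFDerivAt.comp_hasDerivAt s
      (hasDerivAt_tchart_flow hS (hI s hs).1 (hI s hs).2.1).fst
  have hmono := (convex_Icc (-(T / 2)) (T / 2)).mul_sub_le_image_sub_of_le_deriv (f := f)
    (fun s hs => (hf s hs).continuousAt.continuousWithinAt)
    (fun s hs => (hf s (interior_subset hs)).differentiableAt.differentiableWithinAt)
    (C := 1 / 2) (fun s hs => by
      rw [(hf s (interior_subset hs)).deriv]
      exact (hI s (interior_subset hs)).2.2.le)
  have hf0 : f 0 = l (tchart I p v).1 := by simp only [f, flow_zero hS]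
  have h0I : (0 : ℝ) ∈ Icc (-(T / 2)) (T / 2) := ⟨by linarith, by linarith⟩
  intro s hs
  have hsI := abs_le.1 hs
  refine ⟨(hI s hsI).1, (hI s hsI).2.1, ?_⟩
  rw [← hf0]
  change |s| / 2 ≤ |f s - f 0|
  rcases le_total 0 s with h1 | h1
  · have := hmono 0 h0I s hsI h1
    rw [abs_of_nonneg h1]
    exact le_trans (by linarith) (le_abs_self _)
  · have := hmono s hsI 0 h0I h1
    rw [abs_of_nonpos h1, abs_sub_comm]
    exact le_trans (by linarith) (le_abs_self _)

/-- The flow box parametrization in coordinates. -/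
def flowBox {F : Type*} [NormedAddCommGroup F] [NormedSpace ℝ F]
    (D : CovariantDerivative I E (TangentSpace I : M → Type _)) (v₀ : TangentBundle I M)
    (A : F →L[ℝ] E × E) (x : (ℝ × ℝ) × F) : E × E :=
  let y := tchart I v₀.1 (flow D x.1.1 ((tchart I v₀.1).symm (tchart I v₀.1 v₀ + A x.2)))
  (y.1, x.1.2 • y.2)

/-- The slice in the tangent bundle parametrized by an affine map in coordinates. -/
def affineSlice {F : Type*} [NormedAddCommGroup F] [NormedSpace ℝ F]
    (v₀ : TangentBundle I M) (A : F →L[ℝ] E × E) (b : F) : TangentBundle I M :=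
  (tchart I v₀.1).symm (tchart I v₀.1 v₀ + A b)

/-! ### The flow box and its differential -/

section FlowBox

variable {F : Type*} [NormedAddCommGroup F] [NormedSpace ℝ F] {v₀ : TangentBundle I M}
  {A : F →L[ℝ] E × E}

lemma affineSlice_zero : affineSlice v₀ A 0 = v₀ := by
  rw [affineSlice, map_zero, add_zero]
  exact (tchart I v₀.1).left_inv (mem_tchart_source.2 (mem_chart_source H v₀.1))

lemma contMDiffAt_affineSlice {b : F}
    (hb : (tchart I v₀.1 v₀ + A b).1 ∈ (extChartAt I v₀.1).target) :
    ContMDiffAt 𝓘(ℝ, F) I.tangent ∞ (affineSlice v₀ A) b := by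
  have h1 : ContDiff ℝ ∞ (fun b : F => tchart I v₀.1 v₀ + A b) :=
    contDiff_const.add A.contDiff
  exact (contMDiffAt_tchart_symm hb).comp b h1.contMDiff.contMDiffAt

lemma eventually_affineSlice :
    ∀ᶠ b in 𝓝 (0 : F), (tchart I v₀.1 v₀ + A b).1 ∈ (extChartAt I v₀.1).target := by
  have hc : ContinuousAt (fun b : F => (tchart I v₀.1 v₀ + A b).1) 0 := by fun_prop
  refine hc.eventually_mem ((isOpen_extChartAt_target v₀.1).mem_nhds ?_)
  rw [map_zero, add_zero]
  exact tchart_fst_mem_target (mem_chart_source H v₀.1)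

lemma tendsto_affineSlice : Filter.Tendsto (affineSlice v₀ A) (𝓝 0) (𝓝 v₀) := by
  have h := (contMDiffAt_affineSlice (v₀ := v₀) (A := A)
    (eventually_affineSlice (v₀ := v₀) (A := A)).self_of_nhds).continuousAt.tendsto
  rwa [affineSlice_zero] at h

lemma tchart_affineSlice {b : F}
    (hb : (tchart I v₀.1 v₀ + A b).1 ∈ (extChartAt I v₀.1).target) :
    (affineSlice v₀ A b).1 ∈ (chartAt H v₀.1).source ∧
      tchart I v₀.1 (affineSlice v₀ A b) = tchart I v₀.1 v₀ + A b :=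
  ⟨mem_tchart_source.1 ((tchart I v₀.1).map_target (mem_tchart_target.2 hb)),
    (tchart I v₀.1).right_inv (mem_tchart_target.2 hb)⟩

lemma contDiffAt_flowBox (hS : SmoothSpray D) {x : (ℝ × ℝ) × F}
    (hx : (tchart I v₀.1 v₀ + A x.2).1 ∈ (extChartAt I v₀.1).target)
    (hx1 : x.1.1 ∈ flowDomain D (affineSlice v₀ A x.2))
    (hx2 : (flow D x.1.1 (affineSlice v₀ A x.2)).1 ∈ (chartAt H v₀.1).source) :
    ContDiffAt ℝ ∞ (flowBox D v₀ A) x := by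
  have h1 : ContMDiffAt 𝓘(ℝ, (ℝ × ℝ) × F) I.tangent ∞
      (fun x : (ℝ × ℝ) × F => affineSlice v₀ A x.2) x :=
    ContMDiffAt.comp (g := affineSlice v₀ A) (f := fun x : (ℝ × ℝ) × F => x.2) x
      (contMDiffAt_affineSlice hx) contDiff_snd.contMDiff.contMDiffAt
  have h2 : ContMDiffAt 𝓘(ℝ, (ℝ × ℝ) × F) 𝓘(ℝ, ℝ) ∞ (fun x : (ℝ × ℝ) × F => x.1.1) x :=
    (contDiff_fst.fst).contMDiff.contMDiffAt
  have h3 : ContMDiffAt 𝓘(ℝ, (ℝ × ℝ) × F) I.tangent ∞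
      (fun x : (ℝ × ℝ) × F => flow D x.1.1 (affineSlice v₀ A x.2)) x :=
    ContMDiffAt.comp (g := fun z : ℝ × TangentBundle I M => flow D z.1 z.2) x
      (contMDiffAt_flow hS hx1).2 (h2.prodMk h1)
  have h4 : ContMDiffAt 𝓘(ℝ, (ℝ × ℝ) × F) 𝓘(ℝ, E × E) ∞
      (fun x : (ℝ × ℝ) × F => tchart I v₀.1 (flow D x.1.1 (affineSlice v₀ A x.2))) x :=
    (contMDiffAt_tchart hx2).comp x h3
  have h5 := h4.contDiffAt
  exact h5.fst.prodMk (contDiffAt_fst.snd.smul h5.snd)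

lemma eventually_flowBox (hS : SmoothSpray D) :
    ∀ᶠ x : (ℝ × ℝ) × F in 𝓝 ((0, 1), 0),
      (tchart I v₀.1 v₀ + A x.2).1 ∈ (extChartAt I v₀.1).target ∧
      x.1.1 ∈ flowDomain D (affineSlice v₀ A x.2) ∧
      (flow D x.1.1 (affineSlice v₀ A x.2)).1 ∈ (chartAt H v₀.1).source ∧ x.1.2 ≠ 0 := by
  have h0 := zero_mem_flowDomain hS v₀
  have hc1 : Filter.Tendsto (fun x : (ℝ × ℝ) × F => x.2) (𝓝 ((0, 1), 0)) (𝓝 0) :=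
    (continuous_snd (X := ℝ × ℝ) (Y := F)).tendsto' _ _ rfl
  have hc2 : Filter.Tendsto (fun x : (ℝ × ℝ) × F => x.1.2) (𝓝 ((0, 1), 0)) (𝓝 1) :=
    (continuous_fst.snd : Continuous fun x : (ℝ × ℝ) × F => x.1.2).tendsto' _ _ rfl
  have hc3 : Filter.Tendsto (fun x : (ℝ × ℝ) × F => x.1.1) (𝓝 ((0, 1), 0)) (𝓝 0) :=
    (continuous_fst.fst : Continuous fun x : (ℝ × ℝ) × F => x.1.1).tendsto' _ _ rfl
  have hσ := tendsto_affineSlice (v₀ := v₀) (A := A)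
  have hc4 : Filter.Tendsto (fun x : (ℝ × ℝ) × F => (x.1.1, affineSlice v₀ A x.2))
      (𝓝 ((0, 1), 0)) (𝓝 (0, v₀)) := hc3.prodMk_nhds (hσ.comp hc1)
  have hps : v₀.1 ∈ (chartAt H v₀.1).source := mem_chart_source H v₀.1
  have hc5 := (continuousAt_flow hS h0).tendsto
  rw [flow_zero hS] at hc5
  filter_upwards [hc1.eventually (eventually_affineSlice (v₀ := v₀) (A := A)),
    hc4.eventually (contMDiffAt_flow hS h0).1,
    (hc5.comp hc4).eventually_mem
      (((chartAt H v₀.1).open_source.preimage (FiberBundle.continuous_proj E _)).mem_nhds hps),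
    hc2.eventually_ne one_ne_zero] with x h1 h2 h3 h4 using ⟨h1, h2, h3, h4⟩

lemma flowBox_apply {x : (ℝ × ℝ) × F}
    (hx2 : (flow D x.1.1 (affineSlice v₀ A x.2)).1 ∈ (chartAt H v₀.1).source) :
    flowBox D v₀ A x = tchart I v₀.1 (scale x.1.2 (flow D x.1.1 (affineSlice v₀ A x.2))) :=
  (tchart_scale hx2 _).symm

/-- At time 0, factor 1 and parameter 0, the three partial derivatives are the geodesic field, the
radial vector of the fiber, and `A`. Each is read off from a curve along a line through this point.
-/
lemma fderiv_flowBox (hS : SmoothSpray D) (t c : ℝ) (b : F) :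
    fderiv ℝ (flowBox D v₀ A) ((0, 1), 0) ((t, c), b) =
      (t • (tchart I v₀.1 v₀).2 + (A b).1,
        t • (geodesicField D v₀.1 (tchart I v₀.1 v₀)).2 + c • (tchart I v₀.1 v₀).2 + (A b).2) := by
  have hg := (eventually_flowBox hS (v₀ := v₀) (A := A)).self_of_nhds
  have hd : HasFDerivAt (flowBox D v₀ A) (fderiv ℝ (flowBox D v₀ A) ((0, 1), 0)) ((0, 1), 0) :=
    ((contDiffAt_flowBox hS hg.1 hg.2.1 hg.2.2.1).differentiableAt (by simp)).hasFDerivAt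
  set L := fderiv ℝ (flowBox D v₀ A) ((0, 1), 0) with hL
  have hps : v₀.1 ∈ (chartAt H v₀.1).source := mem_chart_source H v₀.1
  have hline : ∀ x : (ℝ × ℝ) × F, HasDerivAt (fun s : ℝ => flowBox D v₀ A (((0, 1), 0) + s • x))
      (L x) 0 := by
    intro x
    have h1 : HasDerivAt (fun s : ℝ => (((0, 1), 0) : (ℝ × ℝ) × F) + s • x) x 0 := by
      simpa using ((hasDerivAt_id (0 : ℝ)).smul_const x).const_add (((0, 1), 0) : (ℝ × ℝ) × F)
    exact HasFDerivAt.comp_hasDerivAt_of_eq 0 hd h1 (by simp)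
  have e1 : L ((1, 0), 0) = ((tchart I v₀.1 v₀).2,
      (geodesicField D v₀.1 (tchart I v₀.1 v₀)).2) := by
    refine (hline _).unique ?_
    have h1 := hasDerivAt_tchart_flow hS (zero_mem_flowDomain hS v₀) (p := v₀.1)
      (by rw [flow_zero hS]; exact hps)
    rw [flow_zero hS] at h1
    refine h1.congr_of_eventuallyEq (Filter.Eventually.of_forall fun s => ?_)
    have h2 : (((0, 1), 0) : (ℝ × ℝ) × F) + s • ((1, 0), 0) = ((s, 1), 0) := by simp
    simp only [h2]
    simp only [flowBox, one_smul]
    exact congrArg (fun u => tchart I v₀.1 (flow D s u)) affineSlice_zero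
  have e2 : L ((0, 1), 0) = (0, (tchart I v₀.1 v₀).2) := by
    refine (hline _).unique ?_
    have h1 : HasDerivAt (fun s : ℝ => ((tchart I v₀.1 v₀).1, (1 + s) • (tchart I v₀.1 v₀).2))
        (0, (tchart I v₀.1 v₀).2) 0 := by
      refine (hasDerivAt_const _ _).prodMk ?_
      simpa using ((hasDerivAt_id (0 : ℝ)).const_add 1).smul_const (tchart I v₀.1 v₀).2
    refine h1.congr_of_eventuallyEq (Filter.Eventually.of_forall fun s => ?_)
    have h2 : (((0, 1), 0) : (ℝ × ℝ) × F) + s • ((0, 1), 0) = ((0, 1 + s), 0) := by simp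
    simp only [h2]
    have h3 : flow D 0 (affineSlice v₀ A 0) = v₀ := by rw [affineSlice_zero, flow_zero hS]
    exact congrArg (fun u => ((tchart I v₀.1 u).1, (1 + s) • (tchart I v₀.1 u).2)) h3
  have e3 : L ((0, 0), b) = A b := by
    refine (hline _).unique ?_
    have h1 : HasDerivAt (fun s : ℝ => tchart I v₀.1 v₀ + s • A b) (A b) 0 := by
      simpa using ((hasDerivAt_id (0 : ℝ)).smul_const (A b)).const_add (tchart I v₀.1 v₀)
    refine h1.congr_of_eventuallyEq ?_
    have hc : Filter.Tendsto (fun s : ℝ => s • b) (𝓝 0) (𝓝 0) :=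
      (continuous_id.smul continuous_const : Continuous fun s : ℝ => s • b).tendsto' _ _ (by simp)
    filter_upwards [hc.eventually (eventually_affineSlice (v₀ := v₀) (A := A))] with s hs
    have h2 : (((0, 1), 0) : (ℝ × ℝ) × F) + s • ((0, 0), b) = ((0, 1), s • b) := by simp
    rw [h2, ← map_smul, ← (tchart_affineSlice hs).2]
    simp only [flowBox, one_smul]
    exact congrArg (tchart I v₀.1) (flow_zero hS _)
  have h : (((t, c), b) : (ℝ × ℝ) × F) = t • ((1, 0), 0) + c • ((0, 1), 0) + ((0, 0), b) := by
    simp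
  rw [h, map_add, map_add, map_smul, map_smul, e1, e2, e3]
  refine Prod.ext ?_ ?_ <;> simp

end FlowBox

end GeodesicSlice

/-! ### Existence of transverse slices -/

section SliceExistence

/-- A linear parametrization of `ker l × ker l`. -/
lemma exists_parametrization_ker {E : Type*} [NormedAddCommGroup E] [NormedSpace ℝ E]
    [FiniteDimensional ℝ E] {l : E →L[ℝ] ℝ} (hl : l ≠ 0) :
    ∃ A : EuclideanSpace ℝ (Fin (2 * (Module.finrank ℝ E - 1))) →L[ℝ] E × E,
      Function.Injective A ∧ (∀ b, l (A b).1 = 0 ∧ l (A b).2 = 0) ∧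
      2 * (Module.finrank ℝ E - 1) + 2 = 2 * Module.finrank ℝ E := by
  have hl' : (l : E →ₗ[ℝ] ℝ) ≠ 0 := fun h => hl (ContinuousLinearMap.coe_injective h)
  -- Since `l ≠ 0` the dimension of `E` is at least 1, so the natural-number subtraction in the
  -- statement is a genuine one.
  have h1 := Module.Dual.finrank_ker_add_one_of_ne_zero (f := (l : E →ₗ[ℝ] ℝ)) hl'
  let K := LinearMap.ker (l : E →ₗ[ℝ] ℝ)
  have h2 : Module.finrank ℝ K + 1 = Module.finrank ℝ E := h1
  have h3 : Module.finrank ℝ (EuclideanSpace ℝ (Fin (2 * (Module.finrank ℝ E - 1))))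
      = Module.finrank ℝ (K × K) := by
    rw [finrank_euclideanSpace_fin, Module.finrank_prod]
    omega
  let e := ContinuousLinearEquiv.ofFinrankEq h3
  let B : K × K →L[ℝ] E × E := K.subtypeL.prodMap K.subtypeL
  have hB : Function.Injective B := by
    rintro ⟨a, b⟩ ⟨c, d⟩ h
    have h' : ((a : E), (b : E)) = ((c : E), (d : E)) := h
    obtain ⟨h4, h5⟩ := Prod.mk.inj h'
    exact Prod.ext (Subtype.ext h4) (Subtype.ext h5)
  refine ⟨B.comp (e : _ →L[ℝ] K × K), hB.comp e.injective, fun b => ?_, by omega⟩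
  exact ⟨(e b).1.2, (e b).2.2⟩

variable {E : Type*} [NormedAddCommGroup E] [NormedSpace ℝ E] [FiniteDimensional ℝ E]
  {H : Type*} [TopologicalSpace H] {I : ModelWithCorners ℝ E H} [I.Boundaryless]
  {M : Type*} [TopologicalSpace M] [ChartedSpace H M] [IsManifold I ∞ M] [T2Space M]
  {D : CovariantDerivative I E (TangentSpace I : M → Type _)}

lemma tchart_self (v : TangentBundle I M) : (tchart I v.1 v).2 = v.2 := by
  rw [tchart_apply (mem_chart_source H v.1)]
  exact trivCoord_self v.1 v.2

/-- The flow box is a local diffeomorphism. -/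
lemma exists_flowBox_homeomorph (hS : SmoothSpray D) {v₀ : TangentBundle I M} {l : E →L[ℝ] ℝ}
    (hl : l (tchart I v₀.1 v₀).2 = 1) {F : Type*} [NormedAddCommGroup F] [NormedSpace ℝ F]
    [FiniteDimensional ℝ F] {A : F →L[ℝ] E × E}
    (hA : Function.Injective A) (hlA : ∀ b, l (A b).1 = 0 ∧ l (A b).2 = 0)
    (hF : Module.finrank ℝ F + 2 = 2 * Module.finrank ℝ E) :
    ∃ e : OpenPartialHomeomorph ((ℝ × ℝ) × F) (E × E), ((0, 1), 0) ∈ e.source ∧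
      ⇑e = flowBox D v₀ A ∧ ContDiffOn ℝ ∞ e.symm e.target := by
  let L : (ℝ × ℝ) × F →L[ℝ] E × E := fderiv ℝ (flowBox D v₀ A) ((0, 1), 0)
  -- The slice directions lie in `ker l × ker l`, while `l` is 1 on the velocity. Applying `l` to
  -- the position component kills `t`, then to the fiber component kills `c`, and `A` is injective.
  have hL : Function.Injective L := by
    rw [injective_iff_map_eq_zero]
    rintro ⟨⟨t, c⟩, b⟩ h
    have h1 := fderiv_flowBox (v₀ := v₀) (A := A) hS t c b
    obtain ⟨h2, h3⟩ := Prod.mk.inj (h1.symm.trans h)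
    have h4 : t = 0 := by
      have := congrArg l h2
      simpa [hl, (hlA b).1] using this
    subst h4
    have h5 : c = 0 := by
      have := congrArg l h3
      simpa [hl, (hlA b).2] using this
    subst h5
    have h6 : A b = 0 := Prod.ext (by simpa using h2) (by simpa using h3)
    rw [map_eq_zero_iff A hA] at h6
    rw [h6]
    rfl
  have hdim : Module.finrank ℝ ((ℝ × ℝ) × F) = Module.finrank ℝ (E × E) := by
    simp only [Module.finrank_prod, Module.finrank_self]
    omega
  let L' : ((ℝ × ℝ) × F) ≃L[ℝ] E × E :=
    (LinearMap.linearEquivOfInjective (L : (ℝ × ℝ) × F →ₗ[ℝ] E × E) hL hdim).toContinuousLinearEquiv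
  have hd : HasFDerivAt (flowBox D v₀ A) (L' : (ℝ × ℝ) × F →L[ℝ] E × E) ((0, 1), 0) := by
    have hg := (eventually_flowBox hS (v₀ := v₀) (A := A)).self_of_nhds
    exact ((contDiffAt_flowBox hS hg.1 hg.2.1 hg.2.2.1).differentiableAt (by simp)).hasFDerivAt
  obtain ⟨e, h1, h2, -, h4⟩ := exists_openPartialHomeomorph_contDiffOn (G := flowBox D v₀ A)
    ((eventually_flowBox hS).mono fun x hg => contDiffAt_flowBox hS hg.1 hg.2.1 hg.2.2.1) hd
  exact ⟨e, h1, h2, h4⟩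

/-- If the connection is nonreturning, then a geodesic meets a small affine slice at most once. -/
lemma eventually_affineSlice_unique (hS : SmoothSpray D) (hN : Nonreturning D)
    {v₀ : TangentBundle I M} {l : E →L[ℝ] ℝ}
    (hl : l (tchart I v₀.1 v₀).2 = 1) {F : Type*} [NormedAddCommGroup F] [NormedSpace ℝ F]
    {A : F →L[ℝ] E × E}
    (hA : Function.Injective A) (hlA : ∀ b, l (A b).1 = 0 ∧ l (A b).2 = 0) :
    ∃ N ∈ 𝓝 (0 : F), ∀ b ∈ N, ∀ b' ∈ N,
      SameGeodesic D (affineSlice v₀ A b) (affineSlice v₀ A b') → b = b' := by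
  obtain ⟨T, hT, hW⟩ := exists_transverse_growth hS l hl
  have hps : v₀.1 ∈ (chartAt H v₀.1).source := mem_chart_source H v₀.1
  -- At time ±`T` the coordinate `l` has moved by at least `T / 2`, so a geodesic starting on the
  -- slice has left this set of width `T / 4`.
  have hV : {y : M | y ∈ (chartAt H v₀.1).source ∧
      |l (extChartAt I v₀.1 y) - l (tchart I v₀.1 v₀).1| < T / 4} ∈ 𝓝 v₀.1 := by
    have hc : ContinuousAt (fun y : M => |l (extChartAt I v₀.1 y) - l (tchart I v₀.1 v₀).1|) v₀.1 :=
      ((l.continuous.continuousAt.comp (continuousAt_extChartAt v₀.1)).sub continuousAt_const).abs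
    have h0 : |l (extChartAt I v₀.1 v₀.1) - l (tchart I v₀.1 v₀).1| < T / 4 := by
      rw [tchart_apply hps, sub_self, abs_zero]
      linarith
    exact Filter.Eventually.and ((chartAt H v₀.1).open_source.mem_nhds hps)
      (hc.eventually (gt_mem_nhds h0))
  obtain ⟨U, hU, hUV, hret⟩ := hN v₀.1 _ hV
  have hσ := tendsto_affineSlice (v₀ := v₀) (A := A)
  have hpr : Filter.Tendsto (fun b => (affineSlice v₀ A b).1) (𝓝 0) (𝓝 v₀.1) :=
    ((FiberBundle.continuous_proj E (TangentSpace I : M → Type _)).continuousAt.tendsto).comp hσ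
  refine ⟨_, (hσ.eventually hW).and ((hpr.eventually_mem hU).and
    (eventually_affineSlice (v₀ := v₀) (A := A))), ?_⟩
  rintro b ⟨hb1, hb2, hb3⟩ b' ⟨-, hb2', hb3'⟩ ⟨c, hc, t, ht, h⟩
  have hl1 : l (tchart I v₀.1 (affineSlice v₀ A b)).1 = l (tchart I v₀.1 v₀).1 := by
    rw [(tchart_affineSlice hb3).2]
    simp [(hlA b).1]
  have hl1' : l (tchart I v₀.1 (affineSlice v₀ A b')).1 = l (tchart I v₀.1 v₀).1 := by
    rw [(tchart_affineSlice hb3').2]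
    simp [(hlA b').1]
  have hl2 : l (tchart I v₀.1 (affineSlice v₀ A b)).2 = 1 := by
    rw [(tchart_affineSlice hb3).2]
    simpa [(hlA b).2] using hl
  have hl2' : l (tchart I v₀.1 (affineSlice v₀ A b')).2 = 1 := by
    rw [(tchart_affineSlice hb3').2]
    simpa [(hlA b').2] using hl
  -- Both ends have the same value of `l`, so growth excludes 0 < |t| ≤ T. If |t| > T, the geodesic
  -- would be outside `U` at time ±`T` and back in `U` at time `t`.
  have ht0 : t = 0 := by
    by_cases htT : |t| ≤ T
    · obtain ⟨-, h2, h3⟩ := hb1 t htT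
      have h4 : (tchart I v₀.1 (flow D t (affineSlice v₀ A b))).1
          = (tchart I v₀.1 (affineSlice v₀ A b')).1 := by
        rw [h, tchart_scale h2]
      rw [h4, hl1', hl1, sub_self, abs_zero] at h3
      exact abs_nonpos_iff.1 (by linarith)
    · exfalso
      push Not at htT
      obtain ⟨s, hs, hst⟩ : ∃ s : ℝ, |s| = T ∧ s ∈ uIcc 0 t := by
        rcases le_total 0 t with h0 | h0
        · refine ⟨T, abs_of_pos hT, ?_⟩
          rw [uIcc_of_le h0]
          rw [abs_of_nonneg h0] at htT
          exact ⟨hT.le, htT.le⟩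
        · refine ⟨-T, by rw [abs_neg, abs_of_pos hT], ?_⟩
          rw [uIcc_of_ge h0]
          rw [abs_of_nonpos h0] at htT
          exact ⟨by linarith, by linarith⟩
      obtain ⟨h1, h2, h3⟩ := hb1 s hs.le
      have hoc := hret _ _ (isMaxGeodesicOn_geodesicOf hS (affineSlice v₀ A b))
      have h0U : (0 : ℝ) ∈ flowDomain D (affineSlice v₀ A b) ∩
          geodesicOf D (affineSlice v₀ A b) ⁻¹' U := by
        refine ⟨zero_mem_flowDomain hS _, ?_⟩
        change (flow D 0 (affineSlice v₀ A b)).1 ∈ U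
        rw [flow_zero_proj hS]
        exact hb2
      have htU : t ∈ flowDomain D (affineSlice v₀ A b) ∩
          geodesicOf D (affineSlice v₀ A b) ⁻¹' U := by
        refine ⟨ht, ?_⟩
        change (flow D t (affineSlice v₀ A b)).1 ∈ U
        rw [h] at hb2'
        exact hb2'
      have hsU := (hUV (hoc.uIcc_subset h0U htU hst).2).2
      rw [hs, hl1, tchart_apply h2] at h3
      have h5 : |l (extChartAt I v₀.1 (flow D s (affineSlice v₀ A b)).1) - l (tchart I v₀.1 v₀).1|
        < T / 4 := hsU
      linarith
  subst ht0
  rw [flow_zero hS] at h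
  -- Only scaling is left, and all vectors of the slice have `l` of the fiber part equal to 1, which
  -- fixes the factor.
  have h6 := tchart_scale (tchart_affineSlice hb3).1 c
  rw [← h] at h6
  have hc1 : c = 1 := by
    have := congrArg (fun z : E × E => l z.2) h6
    simp only [hl2', map_smul, hl2, smul_eq_mul, mul_one] at this
    exact this.symm
  rw [hc1, one_smul, (tchart_affineSlice hb3).2, (tchart_affineSlice hb3').2] at h6
  exact (hA (add_left_cancel h6)).symm

/-- In the flow box, forgetting time and factor is a smooth projection onto the slice along the
geodesics. The nonreturning property, through `eventually_affineSlice_unique`, makes the slice meet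
each class only once. -/
lemma exists_transverseSlice_of_parametrization (hS : SmoothSpray D) (hN : Nonreturning D)
    (v₀ : reducedTangentBundle I M) {l : E →L[ℝ] ℝ} (hl : l (tchart I v₀.1.1 v₀.1).2 = 1)
    {F : Type*} [NormedAddCommGroup F] [NormedSpace ℝ F] [FiniteDimensional ℝ F]
    {A : F →L[ℝ] E × E}
    (hA : Function.Injective A) (hlA : ∀ b, l (A b).1 = 0 ∧ l (A b).2 = 0)
    (hF : Module.finrank ℝ F + 2 = 2 * Module.finrank ℝ E) :
    ∃ s : TransverseSlice I.tangent (toGeodesicQuotient D) F,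
      v₀ ∈ s.nbhd ∧ s.toFun (s.proj v₀) = v₀ := by
  classical
  obtain ⟨e, he, heq, hes⟩ := exists_flowBox_homeomorph hS hl hA hlA hF
  obtain ⟨N, hN, huniq⟩ := eventually_affineSlice_unique hS hN hl hA hlA
  have hσ := tendsto_affineSlice (v₀ := v₀.1) (A := A)
  have hsnd : Filter.Tendsto (fun x : (ℝ × ℝ) × F => x.2) (𝓝 ((0, 1), 0)) (𝓝 0) :=
    (continuous_snd (X := ℝ × ℝ) (Y := F)).tendsto' _ _ rfl
  have hgood := (eventually_flowBox hS (v₀ := v₀.1) (A := A)).and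
    (Filter.Eventually.and (e.open_source.mem_nhds he)
      ((hsnd.eventually_mem hN).and
        ((hσ.comp hsnd).eventually_mem ((reducedTangentBundle I M).isOpen.mem_nhds v₀.2))))
  obtain ⟨ρ, hρ, hball⟩ := Metric.eventually_nhds_iff_ball.1 hgood
  set box := Metric.ball (((0, 1), 0) : (ℝ × ℝ) × F) ρ with hbox
  have hboxsrc : box ⊆ e.source := fun x hx => (hball x hx).2.1
  have hmem : ∀ {b : F}, b ∈ Metric.ball (0 : F) ρ → (((0, 1), b) : (ℝ × ℝ) × F) ∈ box := by
    intro b hb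
    rw [hbox, ← ball_prod_same, ← ball_prod_same]
    exact ⟨⟨Metric.mem_ball_self hρ, Metric.mem_ball_self hρ⟩, hb⟩
  have hmem' : ∀ {x : (ℝ × ℝ) × F}, x ∈ box → x.2 ∈ Metric.ball (0 : F) ρ := by
    intro x hx
    rw [hbox, ← ball_prod_same] at hx
    exact hx.2
  -- The default value `v₀` occurs only outside the ball, where the slice vector might be zero.
  let σ : F → reducedTangentBundle I M := fun b =>
    if h : affineSlice v₀.1 A b ∈ reducedTangentBundle I M then ⟨_, h⟩ else v₀
  have hσ' : ∀ {b : F}, b ∈ Metric.ball (0 : F) ρ → (σ b : TangentBundle I M)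
      = affineSlice v₀.1 A b := fun {b} hb => by
    have h : affineSlice v₀.1 A b ∈ reducedTangentBundle I M := (hball _ (hmem hb)).2.2.2
    simp only [σ, dif_pos h]
  -- The vectors covered by the flow box; on them the slice parameter is the last component of its
  -- inverse.
  let W : Set (TangentBundle I M) :=
    {w | w.1 ∈ (chartAt H v₀.1.1).source} ∩ tchart I v₀.1.1 ⁻¹' (e '' box)
  have hWo : IsOpen W := (contMDiffOn_tchart v₀.1.1).continuousOn.isOpen_inter_preimage
    ((chartAt H v₀.1.1).open_source.preimage (FiberBundle.continuous_proj E _))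
    (e.isOpen_image_of_subset_source Metric.isOpen_ball hboxsrc)
  let r : TangentBundle I M → F := fun w => (e.symm (tchart I v₀.1.1 w)).2
  have hr : ∀ {w : TangentBundle I M}, w ∈ W → ∃ x ∈ box, e.symm (tchart I v₀.1.1 w) = x ∧
      w = scale x.1.2 (flow D x.1.1 (affineSlice v₀.1 A x.2)) := by
    rintro w ⟨hw, x, hx, hxw⟩
    have h1 := (hball x hx).1
    refine ⟨x, hx, by rw [← hxw, e.left_inv (hboxsrc hx)], ?_⟩
    rw [heq, flowBox_apply h1.2.2.1] at hxw
    exact (tchart_injOn v₀.1.1 (show (scale x.1.2 (flow D x.1.1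
      (affineSlice v₀.1 A x.2))).1 ∈ (chartAt H v₀.1.1).source from h1.2.2.1) hw hxw).symm
  have hσW : ∀ {b : F}, b ∈ Metric.ball (0 : F) ρ → affineSlice v₀.1 A b ∈ W ∧
      r (affineSlice v₀.1 A b) = b := by
    intro b hb
    have h1 := (hball _ (hmem hb)).1
    have h2 := tchart_affineSlice h1.1
    have h3 : tchart I v₀.1.1 (affineSlice v₀.1 A b) = e ((0, 1), b) := by
      rw [heq, flowBox_apply h1.2.2.1, flow_zero hS, scale_one]
    refine ⟨⟨h2.1, _, hmem hb, h3.symm⟩, ?_⟩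
    change (e.symm (tchart I v₀.1.1 (affineSlice v₀.1 A b))).2 = b
    rw [h3, e.left_inv (hboxsrc (hmem hb))]
  have hv₀W : v₀.1 ∈ W ∧ r v₀.1 = 0 := by
    have := hσW (Metric.mem_ball_self hρ)
    rwa [affineSlice_zero] at this
  have hrW : ∀ {w : TangentBundle I M}, w ∈ W → r w ∈ Metric.ball (0 : F) ρ := by
    intro w hw
    obtain ⟨x, hx, h1, -⟩ := hr hw
    change (e.symm _).2 ∈ _
    rw [h1]
    exact hmem' hx
  refine ⟨{
    base := Metric.ball 0 ρ
    toFun := σ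
    nbhd := Subtype.val ⁻¹' W
    proj := fun w => r w.1
    isOpen_base := Metric.isOpen_ball
    isOpen_nbhd := hWo.preimage continuous_subtype_val
    contMDiffOn_toFun := ?_
    contMDiffOn_proj := ?_
    mapsTo_toFun := fun b hb => ?_
    mapsTo_proj := fun w hw => hrW hw
    proj_toFun := fun b hb => ?_
    comp_proj := fun w hw => ?_
    injOn := fun b hb b' hb' h => ?_ }, hv₀W.1, ?_⟩
  · intro b hb
    refine ContMDiffAt.contMDiffWithinAt ?_
    rw [contMDiffAt_opens_iff]
    refine (contMDiffAt_affineSlice (hball _ (hmem hb)).1.1).congr_of_eventuallyEq ?_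
    filter_upwards [Metric.isOpen_ball.mem_nhds hb] with b' hb' using hσ' hb'
  · intro w hw
    refine ContMDiffAt.contMDiffWithinAt ?_
    have h1 : ContMDiffAt I.tangent 𝓘(ℝ, E × E) ∞
        (fun w : reducedTangentBundle I M => tchart I v₀.1.1 w.1) w :=
      (contMDiffAt_tchart hw.1).comp w contMDiff_subtype_val.contMDiffAt
    obtain ⟨x, hx, hxw⟩ := hw.2
    have h2 : tchart I v₀.1.1 w.1 ∈ e.target := by
      rw [← hxw]
      exact e.map_source (hboxsrc hx)
    have h3 : ContDiffAt ℝ ∞ (fun z => (e.symm z).2) (tchart I v₀.1.1 w.1) :=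
      (hes.contDiffAt (e.open_target.mem_nhds h2)).snd
    exact ContMDiffAt.comp (g := fun z => (e.symm z).2)
      (f := fun w : reducedTangentBundle I M => tchart I v₀.1.1 w.1) w h3.contMDiffAt h1
  · change (σ b : TangentBundle I M) ∈ W
    rw [hσ' hb]
    exact (hσW hb).1
  · rw [hσ' hb]
    exact (hσW hb).2
  · obtain ⟨x, hx, h1, h2⟩ := hr hw
    refine (toGeodesicQuotient_eq_iff hS).2 ?_
    have h3 : r w.1 = x.2 := congrArg Prod.snd h1
    change SameGeodesic D (σ (r w.1) : TangentBundle I M) w.1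
    rw [h3, hσ' (hmem' hx)]
    have h4 := (hball x hx).1
    exact ⟨x.1.2, h4.2.2.2, x.1.1, h4.2.1, h2⟩
  · have h1 := (toGeodesicQuotient_eq_iff hS).1 h
    rw [hσ' hb, hσ' hb'] at h1
    exact huniq b (hball _ (hmem hb)).2.2.1 b' (hball _ (hmem hb')).2.2.1 h1
  · refine Subtype.ext ?_
    change (σ (r v₀.1) : TangentBundle I M) = v₀.1
    rw [hv₀W.2, hσ' (Metric.mem_ball_self hρ), affineSlice_zero]

/-- Any functional normalized on the nonzero velocity will do. Of the 2 dim M dimensions of TM, flow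
and scaling remove two. -/
lemma exists_transverseSlice (hS : SmoothSpray D) (hN : Nonreturning D)
    (v₀ : reducedTangentBundle I M) :
    ∃ s : TransverseSlice I.tangent (toGeodesicQuotient D)
      (EuclideanSpace ℝ (Fin (2 * (Module.finrank ℝ E - 1)))),
      v₀ ∈ s.nbhd ∧ s.toFun (s.proj v₀) = v₀ := by
  have hne : (tchart I v₀.1.1 v₀.1).2 ≠ 0 := by rw [tchart_self]; exact v₀.2
  obtain ⟨l, hl⟩ := SeparatingDual.exists_eq_one (R := ℝ) hne
  have hl0 : l ≠ 0 := by
    rintro rfl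
    simp at hl
  obtain ⟨A, hA, hlA, hdim⟩ := exists_parametrization_ker hl0
  exact exists_transverseSlice_of_parametrization hS hN v₀ hl hA hlA
    (by rw [finrank_euclideanSpace_fin]; exact hdim)

/-- The smooth structure on the space of geodesics of a nonreturning connection. -/
theorem exists_manifold_structure (hS : SmoothSpray D) (hN : Nonreturning D) :
    ∃ (d : ℕ) (_ : ChartedSpace (EuclideanSpace ℝ (Fin d)) (GeodesicQuotient D)),
      IsManifold (𝓡 d) ∞ (GeodesicQuotient D) ∧
      ContMDiff I.tangent (𝓡 d) ∞ (toGeodesicQuotient D) ∧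
      ∀ v : reducedTangentBundle I M,
        Function.Surjective (mfderiv I.tangent (𝓡 d) (toGeodesicQuotient D) v) :=
  ⟨_, exists_quotient_manifold (isOpenQuotientMap_toGeodesicQuotient hS)
    (fun _ _ h => exists_holonomy hS h) (exists_transverseSlice hS hN)⟩

end SliceExistence

/-! ### Pseudoconvexity implies the Hausdorff property -/

section Hausdorff

variable {E : Type*} [NormedAddCommGroup E] [NormedSpace ℝ E] [FiniteDimensional ℝ E]
  {H : Type*} [TopologicalSpace H] {I : ModelWithCorners ℝ E H} [I.Boundaryless]
  {M : Type*} [TopologicalSpace M] [ChartedSpace H M] [IsManifold I ∞ M] [T2Space M]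
  {D : CovariantDerivative I E (TangentSpace I : M → Type _)}

lemma eq_zero_of_tchart_snd_eq_zero {p : M} {v : TangentBundle I M}
    (hv : v.1 ∈ (chartAt H p).source) (h : (tchart I p v).2 = 0) : v.2 = 0 := by
  have h1 : tchart I p v = tchart I p (scale 0 v) := by
    rw [tchart_scale hv, zero_smul]
    exact Prod.ext rfl h
  have h2 := tchart_injOn p hv (show (scale 0 v).1 ∈ (chartAt H p).source from hv) h1
  rw [h2]
  exact zero_smul ℝ v.2

/-- If a geodesic of a nonreturning connection accumulates at a point, then it converges. -/
lemma tendsto_flow_of_ultrafilter (hS : SmoothSpray D) (hN : Nonreturning D)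
    {v : TangentBundle I M} {l : Ultrafilter (flowDomain D v)}
    (hl : (l : Filter (flowDomain D v)) ≤ Filter.atTop) {p : M}
    (hp : Filter.Tendsto (fun s : flowDomain D v => (flow D s v).1) l (𝓝 p)) :
    Filter.Tendsto (fun s : flowDomain D v => (flow D s v).1) Filter.atTop (𝓝 p) := by
  intro V hV
  obtain ⟨U, hU, hUV, hret⟩ := hN p V hV
  have hoc := hret _ _ (isMaxGeodesicOn_geodesicOf hS v)
  have hUl : ∀ᶠ s : flowDomain D v in (l : Filter (flowDomain D v)), (flow D s v).1 ∈ U := hp hU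
  obtain ⟨s₁, hs₁⟩ := hUl.exists
  rw [Filter.mem_map]
  filter_upwards [Filter.eventually_ge_atTop s₁] with t ht
  -- Accumulation brings the geodesic into `U` at some `s₂ ≥ t`; it was in `U` at `s₁ ≤ t`, so it
  -- cannot be outside at time `t`.
  obtain ⟨s₂, hs₂, hts⟩ := (hUl.and (hl (Filter.eventually_ge_atTop t))).exists
  exact hUV (hoc.out ⟨s₁.2, hs₁⟩ ⟨s₂.2, hs₂⟩ ⟨ht, hts⟩).2

/-- A geodesic which is not constant cannot converge. -/
lemma not_tendsto_flow (hS : SmoothSpray D) {v : TangentBundle I M} (hv : v.2 ≠ 0) {p : M}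
    (hp : Filter.Tendsto (fun s : flowDomain D v => (flow D s v).1) Filter.atTop (𝓝 p)) :
    False := by
  have : Nonempty (flowDomain D v) := ⟨⟨0, zero_mem_flowDomain hS v⟩⟩
  let l : Ultrafilter (flowDomain D v) := Ultrafilter.of Filter.atTop
  have hl : (l : Filter (flowDomain D v)) ≤ Filter.atTop := Ultrafilter.of_le _
  have hsrc : ∀ᶠ s : flowDomain D v in Filter.atTop, (flow D s v).1 ∈ (chartAt H p).source :=
    hp ((chartAt H p).open_source.mem_nhds (mem_chart_source H p))
  -- The velocities may shrink or blow up towards the end of the domain, so they are normalized in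
  -- the chart at `p`; compactness of the sphere gives a limit direction.
  let w : flowDomain D v → E := fun s => (tchart I p (flow D s v)).2
  have hw : ∀ᶠ s : flowDomain D v in Filter.atTop, w s ≠ 0 := by
    filter_upwards [hsrc] with s hs h
    exact flow_snd_ne_zero hS hv s.2 (eq_zero_of_tchart_snd_eq_zero hs h)
  obtain ⟨u, hu, hlu⟩ := (isCompact_sphere (0 : E) 1).ultrafilter_le_nhds
    (l.map fun s => ‖w s‖⁻¹ • w s) (by
      rw [Ultrafilter.coe_map, Filter.le_principal_iff, Filter.mem_map]
      filter_upwards [hl hw] with s hs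
      rw [mem_preimage, mem_sphere_zero_iff_norm, norm_smul, norm_inv, norm_norm,
        inv_mul_cancel₀ (norm_ne_zero_iff.2 hs)])
  have hu0 : u ≠ 0 := by
    rintro rfl
    simp at hu
  have htgt : extChartAt I p p ∈ (extChartAt I p).target := mem_extChartAt_target p
  obtain ⟨v₀, hv₀, hc₀, hd⟩ : ∃ v₀ : TangentBundle I M, v₀.1 = p ∧ (tchart I p v₀).2 = u ∧
      Filter.Tendsto (fun s : flowDomain D v => scale ‖w s‖⁻¹ (flow D s v)) l (𝓝 v₀) := by
    have hz : (extChartAt I p p, u) ∈ (tchart I p).target := mem_tchart_target.2 htgt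
    refine ⟨(tchart I p).symm (extChartAt I p p, u), ?_, ?_, ?_⟩
    · rw [tchart_symm_fst htgt]
      exact extChartAt_to_inv p
    · rw [(tchart I p).right_inv hz]
    · have h1 : Filter.Tendsto (fun s : flowDomain D v =>
          (extChartAt I p (flow D s v).1, ‖w s‖⁻¹ • w s)) l (𝓝 (extChartAt I p p, u)) :=
        ((continuousAt_extChartAt p).tendsto.comp (hp.mono_left hl)).prodMk_nhds hlu
      have h2 := (contMDiffAt_tchart_symm (I := I) (z := (extChartAt I p p, u))
        htgt).continuousAt.tendsto.comp h1
      refine h2.congr' ?_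
      filter_upwards [hl hsrc] with s hs
      have h3 := tchart_scale hs ‖w s‖⁻¹
      have h4 : (tchart I p (flow D s v)).1 = extChartAt I p (flow D s v).1 := by
        rw [tchart_apply hs]
      rw [h4] at h3
      change (tchart I p).symm (extChartAt I p (flow D s v).1, ‖w s‖⁻¹ • w s) = _
      rw [← h3]
      exact (tchart I p).left_inv (mem_tchart_source.2 hs)
  subst hv₀
  obtain ⟨k, hk⟩ := SeparatingDual.exists_eq_one (R := ℝ) hu0
  rw [← hc₀] at hk
  obtain ⟨T, hT, hgrow⟩ := exists_transverse_growth hS k hk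
  -- Any two late points differ by less than `T / 2` in the coordinate `k`, whereas near the limit
  -- direction a geodesic moves by at least `T / 2` in time `T`.
  have hclose : ∀ᶠ s : flowDomain D v in Filter.atTop,
      |k (extChartAt I v₀.1 (flow D s v).1) - k (extChartAt I v₀.1 v₀.1)| < T / 4 := by
    have h1 : Filter.Tendsto (fun s : flowDomain D v =>
        |k (extChartAt I v₀.1 (flow D s v).1) - k (extChartAt I v₀.1 v₀.1)|) Filter.atTop
        (𝓝 |k (extChartAt I v₀.1 v₀.1) - k (extChartAt I v₀.1 v₀.1)|) :=
      (((k.continuous.continuousAt.comp (continuousAt_extChartAt v₀.1)).tendsto.comp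
        hp).sub_const _).abs
    rw [sub_self, abs_zero] at h1
    exact h1.eventually (gt_mem_nhds (by linarith))
  obtain ⟨s₀, hs₀⟩ := Filter.eventually_atTop.1 (hclose.and (hsrc.and hw))
  obtain ⟨s, hs, hss⟩ := ((hd.eventually hgrow).and (hl (Filter.eventually_ge_atTop s₀))).exists
  obtain ⟨h1, h2, h3⟩ := hs T (abs_of_pos hT).le
  obtain ⟨h4, h5, h6⟩ := hs₀ s hss
  -- Time `T` for the normalized vector is the additional time `‖w s‖⁻¹ * T` for the original one.
  -- The factor is positive, so the later point also lies beyond `s₀`.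
  have hc : 0 < ‖w s‖⁻¹ := inv_pos.2 (norm_pos_iff.2 h6)
  have h7 := ((flow_scale hS hc.ne' _).1 _).1 h1
  have h8 := ((flow_add hS s.2).1 _).1 h7
  rw [(flow_scale hS hc.ne' _).2 _ h7, (flow_add hS s.2).2 _ h8] at h2 h3
  have h9 : s₀ ≤ ⟨‖w s‖⁻¹ * T + s, h8⟩ := by
    refine hss.trans ?_
    change (s : ℝ) ≤ ‖w s‖⁻¹ * T + s
    have := mul_pos hc hT
    linarith
  obtain ⟨h10, h11, -⟩ := hs₀ _ h9
  have h12 : (tchart I v₀.1 (scale ‖w s‖⁻¹ (flow D (‖w s‖⁻¹ * T + s) v))).1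
      = extChartAt I v₀.1 (flow D (‖w s‖⁻¹ * T + s) v).1 := by
    rw [tchart_scale h11, tchart_apply h11]
  have h13 : (tchart I v₀.1 (scale ‖w s‖⁻¹ (flow D s v))).1
      = extChartAt I v₀.1 (flow D s v).1 := by
    rw [tchart_scale h5, tchart_apply h5]
  rw [h12, h13, abs_of_pos hT] at h3
  have h10' : |k (extChartAt I v₀.1 (flow D (‖w s‖⁻¹ * T + s) v).1)
    - k (extChartAt I v₀.1 v₀.1)| < T / 4 := h10
  have h14 := abs_sub_lt_iff.1 h4
  have h15 := abs_sub_lt_iff.1 h10'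
  have h16 : |k (extChartAt I v₀.1 (flow D (‖w s‖⁻¹ * T + s) v).1)
      - k (extChartAt I v₀.1 (flow D s v).1)| < T / 2 := abs_sub_lt_iff.2 ⟨by linarith, by linarith⟩
  linarith

/-- No nonconstant geodesic of a nonreturning connection is imprisoned in a compact set. -/
lemma exists_flow_notMem (hS : SmoothSpray D) (hN : Nonreturning D)
    {v : TangentBundle I M} (hv : v.2 ≠ 0) {K : Set M} (hK : IsCompact K) :
    ∃ t ∈ flowDomain D v, 0 ≤ t ∧ (flow D t v).1 ∉ K := by
  by_contra! h
  have : Nonempty (flowDomain D v) := ⟨⟨0, zero_mem_flowDomain hS v⟩⟩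
  let l : Ultrafilter (flowDomain D v) := Ultrafilter.of Filter.atTop
  have hl : (l : Filter (flowDomain D v)) ≤ Filter.atTop := Ultrafilter.of_le _
  obtain ⟨p, -, hp⟩ := hK.ultrafilter_le_nhds (l.map fun s : flowDomain D v => (flow D s v).1) (by
    rw [Ultrafilter.coe_map, Filter.le_principal_iff, Filter.mem_map]
    filter_upwards [hl (Filter.eventually_ge_atTop ⟨0, zero_mem_flowDomain hS v⟩)] with s hs
    exact h s s.2 hs)
  exact not_tendsto_flow hS hv (tendsto_flow_of_ultrafilter hS hN hl hp)

/-- Scaling by -1 reverses time. -/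
lemma exists_flow_notMem_neg (hS : SmoothSpray D) (hN : Nonreturning D)
    {v : TangentBundle I M} (hv : v.2 ≠ 0) {K : Set M} (hK : IsCompact K) :
    ∃ t ∈ flowDomain D v, t ≤ 0 ∧ (flow D t v).1 ∉ K := by
  have h1 : (scale (-1) v).2 ≠ 0 := smul_ne_zero (by norm_num) hv
  obtain ⟨t, ht, h0, h⟩ := exists_flow_notMem hS hN h1 hK
  have h2 := ((flow_scale hS (by norm_num : (-1 : ℝ) ≠ 0) v).1 t).1 ht
  rw [(flow_scale hS (by norm_num : (-1 : ℝ) ≠ 0) v).2 t h2] at h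
  exact ⟨_, h2, by linarith, h⟩

/-- Limits of proportional vectors are proportional. -/
lemma exists_scale_of_tendsto {ι : Type*} {l : Filter ι} [l.NeBot] {y w : ι → TangentBundle I M}
    {c : ι → ℝ} {y₀ w₀ : TangentBundle I M} (hy : Filter.Tendsto y l (𝓝 y₀))
    (hw : Filter.Tendsto w l (𝓝 w₀)) (h : ∀ᶠ i in l, w i = scale (c i) (y i))
    (hy₀ : y₀.2 ≠ 0) (hw₀ : w₀.2 ≠ 0) : ∃ c₀ : ℝ, c₀ ≠ 0 ∧ w₀ = scale c₀ y₀ := by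
  have hpc := FiberBundle.continuous_proj E (TangentSpace I : M → Type _)
  have hp : w₀.1 = y₀.1 := by
    refine tendsto_nhds_unique ((hpc.continuousAt.tendsto.comp hw).congr' ?_)
      (hpc.continuousAt.tendsto.comp hy)
    filter_upwards [h] with i hi
    change (w i).1 = (y i).1
    rw [hi]
    rfl
  have hys : y₀.1 ∈ (chartAt H y₀.1).source := mem_chart_source H _
  have hws : w₀.1 ∈ (chartAt H y₀.1).source := hp ▸ hys
  have hyne : (tchart I y₀.1 y₀).2 ≠ 0 := fun h0 => hy₀ (eq_zero_of_tchart_snd_eq_zero hys h0)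
  have hwne : (tchart I y₀.1 w₀).2 ≠ 0 := fun h0 => hw₀ (eq_zero_of_tchart_snd_eq_zero hws h0)
  obtain ⟨k, hk⟩ := SeparatingDual.exists_eq_one (R := ℝ) hyne
  have hyt : Filter.Tendsto (fun i => (tchart I y₀.1 (y i)).2) l (𝓝 (tchart I y₀.1 y₀).2) :=
    (continuous_snd.continuousAt.comp (contMDiffAt_tchart hys).continuousAt).tendsto.comp hy
  have hwt : Filter.Tendsto (fun i => (tchart I y₀.1 (w i)).2) l (𝓝 (tchart I y₀.1 w₀).2) :=
    (continuous_snd.continuousAt.comp (contMDiffAt_tchart hws).continuousAt).tendsto.comp hw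
  have hsrc : ∀ᶠ i in l, (y i).1 ∈ (chartAt H y₀.1).source :=
    (hpc.continuousAt.tendsto.comp hy).eventually_mem ((chartAt H y₀.1).open_source.mem_nhds hys)
  -- Cross-multiplying eliminates the factors `c i`, about whose convergence nothing is assumed.
  have h1 : ∀ᶠ i in l, k (tchart I y₀.1 (y i)).2 • (tchart I y₀.1 (w i)).2
      = k (tchart I y₀.1 (w i)).2 • (tchart I y₀.1 (y i)).2 := by
    filter_upwards [h, hsrc] with i hi hs
    rw [hi, tchart_scale hs]
    simp only [map_smul, smul_eq_mul, smul_smul]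
    rw [mul_comm]
  have h2 := tendsto_nhds_unique
    ((((k.continuous.tendsto _).comp hyt).smul hwt).congr' h1)
    (((k.continuous.tendsto _).comp hwt).smul hyt)
  rw [hk, one_smul] at h2
  refine ⟨k (tchart I y₀.1 w₀).2, fun h0 => hwne (by rw [h2, h0, zero_smul]),
    tchart_injOn y₀.1 hws (show (scale _ y₀).1 ∈ _ from hys) ?_⟩
  rw [tchart_scale hys]
  refine Prod.ext ?_ h2
  rw [tchart_apply hws, tchart_apply hys, hp]

/-- The space of geodesics of a nonreturning pseudoconvex connection is Hausdorff. -/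
theorem t2Space_of_pseudoconvex (hS : SmoothSpray D) (hN : Nonreturning D)
    (hP : Pseudoconvex D) : T2Space (GeodesicQuotient D) := by
  have : LocallyCompactSpace M := Manifold.locallyCompact_of_finiteDimensional I
  -- For an open quotient map, separation amounts to closedness of the relation in the product.
  rw [t2Space_iff_of_isOpenQuotientMap (isOpenQuotientMap_toGeodesicQuotient hS),
    isClosed_iff_ultrafilter]
  rintro ⟨v, w⟩ l hl hmem
  have hR : ∀ᶠ z : reducedTangentBundle I M × reducedTangentBundle I M in (l : Filter _),
      SameGeodesic D z.1.1 z.2.1 := by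
    filter_upwards [hmem] with z hz using (toGeodesicQuotient_eq_iff hS).1 hz
  refine (toGeodesicQuotient_eq_iff hS).2 ?_
  obtain ⟨K₁, hK₁, hv₁⟩ := exists_compact_mem_nhds v.1.1
  obtain ⟨K₂, hK₂, hv₂⟩ := exists_compact_mem_nhds w.1.1
  obtain ⟨K', hK', hseg⟩ := hP (K₁ ∪ K₂) (hK₁.union hK₂)
  -- The limit geodesic leaves `K'` both before and after time 0. By continuity of the flow, nearby
  -- geodesics are outside `K'` at the same two times.
  obtain ⟨a, ha, ha0, haK⟩ := exists_flow_notMem_neg hS hN v.2 hK'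
  obtain ⟨b, hb, hb0, hbK⟩ := exists_flow_notMem hS hN v.2 hK'
  have hlv : Filter.Tendsto (fun z : reducedTangentBundle I M × reducedTangentBundle I M =>
      z.1.1) l (𝓝 v.1) :=
    ((continuous_subtype_val.comp continuous_fst).tendsto (v, w)).mono_left hl
  have hlw : Filter.Tendsto (fun z : reducedTangentBundle I M × reducedTangentBundle I M =>
      z.2.1) l (𝓝 w.1) :=
    ((continuous_subtype_val.comp continuous_snd).tendsto (v, w)).mono_left hl
  have hpc := FiberBundle.continuous_proj E (TangentSpace I : M → Type _)
  have hout : ∀ {s : ℝ}, s ∈ flowDomain D v.1 → (flow D s v.1).1 ∉ K' →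
      ∀ᶠ u : TangentBundle I M in 𝓝 v.1, s ∈ flowDomain D u ∧ (flow D s u).1 ∉ K' := by
    intro s hs hsK
    have h1 : ContinuousAt (fun u : TangentBundle I M => (s, u)) v.1 := by fun_prop
    have h2 := hpc.continuousAt.comp (ContinuousAt.comp (f := fun u : TangentBundle I M => (s, u))
      (continuousAt_flow hS hs) h1)
    exact (eventually_mem_flowDomain hS hs).and
      (h2.eventually_mem (hK'.isClosed.isOpen_compl.mem_nhds hsK))
  choose! c hc t ht hw using fun (z : reducedTangentBundle I M × reducedTangentBundle I M)
    (hz : SameGeodesic D z.1.1 z.2.1) => hz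
  -- A connecting time outside `[a, b]` would give a segment with both ends in `K₁ ∪ K₂` that passes
  -- through a point outside `K'`.
  have htab : ∀ᶠ z in (l : Filter _), t z ∈ Icc a b := by
    filter_upwards [hR, hlv.eventually (hout ha haK), hlv.eventually (hout hb hbK),
      (hpc.continuousAt.tendsto.comp hlv).eventually_mem hv₁,
      (hpc.continuousAt.tendsto.comp hlw).eventually_mem hv₂] with z hz h1 h2 h3 h4
    have hg := (isGeodesicOn_geodesicOf hS z.1.1).1
    have h0 : geodesicOf D z.1.1 0 ∈ K₁ ∪ K₂ := by
      refine Or.inl ?_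
      rw [geodesicOf, flow_zero hS]
      exact h3
    have h0t : geodesicOf D z.1.1 (t z) ∈ K₁ ∪ K₂ := by
      refine Or.inr ?_
      have h5 : z.2.1.1 ∈ K₂ := h4
      rw [hw z hz] at h5
      exact h5
    constructor
    · by_contra! hlt
      exact h1.2 (hseg _ _ hg (t z) (ht z hz) 0 (zero_mem_flowDomain hS _) (by linarith) h0t h0 a
        ⟨hlt.le, ha0⟩)
    · by_contra! hlt
      exact h2.2 (hseg _ _ hg 0 (zero_mem_flowDomain hS _) (t z) (ht z hz) (by linarith) h0 h0t b
        ⟨hb0, hlt.le⟩)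
  -- The limit time lies in `[a, b]`, hence in the domain of the limit geodesic, and continuity of
  -- the flow applies there.
  obtain ⟨τ, hτ, hlτ⟩ := isCompact_Icc.ultrafilter_le_nhds (l.map t) (by
    rw [Ultrafilter.coe_map, Filter.le_principal_iff, Filter.mem_map]
    exact htab)
  have hτd : τ ∈ flowDomain D v.1 := (ordConnected_flowDomain v.1).out ha hb hτ
  have hpair : Filter.Tendsto (fun z => (t z, z.1.1)) l (𝓝 (τ, v.1)) :=
    Filter.Tendsto.prodMk_nhds hlτ hlv
  have hflow := (continuousAt_flow hS hτd).tendsto.comp hpair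
  obtain ⟨c₀, hc₀, h⟩ := exists_scale_of_tendsto (c := c) hflow hlw (by
    filter_upwards [hR] with z hz using hw z hz) (flow_snd_ne_zero hS v.2 hτd) w.2
  exact ⟨c₀, hc₀, τ, hτd, h⟩

end Hausdorff

/-! ### The Hausdorff property implies pseudoconvexity -/

section Pseudoconvexity

variable {E : Type*} [NormedAddCommGroup E] [NormedSpace ℝ E] [FiniteDimensional ℝ E]
  {H : Type*} [TopologicalSpace H] {I : ModelWithCorners ℝ E H} [I.Boundaryless]
  {M : Type*} [TopologicalSpace M] [ChartedSpace H M] [IsManifold I ∞ M] [T2Space M]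
  {D : CovariantDerivative I E (TangentSpace I : M → Type _)}

variable (D) in
/-- All geodesic segments whose initial and final tangent vectors are proportional to a pair of
vectors in `S` lie in `K`. -/
def SegmentsIn (S : Set (TangentBundle I M × TangentBundle I M)) (K : Set M) : Prop :=
  ∀ z ∈ S, ∀ t ∈ flowDomain D z.1, ∀ c : ℝ, c ≠ 0 → z.2 = scale c (flow D t z.1) →
    ∀ s ∈ uIcc 0 t, (flow D s z.1).1 ∈ K

/-- If `v` and `w` lie on one geodesic, nearby segments follow a compact arc and then stay near its
end, since they cannot return after leaving. Otherwise the Hausdorff property separates the two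
geodesics, and no segment joins vectors close to `v` and `w`. -/
lemma exists_segmentsIn_nhds (hS : SmoothSpray D) (hN : Nonreturning D)
    [T2Space (GeodesicQuotient D)] {v w : TangentBundle I M} (hv : v.2 ≠ 0) (hw : w.2 ≠ 0) :
    ∃ S ∈ 𝓝 (v, w), ∃ K : Set M, IsCompact K ∧ SegmentsIn D S K := by
  have : LocallyCompactSpace M := Manifold.locallyCompact_of_finiteDimensional I
  have hpc := FiberBundle.continuous_proj E (TangentSpace I : M → Type _)
  by_cases h : SameGeodesic D v w
  · obtain ⟨c, hc, τ, hτ, h⟩ := h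
    obtain ⟨V, hV, hVw⟩ := exists_compact_mem_nhds w.1
    obtain ⟨U, hU, hUV, hret⟩ := hN w.1 V hVw
    have hdom : ∀ s ∈ uIcc 0 τ, s ∈ flowDomain D v := fun s hs =>
      (ordConnected_flowDomain v).uIcc_subset (zero_mem_flowDomain hS v) hτ hs
    obtain ⟨K₀, hK₀, hK₀s⟩ := exists_compact_superset
      ((isCompact_uIcc (a := (0 : ℝ)) (b := τ)).image_of_continuousOn
        (f := geodesicOf D v) fun s hs =>
        ((isGeodesicOn_geodesicOf hS v).1.contMDiffAt (hdom s hs)).continuousAt.continuousWithinAt)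
    have hflow : ∀ {s : ℝ}, s ∈ flowDomain D v → Filter.Tendsto
        (fun z : TangentBundle I M × ℝ => (flow D z.2 z.1).1) (𝓝 (v, s)) (𝓝 (flow D s v).1) := by
      intro s hs
      have h1 : Filter.Tendsto (fun z : TangentBundle I M × ℝ => (z.2, z.1)) (𝓝 (v, s))
        (𝓝 (s, v)) := continuous_swap.tendsto (v, s)
      exact (hpc.continuousAt.tendsto.comp (continuousAt_flow hS hs).tendsto).comp h1
    have htube : ∀ᶠ u in 𝓝 v, ∀ s ∈ uIcc 0 τ, (flow D s u).1 ∈ K₀ := by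
      refine isCompact_uIcc.eventually_forall_of_forall_eventually fun s hs => ?_
      have h1 : (flow D s v).1 ∈ interior K₀ := hK₀s ⟨s, hs, rfl⟩
      exact ((hflow (hdom s hs)).eventually_mem (isOpen_interior.mem_nhds h1)).mono
        fun z hz => interior_subset hz
    have hend : ∀ᶠ u in 𝓝 v, τ ∈ flowDomain D u ∧ (flow D τ u).1 ∈ U := by
      have h1 : Filter.Tendsto (fun u : TangentBundle I M => (u, τ)) (𝓝 v) (𝓝 (v, τ)) :=
        (Continuous.prodMk_left τ).tendsto v
      have h2 : U ∈ 𝓝 (flow D τ v).1 := by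
        rw [h] at hU
        exact hU
      exact (eventually_mem_flowDomain hS hτ).and (((hflow hτ).comp h1).eventually_mem h2)
    refine ⟨_, prod_mem_nhds (htube.and hend) (hpc.continuousAt.preimage_mem_nhds hU),
      K₀ ∪ V, hK₀.union hV, ?_⟩
    rintro ⟨u, u'⟩ ⟨⟨h1, h2, h3⟩, h4⟩ t ht c' hc' he s hs
    -- Up to time `τ` the segment stays in `K₀` by continuity of the flow. Between `τ` and `t` both
    -- ends are in `U`, so the nonreturning property keeps it in `U`.
    rcases uIcc_subset_uIcc_union_uIcc (b := τ) hs with hs | hs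
    · exact Or.inl (h1 s hs)
    · refine Or.inr (hUV ?_)
      have h5 : (flow D t u).1 ∈ U := by
        have h6 : u'.1 ∈ U := h4
        have h7 : u' = scale c' (flow D t u) := he
        rw [h7] at h6
        exact h6
      exact ((hret _ _ (isMaxGeodesicOn_geodesicOf hS u)).uIcc_subset ⟨h2, h3⟩ ⟨ht, h5⟩ hs).2
  · have hq := isOpenQuotientMap_toGeodesicQuotient hS
    have hne : toGeodesicQuotient D ⟨v, hv⟩ ≠ toGeodesicQuotient D ⟨w, hw⟩ := fun h' =>
      h ((toGeodesicQuotient_eq_iff hS).1 h')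
    obtain ⟨A, B, hA, hB, hvA, hwB, hAB⟩ := t2_separation hne
    have hmap := (reducedTangentBundle I M).isOpen.isOpenMap_subtype_val
    refine ⟨_, prod_mem_nhds
      ((hmap _ (hA.preimage hq.continuous)).mem_nhds ⟨⟨v, hv⟩, hvA, rfl⟩)
      ((hmap _ (hB.preimage hq.continuous)).mem_nhds ⟨⟨w, hw⟩, hwB, rfl⟩), ∅, isCompact_empty, ?_⟩
    rintro ⟨_, _⟩ ⟨⟨u, hu, rfl⟩, ⟨u', hu', rfl⟩⟩ t ht c hc he
    have h1 := (toGeodesicQuotient_eq_iff hS).2 ⟨c, hc, t, ht, he⟩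
    exact absurd hu' (disjoint_left.1 hAB (h1 ▸ hu))

/-- Finitely many of the neighborhoods from `exists_segmentsIn_nhds` suffice. -/
lemma exists_segmentsIn_of_isCompact (hS : SmoothSpray D) (hN : Nonreturning D)
    [T2Space (GeodesicQuotient D)] {S : Set (TangentBundle I M × TangentBundle I M)}
    (hSc : IsCompact S) (hne : ∀ z ∈ S, z.1.2 ≠ 0 ∧ z.2.2 ≠ 0) :
    ∃ K : Set M, IsCompact K ∧ SegmentsIn D S K := by
  refine hSc.induction_on (p := fun S => ∃ K : Set M, IsCompact K ∧ SegmentsIn D S K)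
    ⟨∅, isCompact_empty, fun z hz => hz.elim⟩ ?_ ?_ ?_
  · rintro S S' hSS ⟨K, hK, h⟩
    exact ⟨K, hK, fun z hz => h z (hSS hz)⟩
  · rintro S S' ⟨K, hK, h⟩ ⟨K', hK', h'⟩
    refine ⟨K ∪ K', hK.union hK', ?_⟩
    rintro z (hz | hz) t ht c hc he s hs
    · exact Or.inl (h z hz t ht c hc he s hs)
    · exact Or.inr (h' z hz t ht c hc he s hs)
  · intro z hz
    obtain ⟨S', hS', h⟩ := exists_segmentsIn_nhds hS hN (hne z hz).1 (hne z hz).2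
    exact ⟨S', mem_nhdsWithin_of_mem_nhds hS', h⟩

variable (I) in
/-- A compact set of nonzero tangent vectors which represents all directions over a compact set. -/
lemma exists_compact_directions {K : Set M} (hK : IsCompact K) :
    ∃ C : Set (TangentBundle I M), IsCompact C ∧ (∀ u ∈ C, u.2 ≠ 0) ∧
      ∀ u : TangentBundle I M, u.1 ∈ K → u.2 ≠ 0 → ∃ c : ℝ, c ≠ 0 ∧ scale c u ∈ C := by
  have : LocallyCompactSpace M := Manifold.locallyCompact_of_finiteDimensional I
  refine hK.induction_on (p := fun K => ∃ C : Set (TangentBundle I M), IsCompact C ∧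
      (∀ u ∈ C, u.2 ≠ 0) ∧
      ∀ u : TangentBundle I M, u.1 ∈ K → u.2 ≠ 0 → ∃ c : ℝ, c ≠ 0 ∧ scale c u ∈ C)
    ⟨∅, isCompact_empty, fun u hu => hu.elim, fun u hu => hu.elim⟩ ?_ ?_ ?_
  · rintro K K' hKK ⟨C, h1, h2, h3⟩
    exact ⟨C, h1, h2, fun u hu => h3 u (hKK hu)⟩
  · rintro K K' ⟨C, h1, h2, h3⟩ ⟨C', h1', h2', h3'⟩
    refine ⟨C ∪ C', h1.union h1', fun u hu => hu.elim (h2 u) (h2' u), ?_⟩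
    rintro u (hu | hu) hne
    · obtain ⟨c, hc, h⟩ := h3 u hu hne
      exact ⟨c, hc, Or.inl h⟩
    · obtain ⟨c, hc, h⟩ := h3' u hu hne
      exact ⟨c, hc, Or.inr h⟩
  · intro p _
    obtain ⟨B, hB, hBs, hBc⟩ := local_compact_nhds
      ((chartAt H p).open_source.mem_nhds (mem_chart_source H p))
    have hsub : extChartAt I p '' B ⊆ (extChartAt I p).target := by
      rintro _ ⟨y, hy, rfl⟩
      refine (extChartAt I p).map_source ?_
      rw [extChartAt_source]
      exact hBs hy
    -- Over a compact piece of a chart, the vectors with unit coordinate norm form a compact set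
    -- meeting every tangent line.
    have hcomp : IsCompact (extChartAt I p '' B) := hBc.image_of_continuousOn
      ((continuousOn_extChartAt p).mono fun y hy => by rw [extChartAt_source]; exact hBs hy)
    refine ⟨B, mem_nhdsWithin_of_mem_nhds hB,
      (tchart I p).symm '' ((extChartAt I p '' B) ×ˢ Metric.sphere (0 : E) 1),
      (hcomp.prod (isCompact_sphere 0 1)).image_of_continuousOn
        ((contMDiffOn_tchart_symm p).continuousOn.mono (prod_mono hsub (subset_univ _))), ?_, ?_⟩
    · rintro _ ⟨z, ⟨hz1, hz2⟩, rfl⟩ h0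
      have hz := mem_tchart_target.2 (hsub hz1)
      have hs := mem_tchart_source.1 ((tchart I p).map_target hz)
      have h1 : tchart I p ((tchart I p).symm z) = tchart I p (scale 0 ((tchart I p).symm z)) := by
        congr 1
        exact TotalSpace.ext rfl (heq_of_eq (h0.trans (zero_smul ℝ _).symm))
      rw [tchart_scale hs, (tchart I p).right_inv hz, zero_smul] at h1
      rw [h1] at hz2
      simp at hz2
    · intro u hu hne
      have hs : u.1 ∈ (chartAt H p).source := hBs hu
      have hw : (tchart I p u).2 ≠ 0 := fun h => hne (eq_zero_of_tchart_snd_eq_zero hs h)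
      refine ⟨‖(tchart I p u).2‖⁻¹, inv_ne_zero (norm_ne_zero_iff.2 hw), _, ⟨?_, ?_⟩,
        (tchart I p).left_inv (mem_tchart_source.2
          (show (scale ‖(tchart I p u).2‖⁻¹ u).1 ∈ (chartAt H p).source from hs))⟩
      · rw [tchart_scale hs, tchart_apply hs]
        exact ⟨u.1, hu, rfl⟩
      · rw [tchart_scale hs, mem_sphere_zero_iff_norm, norm_smul, norm_inv, norm_norm,
          inv_mul_cancel₀ (norm_ne_zero_iff.2 hw)]

lemma IsGeodesicOn.flow_lift (hS : SmoothSpray D) {γ : ℝ → M} {J : Set ℝ}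
    (h : IsGeodesicOn D γ J) {a t : ℝ} (ha : a ∈ J) (ht : t ∈ J) :
    t - a ∈ flowDomain D (lift I γ a) ∧ flow D (t - a) (lift I γ a) = lift I γ t := by
  obtain ⟨h1, h2⟩ := h.comp_add a
  have h0 : (0 : ℝ) + a ∈ J := by rwa [zero_add]
  have ht' : t - a + a ∈ J := by rwa [sub_add_cancel]
  have h3 := flow_eq_lift hS h1 (t := t - a) (v := lift I γ a) h0
    (by rw [h2 0 h0, zero_add]) ht'
  rwa [h2 _ ht', sub_add_cancel] at h3

/-- A nonreturning connection with Hausdorff space of geodesics is pseudoconvex. -/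
theorem pseudoconvex_of_t2Space (hS : SmoothSpray D) (hN : Nonreturning D)
    [T2Space (GeodesicQuotient D)] : Pseudoconvex D := by
  intro K hK
  obtain ⟨C, hC, hne, hdir⟩ := exists_compact_directions I hK
  obtain ⟨K', hK', hseg⟩ := exists_segmentsIn_of_isCompact hS hN (hC.prod hC)
    fun z hz => ⟨hne _ hz.1, hne _ hz.2⟩
  -- `K` itself takes care of the constant geodesics, which have no direction.
  refine ⟨K ∪ K', hK.union hK', fun γ J hγ a ha b hb hab haK hbK t ht => ?_⟩
  have htJ : t ∈ J := hγ.ordConnected.out ha hb ht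
  obtain ⟨h1, h2⟩ := hγ.flow_lift hS ha htJ
  obtain ⟨h3, h4⟩ := hγ.flow_lift hS ha hb
  by_cases h0 : (lift I γ a).2 = 0
  · left
    rw [(flow_zero_vector hS h0 _).2] at h2
    have : γ a = γ t := congrArg TotalSpace.proj h2
    rwa [← this]
  · right
    have hb0 : (lift I γ b).2 ≠ 0 := by
      rw [← h4]
      exact flow_snd_ne_zero hS h0 h3
    -- Normalizing the initial vector by `c` divides times by `c`. The sign of `c` may reverse them,
    -- which is why `SegmentsIn` uses unordered intervals.
    obtain ⟨c, hc, hcC⟩ := hdir (lift I γ a) haK h0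
    obtain ⟨d, hd, hdC⟩ := hdir (lift I γ b) hbK hb0
    have hmul : ∀ s : ℝ, c * (s / c) = s := fun s => by field_simp
    have h5 : c * ((b - a) / c) ∈ flowDomain D (lift I γ a) := by rwa [hmul]
    have h6 : c * ((t - a) / c) ∈ flowDomain D (lift I γ a) := by rwa [hmul]
    have h7 := hseg (scale c (lift I γ a), scale d (lift I γ b)) ⟨hcC, hdC⟩ ((b - a) / c)
      (((flow_scale hS hc _).1 _).2 h5) (d / c) (div_ne_zero hd hc) (by
        rw [(flow_scale hS hc _).2 _ h5, hmul, h4, scale_scale, div_mul_cancel₀ d hc])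
      ((t - a) / c) (by
        have h8 := mem_image_of_mem (fun s : ℝ => s / c) (show t - a ∈ uIcc 0 (b - a) by
          rw [uIcc_of_le (by linarith)]
          exact ⟨by linarith [ht.1], by linarith [ht.2]⟩)
        rw [image_div_const_uIcc, zero_div] at h8
        exact h8)
    rw [(flow_scale hS hc _).2 _ h6, hmul, h2] at h7
    exact h7

end Pseudoconvexity

/-! ### Global topology of the space of geodesics -/

/-- A connected paracompact locally compact Hausdorff space is σ-compact. -/
lemma sigmaCompactSpace_of_paracompact (X : Type*) [TopologicalSpace X] [T2Space X]
    [LocallyCompactSpace X] [ParacompactSpace X] [PreconnectedSpace X] : SigmaCompactSpace X := by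
  rcases isEmpty_or_nonempty X with hX | ⟨⟨x₀⟩⟩
  · infer_instance
  choose B hB hxB using fun x : X => exists_compact_mem_nhds x
  obtain ⟨V, hVo, hVc, hVl, hVB⟩ := precise_refinement (fun x => interior (B x))
    (fun _ => isOpen_interior) (iUnion_eq_univ_iff.2 fun x => ⟨x, mem_interior_iff_mem_nhds.2 (hxB x)⟩)
  have hcl : ∀ x, IsCompact (closure (V x)) := fun x =>
    (hB x).closure_of_subset ((hVB x).trans interior_subset)
  -- By local finiteness only finitely many members of the cover meet a compact set, so adjoining
  -- their compact closures preserves compactness.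
  let next : Set X → Set X := fun K => ⋃ x ∈ {x | (V x ∩ K).Nonempty}, closure (V x)
  have hnext : ∀ K, IsCompact K → IsCompact (next K) := fun K hK =>
    (hVl.finite_nonempty_inter_compact hK).isCompact_biUnion fun x _ => hcl x
  let K : ℕ → Set X := fun n => next^[n] {x₀}
  have hK : ∀ n, IsCompact (K n) := by
    intro n
    induction n with
    | zero => exact isCompact_singleton
    | succ n ih =>
      change IsCompact (next^[n + 1] {x₀})
      rw [Function.iterate_succ_apply']
      exact hnext _ ih
  have hstep : ∀ {n : ℕ} {i : X}, (V i ∩ K n).Nonempty → V i ⊆ ⋃ n, K n := by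
    intro n i h y hy
    refine mem_iUnion.2 ⟨n + 1, ?_⟩
    change y ∈ next^[n + 1] {x₀}
    rw [Function.iterate_succ_apply']
    exact mem_biUnion (x := i) h (subset_closure hy)
  -- A member of the cover that meets some stage is contained in the next one. This gives both
  -- openness and closedness of the union.
  have hclopen : IsClopen (⋃ n, K n) := by
    constructor
    · refine isClosed_of_closure_subset fun x hx => ?_
      obtain ⟨i, hi⟩ := mem_iUnion.1 (hVc ▸ mem_univ x : x ∈ ⋃ i, V i)
      obtain ⟨y, hy, hyK⟩ := mem_closure_iff.1 hx _ (hVo i) hi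
      obtain ⟨n, hn⟩ := mem_iUnion.1 hyK
      exact hstep ⟨y, hy, hn⟩ hi
    · refine isOpen_iff_mem_nhds.2 fun x hx => ?_
      obtain ⟨i, hi⟩ := mem_iUnion.1 (hVc ▸ mem_univ x : x ∈ ⋃ i, V i)
      obtain ⟨n, hn⟩ := mem_iUnion.1 hx
      exact Filter.mem_of_superset ((hVo i).mem_nhds hi) (hstep ⟨x, hi, hn⟩)
  have huniv := hclopen.eq_univ ⟨x₀, mem_iUnion.2 ⟨0, mem_singleton x₀⟩⟩
  exact SigmaCompactSpace.of_countable (range K) (countable_range K) (forall_mem_range.2 hK)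
    (by rw [sUnion_range, huniv])

section Global

variable {E : Type*} [NormedAddCommGroup E] [NormedSpace ℝ E] [FiniteDimensional ℝ E]
  {H : Type*} [TopologicalSpace H] {I : ModelWithCorners ℝ E H} [I.Boundaryless]
  {M : Type*} [TopologicalSpace M] [ChartedSpace H M] [IsManifold I ∞ M] [T2Space M]
  {D : CovariantDerivative I E (TangentSpace I : M → Type _)}

variable (I M) in
-- Countably many charts cover `M`, and the tangent bundle charts above them have second countable
-- models.
lemma secondCountableTopology_tangentBundle [SigmaCompactSpace M] :
    SecondCountableTopology (TangentBundle I M) := by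
  have := I.secondCountableTopology
  have : SecondCountableTopology (ModelProd H E) :=
    inferInstanceAs (SecondCountableTopology (H × E))
  obtain ⟨s, hsc, hsU⟩ := countable_cover_nhds_of_sigmaCompact
    fun x : M => chart_source_mem_nhds H x
  refine ChartedSpace.secondCountable_of_countable_cover (ModelProd H E)
    (s := (fun p : M => (⟨p, 0⟩ : TangentBundle I M)) '' s) ?_ (hsc.image _)
  refine eq_univ_of_forall fun v => ?_
  obtain ⟨p, hp, hv⟩ := mem_iUnion₂.1 (hsU ▸ mem_univ v.1 : v.1 ∈ ⋃ x ∈ s, (chartAt H x).source)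
  exact mem_biUnion (mem_image_of_mem _ hp) ((TangentBundle.mem_chart_source_iff _ _).2 hv)

lemma toGeodesicQuotient_scale (hS : SmoothSpray D) {v : reducedTangentBundle I M} {c : ℝ}
    (hc : c ≠ 0) (h : scale c v.1 ∈ reducedTangentBundle I M) :
    toGeodesicQuotient D ⟨scale c v.1, h⟩ = toGeodesicQuotient D v :=
  ((toGeodesicQuotient_eq_iff hS).2 ⟨c, hc, 0, zero_mem_flowDomain hS _, by
    rw [flow_zero hS]⟩).symm

/-- All geodesics through a given point belong to the same clopen sets. -/
lemma mem_clopen_of_proj_eq (hS : SmoothSpray D) {A : Set (GeodesicQuotient D)} (hA : IsClopen A)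
    {v w : reducedTangentBundle I M} (hvw : v.1.1 = w.1.1) (hv : toGeodesicQuotient D v ∈ A) :
    toGeodesicQuotient D w ∈ A := by
  obtain ⟨⟨p, v⟩, hv0⟩ := v
  obtain ⟨⟨p', w⟩, hw0⟩ := w
  obtain rfl : p = p' := hvw
  have hv0 : v ≠ 0 := hv0
  have hw0 : w ≠ 0 := hw0
  let f : {e : TangentSpace I p // e ≠ 0} → GeodesicQuotient D := fun e =>
    toGeodesicQuotient D ⟨⟨p, e.1⟩, e.2⟩
  have hf : Continuous f := by
    refine (isQuotientMap_toGeodesicQuotient D).continuous.comp (Continuous.subtype_mk ?_ _)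
    exact (FiberBundle.continuous_totalSpaceMk E (TangentSpace I : M → Type _) p).comp
      continuous_subtype_val
  -- A segment of nonzero vectors in one tangent space gives a connected family of geodesics.
  have hseg : ∀ {u : TangentSpace I p} (hu : u ≠ 0),
      (∀ t ∈ Icc (0 : ℝ) 1, (1 - t) • v + t • u ≠ 0) → f ⟨u, hu⟩ ∈ A := by
    intro u hu h
    let g : Icc (0 : ℝ) 1 → {e : TangentSpace I p // e ≠ 0} := fun t =>
      ⟨(1 - (t : ℝ)) • v + (t : ℝ) • u, h t t.2⟩
    have hg : Continuous g := by
      refine Continuous.subtype_mk ?_ _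
      exact ((continuous_const.sub continuous_subtype_val).smul continuous_const).add
        (continuous_subtype_val.smul continuous_const)
    have hpre : IsPreconnected (range (f ∘ g)) := isPreconnected_range (hf.comp hg)
    have h0 : f (g 0) ∈ A := by
      have : g 0 = ⟨v, hv0⟩ := Subtype.ext (by simp [g])
      rw [this]
      exact hv
    have h1 : g 1 = ⟨u, hu⟩ := Subtype.ext (by simp [g])
    rw [← h1]
    exact hpre.subset_isClopen hA ⟨_, mem_range_self 0, h0⟩ (mem_range_self 1)
  by_cases h : ∀ t ∈ Icc (0 : ℝ) 1, (1 - t) • v + t • w ≠ 0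
  · exact hseg hw0 h
  · push Not at h
    obtain ⟨t, ht, h⟩ := h
    -- If the segment from `v` to `w` hits 0, the one from `v` to `-w` does not, and `-w` spans the
    -- same line as `w`. This covers dimension one, where the nonzero vectors are disconnected.
    have hneg := hseg (neg_ne_zero.2 hw0) fun s hs h' => by
      have ht0 : t ≠ 0 := by
        rintro rfl
        simp at h
        exact hv0 h
      have hs0 : s ≠ 0 := by
        rintro rfl
        simp at h'
        exact hv0 h'
      have h1 : (s * (1 - t) + t * (1 - s)) • v = 0 := by
        have h2 : (s * (1 - t) + t * (1 - s)) • v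
            = s • ((1 - t) • v + t • w) + t • ((1 - s) • v + s • -w) := by module
        rw [h2, h, h', smul_zero, smul_zero, add_zero]
      rcases smul_eq_zero.1 h1 with h3 | h3
      · have hs1 : 0 < s := lt_of_le_of_ne hs.1 hs0.symm
        have ht1 : 0 < t := lt_of_le_of_ne ht.1 ht0.symm
        have h4 : 0 ≤ s * (1 - t) := mul_nonneg hs1.le (by linarith [ht.2])
        have h5 : 0 ≤ t * (1 - s) := mul_nonneg ht1.le (by linarith [hs.2])
        have h6 : 1 - t = 0 := by
          rcases mul_eq_zero.1 (by linarith : s * (1 - t) = 0) with h | h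
          · exact absurd h hs0
          · exact h
        rw [h6, zero_smul, zero_add] at h
        rcases smul_eq_zero.1 h with h | h
        · exact ht0 h
        · exact hw0 h
      · exact hv0 h3
    have h1 : scale (-1) (⟨p, w⟩ : TangentBundle I M) = ⟨p, -w⟩ :=
      congrArg (TotalSpace.mk p) (neg_one_smul ℝ w)
    have h2 := toGeodesicQuotient_scale hS (v := ⟨⟨p, w⟩, hw0⟩) (c := -1) (by norm_num)
      (smul_ne_zero (by norm_num) hw0)
    rw [← h2]
    have h3 : (⟨scale (-1) (⟨p, w⟩ : TangentBundle I M), smul_ne_zero (by norm_num) hw0⟩ :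
      reducedTangentBundle I M) = ⟨⟨p, -w⟩, neg_ne_zero.2 hw0⟩ := Subtype.ext h1
    exact (congrArg (toGeodesicQuotient D) h3) ▸ hneg

/-- A clopen set and its complement project to open sets covering `M`. If both were nonempty, they
would overlap, contrary to `mem_clopen_of_proj_eq`. -/
lemma preconnectedSpace_geodesicQuotient (hS : SmoothSpray D) [PreconnectedSpace M] :
    PreconnectedSpace (GeodesicQuotient D) := by
  rw [preconnectedSpace_iff_clopen]
  intro A hA
  have hq := isOpenQuotientMap_toGeodesicQuotient hS
  let P : Set (GeodesicQuotient D) → Set M := fun B =>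
    (fun v : reducedTangentBundle I M => v.1.1) '' (toGeodesicQuotient D ⁻¹' B)
  have hP : ∀ {B}, IsOpen B → IsOpen (P B) := fun {B} hB =>
    ((FiberBundle.isOpenMap_proj E (TangentSpace I : M → Type _)).comp
      (reducedTangentBundle I M).isOpen.isOpenMap_subtype_val) _ (hB.preimage hq.continuous)
  by_contra! hne
  obtain ⟨x, hx⟩ := hne.1
  obtain ⟨y, hy⟩ := (ne_univ_iff_exists_notMem _).1 hne.2
  obtain ⟨v, rfl⟩ := hq.surjective x
  obtain ⟨w, rfl⟩ := hq.surjective y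
  have hE : ∃ e : E, e ≠ 0 := ⟨v.1.2, v.2⟩
  obtain ⟨e, he⟩ := hE
  -- A single nonzero `e` in the model space gives a geodesic through every point. It exists because
  -- `G(M)` is nonempty here; in dimension 0 there is nothing to prove.
  have hcover : (univ : Set M) ⊆ P A ∪ P Aᶜ := fun p _ => by
    let u : reducedTangentBundle I M := ⟨⟨p, (e : TangentSpace I p)⟩, he⟩
    by_cases hu : toGeodesicQuotient D u ∈ A
    · exact Or.inl ⟨u, hu, rfl⟩
    · exact Or.inr ⟨u, hu, rfl⟩
  obtain ⟨p, -, ⟨u, hu, hup⟩, u', hu', hup'⟩ := isPreconnected_univ (α := M) (P A) (P Aᶜ)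
    (hP hA.isOpen) (hP hA.compl.isOpen) hcover ⟨_, trivial, v, hx, rfl⟩ ⟨_, trivial, w, hy, rfl⟩
  exact hu' (mem_clopen_of_proj_eq hS hA (hup.trans hup'.symm) hu)

/-- For a nonreturning connection, a Hausdorff space of geodesics is a manifold. -/
theorem geodesicQuotientIsManifold_of_t2Space (hS : SmoothSpray D) (hN : Nonreturning D)
    [SigmaCompactSpace M] [PreconnectedSpace M] [hT : T2Space (GeodesicQuotient D)] :
    GeodesicQuotientIsManifold D := by
  have hq := isOpenQuotientMap_toGeodesicQuotient hS
  obtain ⟨d, hc, h⟩ := exists_manifold_structure hS hN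
  have := secondCountableTopology_tangentBundle I M
  have : SecondCountableTopology (reducedTangentBundle I M) :=
    TopologicalSpace.Subtype.secondCountableTopology
      ((reducedTangentBundle I M : Set (TangentBundle I M)))
  have : SecondCountableTopology (GeodesicQuotient D) :=
    hq.isQuotientMap.secondCountableTopology hq.isOpenMap
  -- Second countable, locally compact and Hausdorff spaces are paracompact.
  have : LocallyCompactSpace (GeodesicQuotient D) :=
    ChartedSpace.locallyCompactSpace (EuclideanSpace ℝ (Fin d)) (GeodesicQuotient D)
  exact ⟨hT, inferInstance, preconnectedSpace_geodesicQuotient hS, d, hc, h⟩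

/-- Characterizations of the manifolds among the spaces of geodesics of nonreturning
connections. -/
theorem nonreturning_tfae (hS : SmoothSpray D) (hN : Nonreturning D)
    [SigmaCompactSpace M] [PreconnectedSpace M] :
    (T2Space (GeodesicQuotient D) ↔ GeodesicQuotientIsManifold D) ∧
      (T2Space (GeodesicQuotient D) ↔ Pseudoconvex D) :=
  ⟨⟨fun _ => geodesicQuotientIsManifold_of_t2Space hS hN, fun h => h.1⟩,
    fun _ => pseudoconvex_of_t2Space hS hN, t2Space_of_pseudoconvex hS hN⟩

end Global

/-! ### Geodesics of a product -/

section ProductGeodesics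

variable {E₁ : Type*} [NormedAddCommGroup E₁] [NormedSpace ℝ E₁] [FiniteDimensional ℝ E₁]
  {H₁ : Type*} [TopologicalSpace H₁] {I₁ : ModelWithCorners ℝ E₁ H₁} [I₁.Boundaryless]
  {M₁ : Type*} [TopologicalSpace M₁] [ChartedSpace H₁ M₁] [IsManifold I₁ ∞ M₁]
  {E₂ : Type*} [NormedAddCommGroup E₂] [NormedSpace ℝ E₂] [FiniteDimensional ℝ E₂]
  {H₂ : Type*} [TopologicalSpace H₂] {I₂ : ModelWithCorners ℝ E₂ H₂} [I₂.Boundaryless]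
  {M₂ : Type*} [TopologicalSpace M₂] [ChartedSpace H₂ M₂] [IsManifold I₂ ∞ M₂]
  {D₁ : CovariantDerivative I₁ E₁ (TangentSpace I₁ : M₁ → Type _)}
  {D₂ : CovariantDerivative I₂ E₂ (TangentSpace I₂ : M₂ → Type _)}

lemma mem_chartAt_prod_source {p y : M₁ × M₂} (h₁ : y.1 ∈ (chartAt H₁ p.1).source)
    (h₂ : y.2 ∈ (chartAt H₂ p.2).source) :
    y ∈ (chartAt (ModelProd H₁ H₂) p).source := by
  rw [prodChartedSpace_chartAt]
  exact ⟨h₁, h₂⟩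

lemma trivCoord_prod {p y : M₁ × M₂} (h₁ : y.1 ∈ (chartAt H₁ p.1).source)
    (h₂ : y.2 ∈ (chartAt H₂ p.2).source) (u : E₁ × E₂) :
    (trivCoord (I₁.prod I₂) p y : E₁ × E₂ →L[ℝ] E₁ × E₂) u
      = ((trivCoord I₁ p.1 y.1 : E₁ →L[ℝ] E₁) u.1, (trivCoord I₂ p.2 y.2 : E₂ →L[ℝ] E₂) u.2) := by
  have h : ⇑(extChartAt (I₁.prod I₂) p) = Prod.map (extChartAt I₁ p.1) (extChartAt I₂ p.2) := by
    rw [extChartAt_prod]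
    rfl
  have h1 : MDifferentiableAt I₁ 𝓘(ℝ, E₁) (extChartAt I₁ p.1) y.1 := mdifferentiableAt_extChartAt h₁
  have h2 : MDifferentiableAt I₂ 𝓘(ℝ, E₂) (extChartAt I₂ p.2) y.2 := mdifferentiableAt_extChartAt h₂
  rw [trivCoord_eq_mfderiv (mem_chartAt_prod_source h₁ h₂), trivCoord_eq_mfderiv h₁,
    trivCoord_eq_mfderiv h₂, h]
  have h3 := mfderiv_prodMap (p := y) h1 h2
  rw [← modelWithCornersSelf_prod, chartedSpaceSelf_prod] at h3
  exact congrArg (fun A : E₁ × E₂ →L[ℝ] E₁ × E₂ => A u) h3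

lemma frameField_prod {p y : M₁ × M₂} (h₁ : y.1 ∈ (chartAt H₁ p.1).source)
    (h₂ : y.2 ∈ (chartAt H₂ p.2).source) (c : E₁ × E₂) :
    (frameField (I₁.prod I₂) p c y : E₁ × E₂)
      = ((frameField I₁ p.1 c.1 y.1 : E₁), (frameField I₂ p.2 c.2 y.2 : E₂)) := by
  let a : E₁ := frameField I₁ p.1 c.1 y.1
  let b : E₂ := frameField I₂ p.2 c.2 y.2
  have h1 : (trivCoord (I₁.prod I₂) p y : E₁ × E₂ →L[ℝ] E₁ × E₂) (a, b) = c :=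
    (trivCoord_prod h₁ h₂ (a, b)).trans
      (Prod.ext (trivCoord_frameField h₁ c.1) (trivCoord_frameField h₂ c.2))
  have h2 : (frameField (I₁.prod I₂) p
      ((trivCoord (I₁.prod I₂) p y : E₁ × E₂ →L[ℝ] E₁ × E₂) (a, b)) y : E₁ × E₂) = (a, b) :=
    frameField_trivCoord (mem_chartAt_prod_source h₁ h₂) _
  exact (congrArg (fun e => (frameField (I₁.prod I₂) p e y : E₁ × E₂)) h1).symm.trans h2

/-- In a product chart, each component of a constant-coefficient field depends on its own factor
only, so the mixed derivatives in `prodCovFun` vanish. -/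
lemma prodConnection_frameField {p y : M₁ × M₂} (h₁ : y.1 ∈ (chartAt H₁ p.1).source)
    (h₂ : y.2 ∈ (chartAt H₂ p.2).source) (c u : E₁ × E₂) :
    (prodConnection D₁ D₂ (frameField (I₁.prod I₂) p c) y : E₁ × E₂ →L[ℝ] E₁ × E₂) u
      = ((D₁ (frameField I₁ p.1 c.1) y.1 : E₁ →L[ℝ] E₁) u.1,
        (D₂ (frameField I₂ p.2 c.2) y.2 : E₂ →L[ℝ] E₂) u.2) := by
  have n1 := (chartAt H₁ p.1).open_source.mem_nhds h₁
  have n2 := (chartAt H₂ p.2).open_source.mem_nhds h₂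
  have hd := mdifferentiableAt_frameField (I := I₁.prod I₂) (mem_chartAt_prod_source h₁ h₂) c
  let P : E₁ →L[ℝ] E₁ := D₁ (frameField I₁ p.1 c.1) y.1
  let Q : E₂ →L[ℝ] E₂ := D₂ (frameField I₂ p.2 c.2) y.2
  let P' : E₁ →L[ℝ] E₁ := D₁ (sliceFst (frameField (I₁.prod I₂) p c) y.2) y.1
  let Q' : E₂ →L[ℝ] E₂ := D₂ (sliceSnd (frameField (I₁.prod I₂) p c) y.1) y.2
  let R : E₂ →L[ℝ] E₁ := mvfderiv I₂ (vertFst (frameField (I₁.prod I₂) p c) y.1) y.2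
  let S : E₁ →L[ℝ] E₂ := mvfderiv I₁ (vertSnd (frameField (I₁.prod I₂) p c) y.2) y.1
  have e1 : P' = P := by
    refine D₁.isCovariantDerivativeOnUniv.congr_of_eventuallyEq (mdifferentiableAt_sliceFst hd)
      (mdifferentiableAt_frameField h₁ c.1) Filter.univ_mem ?_
    filter_upwards [n1] with z hz
    exact congrArg Prod.fst (frameField_prod (y := (z, y.2)) hz h₂ c)
  have e2 : Q' = Q := by
    refine D₂.isCovariantDerivativeOnUniv.congr_of_eventuallyEq (mdifferentiableAt_sliceSnd hd)
      (mdifferentiableAt_frameField h₂ c.2) Filter.univ_mem ?_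
    filter_upwards [n2] with z hz
    exact congrArg Prod.snd (frameField_prod (y := (y.1, z)) h₁ hz c)
  have e3 : R = 0 := by
    have h : vertFst (frameField (I₁.prod I₂) p c) y.1
        =ᶠ[𝓝 y.2] fun _ => (frameField I₁ p.1 c.1 y.1 : E₁) := by
      filter_upwards [n2] with z hz
      exact congrArg Prod.fst (frameField_prod (y := (y.1, z)) h₁ hz c)
    exact h.mfderiv_eq.trans mfderiv_const
  have e4 : S = 0 := by
    have h : vertSnd (frameField (I₁.prod I₂) p c) y.2
        =ᶠ[𝓝 y.1] fun _ => (frameField I₂ p.2 c.2 y.2 : E₂) := by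
      filter_upwards [n1] with z hz
      exact congrArg Prod.snd (frameField_prod (y := (z, y.2)) hz h₂ c)
    exact h.mfderiv_eq.trans mfderiv_const
  change ((P'.coprod R).prod (S.coprod Q')) u = (P u.1, Q u.2)
  rw [e1, e2, e3, e4]
  exact Prod.ext (add_zero (P u.1)) (zero_add (Q u.2))

/-- The geodesic equation decouples in product charts, since both the connection on
constant-coefficient fields and the coordinates split. -/
lemma spray_prod {p : M₁ × M₂} {z : E₁ × E₂} (h₁ : z.1 ∈ (extChartAt I₁ p.1).target)
    (h₂ : z.2 ∈ (extChartAt I₂ p.2).target) (w : E₁ × E₂) :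
    spray (prodConnection D₁ D₂) p z w = (spray D₁ p.1 z.1 w.1, spray D₂ p.2 z.2 w.2) := by
  have hy : (extChartAt (I₁.prod I₂) p).symm z
      = ((extChartAt I₁ p.1).symm z.1, (extChartAt I₂ p.2).symm z.2) := by
    rw [extChartAt_prod]
    rfl
  have s₁ : (extChartAt I₁ p.1).symm z.1 ∈ (chartAt H₁ p.1).source := by
    rw [← extChartAt_source I₁]
    exact (extChartAt I₁ p.1).map_target h₁
  have s₂ : (extChartAt I₂ p.2).symm z.2 ∈ (chartAt H₂ p.2).source := by
    rw [← extChartAt_source I₂]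
    exact (extChartAt I₂ p.2).map_target h₂
  have key : ∀ y : M₁ × M₂, y.1 ∈ (chartAt H₁ p.1).source → y.2 ∈ (chartAt H₂ p.2).source →
      trivCoord (I₁.prod I₂) p y (prodConnection D₁ D₂ (frameField (I₁.prod I₂) p w) y
        (frameField (I₁.prod I₂) p w y))
      = (trivCoord I₁ p.1 y.1 (D₁ (frameField I₁ p.1 w.1) y.1 (frameField I₁ p.1 w.1 y.1)),
        trivCoord I₂ p.2 y.2 (D₂ (frameField I₂ p.2 w.2) y.2 (frameField I₂ p.2 w.2 y.2))) := by
    intro y hy₁ hy₂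
    let f : E₁ × E₂ := frameField (I₁.prod I₂) p w y
    let a : E₁ := frameField I₁ p.1 w.1 y.1
    let b : E₂ := frameField I₂ p.2 w.2 y.2
    have e2 : f = (a, b) := frameField_prod hy₁ hy₂ w
    let A : E₁ × E₂ →L[ℝ] E₁ × E₂ := prodConnection D₁ D₂ (frameField (I₁.prod I₂) p w) y
    let B₁ : E₁ →L[ℝ] E₁ := D₁ (frameField I₁ p.1 w.1) y.1
    let B₂ : E₂ →L[ℝ] E₂ := D₂ (frameField I₂ p.2 w.2) y.2
    have e1 : A f = (B₁ a, B₂ b) := by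
      rw [e2]
      exact prodConnection_frameField hy₁ hy₂ w (a, b)
    let τ : E₁ × E₂ →L[ℝ] E₁ × E₂ := trivCoord (I₁.prod I₂) p y
    change τ (A f) = _
    rw [e1]
    exact trivCoord_prod hy₁ hy₂ (B₁ a, B₂ b)
  simp only [spray]
  rw [hy]
  exact key _ s₁ s₂

end ProductGeodesics

/-! ### Geodesics, nonreturning property and pseudoconvexity of products -/

section ProductConvexity

variable {E₁ : Type*} [NormedAddCommGroup E₁] [NormedSpace ℝ E₁] [FiniteDimensional ℝ E₁]
  {H₁ : Type*} [TopologicalSpace H₁] {I₁ : ModelWithCorners ℝ E₁ H₁} [I₁.Boundaryless]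
  {M₁ : Type*} [TopologicalSpace M₁] [ChartedSpace H₁ M₁] [IsManifold I₁ ∞ M₁]
  {E₂ : Type*} [NormedAddCommGroup E₂] [NormedSpace ℝ E₂] [FiniteDimensional ℝ E₂]
  {H₂ : Type*} [TopologicalSpace H₂] {I₂ : ModelWithCorners ℝ E₂ H₂} [I₂.Boundaryless]
  {M₂ : Type*} [TopologicalSpace M₂] [ChartedSpace H₂ M₂] [IsManifold I₂ ∞ M₂]
  {D₁ : CovariantDerivative I₁ E₁ (TangentSpace I₁ : M₁ → Type _)}
  {D₂ : CovariantDerivative I₂ E₂ (TangentSpace I₂ : M₂ → Type _)}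

/-- Everything about geodesics uses the smoothness of a connection only through its spray, so for
the product connection this suffices. -/
lemma SmoothSpray.prod (h₁ : SmoothSpray D₁) (h₂ : SmoothSpray D₂) :
    SmoothSpray (prodConnection D₁ D₂) := by
  intro p
  have ht : (extChartAt (I₁.prod I₂) p).target
      = (extChartAt I₁ p.1).target ×ˢ (extChartAt I₂ p.2).target := by
    rw [extChartAt_prod]
    rfl
  rw [ht]
  have e₁ : ContDiffOn ℝ ∞ (fun z : (E₁ × E₂) × E₁ × E₂ => spray D₁ p.1 z.1.1 z.2.1)
      (((extChartAt I₁ p.1).target ×ˢ (extChartAt I₂ p.2).target) ×ˢ univ) :=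
    (h₁ p.1).comp (f := fun z : (E₁ × E₂) × E₁ × E₂ => (z.1.1, z.2.1))
      (contDiff_fst.fst.prodMk contDiff_snd.fst).contDiffOn fun z hz => ⟨hz.1.1, trivial⟩
  have e₂ : ContDiffOn ℝ ∞ (fun z : (E₁ × E₂) × E₁ × E₂ => spray D₂ p.2 z.1.2 z.2.2)
      (((extChartAt I₁ p.1).target ×ˢ (extChartAt I₂ p.2).target) ×ˢ univ) :=
    (h₂ p.2).comp (f := fun z : (E₁ × E₂) × E₁ × E₂ => (z.1.2, z.2.2))
      (contDiff_fst.snd.prodMk contDiff_snd.snd).contDiffOn fun z hz => ⟨hz.1.2, trivial⟩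
  exact (e₁.prodMk e₂).congr fun z hz => spray_prod hz.1.1 hz.1.2 z.2

/-- The geodesics of a product are the pairs of geodesics. -/
lemma isGeodesicOn_prod_iff {γ : ℝ → M₁ × M₂} {J : Set ℝ} :
    IsGeodesicOn (prodConnection D₁ D₂) γ J ↔
      IsGeodesicOn D₁ (fun t => (γ t).1) J ∧ IsGeodesicOn D₂ (fun t => (γ t).2) J := by
  have key : IsOpen J → ContMDiffOn 𝓘(ℝ, ℝ) I₁ 2 (fun t => (γ t).1) J →
      ContMDiffOn 𝓘(ℝ, ℝ) I₂ 2 (fun t => (γ t).2) J → ∀ t ∈ J,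
      (covDerivAlong (prodConnection D₁ D₂) γ (velocity (I₁.prod I₂) γ) t = 0 ↔
        covDerivAlong D₁ (fun t => (γ t).1) (velocity I₁ fun t => (γ t).1) t = 0 ∧
        covDerivAlong D₂ (fun t => (γ t).2) (velocity I₂ fun t => (γ t).2) t = 0) := by
    intro hJ h₁ h₂ t ht
    have s₁ : (γ t).1 ∈ (chartAt H₁ (γ t).1).source := mem_chart_source H₁ _
    have s₂ : (γ t).2 ∈ (chartAt H₂ (γ t).2).source := mem_chart_source H₂ _
    have a₁ : ∀ᶠ s in 𝓝 t, ContMDiffAt 𝓘(ℝ, ℝ) I₁ 2 (fun t => (γ t).1) s := by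
      filter_upwards [hJ.mem_nhds ht] with s hs using h₁.contMDiffAt (hJ.mem_nhds hs)
    have a₂ : ∀ᶠ s in 𝓝 t, ContMDiffAt 𝓘(ℝ, ℝ) I₂ 2 (fun t => (γ t).2) s := by
      filter_upwards [hJ.mem_nhds ht] with s hs using h₂.contMDiffAt (hJ.mem_nhds hs)
    have a : ∀ᶠ s in 𝓝 t, ContMDiffAt 𝓘(ℝ, ℝ) (I₁.prod I₂) 2 γ s := by
      filter_upwards [a₁, a₂] with s hs hs' using hs.prodMk hs'
    rw [covDerivAlong_velocity_eq_zero_iff _ a (mem_chart_source _ (γ t)),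
      covDerivAlong_velocity_eq_zero_iff _ a₁ s₁, covDerivAlong_velocity_eq_zero_iff _ a₂ s₂]
    set x₁ : ℝ → E₁ := extChartAt I₁ (γ t).1 ∘ fun t => (γ t).1 with hx₁
    set x₂ : ℝ → E₂ := extChartAt I₂ (γ t).2 ∘ fun t => (γ t).2 with hx₂
    have hx : extChartAt (I₁.prod I₂) (γ t) ∘ γ = fun s => (x₁ s, x₂ s) := by
      rw [extChartAt_prod]
      rfl
    have htwo : (2 : ℕ∞ω) ≤ ∞ := WithTop.coe_le_coe.2 le_top
    have c₁ : ContDiffAt ℝ 2 x₁ t := contDiffAt_extChartAt_comp htwo a₁.self_of_nhds s₁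
    have c₂ : ContDiffAt ℝ 2 x₂ t := contDiffAt_extChartAt_comp htwo a₂.self_of_nhds s₂
    have d₁ : DifferentiableAt ℝ (deriv x₁) t :=
      ((c₁.fderiv_right (m := 1) (by norm_num)).clm_apply contDiffAt_const).differentiableAt
        (by norm_num)
    have d₂ : DifferentiableAt ℝ (deriv x₂) t :=
      ((c₂.fderiv_right (m := 1) (by norm_num)).clm_apply contDiffAt_const).differentiableAt
        (by norm_num)
    have hd : deriv (fun s => (x₁ s, x₂ s)) =ᶠ[𝓝 t] fun s => (deriv x₁ s, deriv x₂ s) := by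
      filter_upwards [c₁.eventually (by simp), c₂.eventually (by simp)] with s hs₁ hs₂
      exact ((hs₁.differentiableAt (by norm_num)).hasDerivAt.prodMk
        (hs₂.differentiableAt (by norm_num)).hasDerivAt).deriv
    have hdd : deriv (deriv fun s => (x₁ s, x₂ s)) t = (deriv (deriv x₁) t, deriv (deriv x₂) t) := by
      rw [hd.deriv_eq]
      exact (d₁.hasDerivAt.prodMk d₂.hasDerivAt).deriv
    have he : extChartAt (I₁.prod I₂) (γ t) (γ t) = (x₁ t, x₂ t) := congrFun hx t
    rw [hx, hdd, hd.self_of_nhds, he, spray_prod ((extChartAt I₁ (γ t).1).map_source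
      (mem_extChartAt_source _)) ((extChartAt I₂ (γ t).2).map_source (mem_extChartAt_source _)),
      Prod.mk_add_mk, Prod.mk_eq_zero]
    rfl
  constructor
  · intro h
    have h₁ : ContMDiffOn 𝓘(ℝ, ℝ) I₁ 2 (fun t => (γ t).1) J := fun t ht => (h.contMDiffOn t ht).fst
    have h₂ : ContMDiffOn 𝓘(ℝ, ℝ) I₂ 2 (fun t => (γ t).2) J := fun t ht => (h.contMDiffOn t ht).snd
    exact ⟨⟨h.isOpen, h.nonempty, h.ordConnected, h₁,
        fun t ht => ((key h.isOpen h₁ h₂ t ht).1 (h.geodesic_eq t ht)).1⟩,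
      ⟨h.isOpen, h.nonempty, h.ordConnected, h₂,
        fun t ht => ((key h.isOpen h₁ h₂ t ht).1 (h.geodesic_eq t ht)).2⟩⟩
  · rintro ⟨h₁, h₂⟩
    exact ⟨h₁.isOpen, h₁.nonempty, h₁.ordConnected, h₁.contMDiffOn.prodMk h₂.contMDiffOn,
      fun t ht => (key h₁.isOpen h₁.contMDiffOn h₂.contMDiffOn t ht).2
        ⟨h₁.geodesic_eq t ht, h₂.geodesic_eq t ht⟩⟩

lemma IsGeodesicOn.prod_const {γ : ℝ → M₁} {J : Set ℝ} (h : IsGeodesicOn D₁ γ J) (q : M₂) :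
    IsGeodesicOn (prodConnection D₁ D₂) (fun t => (γ t, q)) J :=
  isGeodesicOn_prod_iff.2 ⟨h, (isGeodesicOn_const q).mono h.isOpen h.nonempty h.ordConnected
    (subset_univ J)⟩

lemma IsGeodesicOn.const_prod {γ : ℝ → M₂} {J : Set ℝ} (h : IsGeodesicOn D₂ γ J) (q : M₁) :
    IsGeodesicOn (prodConnection D₁ D₂) (fun t => (q, γ t)) J :=
  isGeodesicOn_prod_iff.2 ⟨(isGeodesicOn_const q).mono h.isOpen h.nonempty h.ordConnected
    (subset_univ J), h⟩

/-- An inextendible geodesic of the first factor, paired with a constant, is inextendible in the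
product, because the first component of an extension would extend it. So neighborhoods can be
restricted to a slice. -/
lemma Nonreturning.fst [Nonempty M₂] (h : Nonreturning (prodConnection D₁ D₂)) :
    Nonreturning D₁ := by
  obtain ⟨q⟩ := ‹Nonempty M₂›
  intro p V hV
  obtain ⟨U, hU, hUV, hret⟩ := h (p, q) (Prod.fst ⁻¹' V) (continuous_fst.continuousAt hV)
  have hc : Continuous fun y : M₁ => (y, q) := by fun_prop
  refine ⟨(fun y => (y, q)) ⁻¹' U, hc.continuousAt hU, fun y hy => hUV hy,
    fun γ J hγ => hret (fun t => (γ t, q)) J ⟨hγ.1.prod_const q, fun γ' J' h' hJ he => ?_⟩⟩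
  exact hγ.2 _ J' (isGeodesicOn_prod_iff.1 h').1 hJ fun t ht => congrArg Prod.fst (he ht)

lemma Nonreturning.snd [Nonempty M₁] (h : Nonreturning (prodConnection D₁ D₂)) :
    Nonreturning D₂ := by
  obtain ⟨q⟩ := ‹Nonempty M₁›
  intro p V hV
  obtain ⟨U, hU, hUV, hret⟩ := h (q, p) (Prod.snd ⁻¹' V) (continuous_snd.continuousAt hV)
  have hc : Continuous fun y : M₂ => (q, y) := by fun_prop
  refine ⟨(fun y => (q, y)) ⁻¹' U, hc.continuousAt hU, fun y hy => hUV hy,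
    fun γ J hγ => hret (fun t => (q, γ t)) J ⟨hγ.1.const_prod q, fun γ' J' h' hJ he => ?_⟩⟩
  exact hγ.2 _ J' (isGeodesicOn_prod_iff.1 h').2 hJ fun t ht => congrArg Prod.snd (he ht)

/-- Downwards, compact sets are placed in a slice and the resulting compact set is projected.
Upwards, a compact set lies in the product of its projections, and the components of a segment are
segments. -/
lemma pseudoconvex_prod_iff [Nonempty M₁] [Nonempty M₂] :
    Pseudoconvex (prodConnection D₁ D₂) ↔ Pseudoconvex D₁ ∧ Pseudoconvex D₂ := by
  obtain ⟨q₁⟩ := ‹Nonempty M₁›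
  obtain ⟨q₂⟩ := ‹Nonempty M₂›
  refine ⟨fun h => ⟨fun K hK => ?_, fun K hK => ?_⟩, fun ⟨h₁, h₂⟩ K hK => ?_⟩
  · obtain ⟨K', hK', hseg⟩ := h (K ×ˢ {q₂}) (hK.prod isCompact_singleton)
    exact ⟨Prod.fst '' K', hK'.image continuous_fst, fun γ J hγ a ha b hb hab haK hbK t ht =>
      ⟨_, hseg _ J (hγ.prod_const q₂) a ha b hb hab ⟨haK, rfl⟩ ⟨hbK, rfl⟩ t ht, rfl⟩⟩
  · obtain ⟨K', hK', hseg⟩ := h ({q₁} ×ˢ K) (isCompact_singleton.prod hK)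
    exact ⟨Prod.snd '' K', hK'.image continuous_snd, fun γ J hγ a ha b hb hab haK hbK t ht =>
      ⟨_, hseg _ J (hγ.const_prod q₁) a ha b hb hab ⟨rfl, haK⟩ ⟨rfl, hbK⟩ t ht, rfl⟩⟩
  · obtain ⟨K₁, hK₁, hseg₁⟩ := h₁ _ (hK.image continuous_fst)
    obtain ⟨K₂, hK₂, hseg₂⟩ := h₂ _ (hK.image continuous_snd)
    refine ⟨K₁ ×ˢ K₂, hK₁.prod hK₂, fun γ J hγ a ha b hb hab haK hbK t ht => ?_⟩
    obtain ⟨hγ₁, hγ₂⟩ := isGeodesicOn_prod_iff.1 hγ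
    exact ⟨hseg₁ _ J hγ₁ a ha b hb hab ⟨_, haK, rfl⟩ ⟨_, hbK, rfl⟩ t ht,
      hseg₂ _ J hγ₂ a ha b hb hab ⟨_, haK, rfl⟩ ⟨_, hbK, rfl⟩ t ht⟩

end ProductConvexity

end GeodesicSpace

end

/-! ### The equivalences for a product -/

theorem mainTheorem5
    {E₁ : Type*} [NormedAddCommGroup E₁] [NormedSpace ℝ E₁] [FiniteDimensional ℝ E₁]
    {H₁ : Type*} [TopologicalSpace H₁] (I₁ : ModelWithCorners ℝ E₁ H₁) [I₁.Boundaryless]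
    {M₁ : Type*} [TopologicalSpace M₁] [ChartedSpace H₁ M₁] [IsManifold I₁ ∞ M₁]
    [T2Space M₁] [ParacompactSpace M₁] [ConnectedSpace M₁]
    {E₂ : Type*} [NormedAddCommGroup E₂] [NormedSpace ℝ E₂] [FiniteDimensional ℝ E₂]
    {H₂ : Type*} [TopologicalSpace H₂] (I₂ : ModelWithCorners ℝ E₂ H₂) [I₂.Boundaryless]
    {M₂ : Type*} [TopologicalSpace M₂] [ChartedSpace H₂ M₂] [IsManifold I₂ ∞ M₂]
    [T2Space M₂] [ParacompactSpace M₂] [ConnectedSpace M₂]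
    (D₁ : CovariantDerivative I₁ E₁ (TangentSpace I₁ : M₁ → Type _))
    (D₂ : CovariantDerivative I₂ E₂ (TangentSpace I₂ : M₂ → Type _))
    (hD₁ : D₁.ContMDiffCovariantDerivative ∞) (hD₂ : D₂.ContMDiffCovariantDerivative ∞)
    (hnr : GeodesicSpace.Nonreturning (GeodesicSpace.prodConnection D₁ D₂)) :
    List.TFAE [
      T2Space (GeodesicSpace.GeodesicQuotient (GeodesicSpace.prodConnection D₁ D₂)),
      GeodesicSpace.GeodesicQuotientIsManifold (GeodesicSpace.prodConnection D₁ D₂),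
      GeodesicSpace.Pseudoconvex (GeodesicSpace.prodConnection D₁ D₂),
      T2Space (GeodesicSpace.GeodesicQuotient D₁) ∧ T2Space (GeodesicSpace.GeodesicQuotient D₂),
      GeodesicSpace.GeodesicQuotientIsManifold D₁ ∧ GeodesicSpace.GeodesicQuotientIsManifold D₂,
      GeodesicSpace.Pseudoconvex D₁ ∧ GeodesicSpace.Pseudoconvex D₂] := by
  have : LocallyCompactSpace M₁ := Manifold.locallyCompact_of_finiteDimensional I₁
  have : LocallyCompactSpace M₂ := Manifold.locallyCompact_of_finiteDimensional I₂
  have := GeodesicSpace.sigmaCompactSpace_of_paracompact M₁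
  have := GeodesicSpace.sigmaCompactSpace_of_paracompact M₂
  have hS₁ := GeodesicSpace.smoothSpray_of_contMDiff hD₁
  have hS₂ := GeodesicSpace.smoothSpray_of_contMDiff hD₂
  obtain ⟨h12, h13⟩ := GeodesicSpace.nonreturning_tfae (hS₁.prod hS₂) hnr
  obtain ⟨a45, a46⟩ := GeodesicSpace.nonreturning_tfae hS₁ hnr.fst
  obtain ⟨b45, b46⟩ := GeodesicSpace.nonreturning_tfae hS₂ hnr.snd
  tfae_have 1 ↔ 2 := h12
  tfae_have 1 ↔ 3 := h13
  -- This is the only link between the product and its factors; the other equivalences concern one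
  -- connection at a time.
  tfae_have 3 ↔ 6 := GeodesicSpace.pseudoconvex_prod_iff
  tfae_have 4 ↔ 5 := and_congr a45 b45
  tfae_have 4 ↔ 6 := and_congr a46 b46
  tfae_finish
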